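/- All strings are binary. For a security parameter $\lambda$, a pseudorandom code (PRC) consists of polynomial-time randomized algorithms $\mathsf{KeyGen}(1^\lambda)$, which outputs a decoding key $\mathsf{dk}\in\{0,1\}^{\ell_{\rm dec}(\lambda)}$ and an encoding key $\mathsf{ek}\in\{0,1\}^{\ell_{\rm enc}(\lambda)}$; $\mathsf{Encode}(1^\lambda,\mathsf{ek},\cdot):\{0,1\}^{k(\lambda)}\to\{0,1\}^{n(\lambda)}$; and $\mathsf{Decode}(1^\lambda,\mathsf{dk},\cdot):\{0,1\}^*\to\{0,1\}^{k(\lambda)}\cup\{\bot\}$. In a secret-key PRC $\mathsf{dk}=\mathsf{ek}$. The function $n$ is the block length. A channel is a randomized map $\mathcal E:\{0,1\}^*\to\{0,1\}^*$. The triple is a (secret-key or public-key) PRC for (i.e. robust to) $\mathcal E$ if the following hold, where $\mathrm{negl}$ denotes negligible functions: - (Error correction) $\Pr[\mathsf{Decode}(1^\lambda,\mathsf{dk},\mathcal E(\mathsf{Encode}(1^\lambda,\mathsf{ek},\mathsf m)))=\mathsf m]\ge 1-\mathrm{negl}(\lambda)$, uniformly over all messages $\mathsf m\in\{0,1\}^{k(\lambda)}$.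 - (Soundness) $\Pr[\mathsf{Decode}(1^\lambda,\mathsf{dk},c)=\bot]\ge 1-\mathrm{negl}(\lambda)$, uniformly over all strings $c\in\{0,1\}^*$. - (Pseudorandomness) Every polynomial-time randomized adversary, given $1^\lambda$ (and $\mathsf{ek}$ in the public-key case) and oracle access either to $\mathsf{Encode}(1^\lambda,\mathsf{ek},\cdot)$ or to an oracle that answers each query with a fresh uniform string in $\{0,1\}^{n(\lambda)}$, distinguishes the two cases with advantage at most $\mathrm{negl}(\lambda)$. For real $r$, a length-preserving channel $\mathcal E$ is $r$-bounded if $\Pr_{x\leftarrow\{0,1\}^N}[\mathrm{wt}(\mathcal E(x)\oplus x)>rN]\le\mathrm{negl}(N)$ for all $N\in\mathbb N$. $\mathrm{BSC}_q$ flips each bit independently with probability $q$; $\mathrm{BDC}_p$ deletes each bit independently with probability $p$; and $\mathrm{BSC}_q\circ\mathrm{BDC}_p$ applies $\mathrm{BDC}_p$ first. For odd $m$, $\mathsf{MajEnc}_m$ replaces each bit $b$ of its input, independently, by a uniformly random string in $\{0,1\}^m$ conditioned on having majority $b$. $\mathsf{MajDec}_n$ splits its input $z$ into $n$ contiguous blocks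 of lengths within $1$ of $|z|/n$ and outputs the $n$ majorities of the blocks, ties being broken by independent uniform bits. For a PRC with block length $n$, $\mathsf{PRC}_{\rm del}[m,\mathsf{PRC}]$ has the same key generation, the encoder $\mathsf{MajEnc}_m\circ\mathsf{Encode}$ and the decoder $\mathsf{Decode}\circ\mathsf{MajDec}_n$. **Theorem.** For all constants $p\in(0,1)$ and $q\in(0,1/2)$ there exists $\varepsilon\in(0,1/2)$ such that the following holds, both for secret-key and for public-key PRCs. Let $\mathsf{PRC}$ have block length $n=n(\lambda)$, where $1^\lambda\mapsto 1^{n(\lambda)}$ is computable in polynomial time, and suppose that $\mathsf{PRC}$ is a PRC for every $(\tfrac12-\varepsilon)$-bounded channel. Then there exists a function $m=m(n)$ with odd values and $m=\Omega(n\log^6 n)$ such that $\mathsf{PRC}_{\rm del}[m,\mathsf{PRC}]$ is a PRC for the channel $\mathrm{BSC}_q\circ\mathrm{BDC}_p$. -/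

import Mathlib

open Filter Asymptotics

noncomputable section

namespace PRC

/-! ## Probability -/

/-- The probability of the event `S` under the discrete distribution `μ`. -/
def Pr {α : Type} (μ : PMF α) (S : Set α) : ℝ := (μ.toOuterMeasure S).toReal

/-- `f = O(1 / poly)` for every polynomial. -/
def Negligible (f : ℕ → ℝ) : Prop :=
  SuperpolynomialDecay atTop (fun n : ℕ => (n : ℝ)) f

/-- `Ber(p)`, with `true` for the bit `1`. -/
def ber (p : unitInterval) : PMF Bool :=
  PMF.ofFintype
    (fun b => if b then ENNReal.ofReal (p : ℝ) else ENNReal.ofReal (1 - (p : ℝ))) (by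
      have h := ENNReal.ofReal_add p.2.1 (sub_nonneg.2 p.2.2)
      simp [← h])

def fairBit : PMF Bool := PMF.uniformOfFintype Bool

/-- The uniform distribution on `{0,1}^n`. -/
def uniformString (n : ℕ) : PMF (List Bool) :=
  (PMF.uniformOfFintype (Fin n → Bool)).map List.ofFn

/-- Apply the randomized map `f` to every entry of a list, independently. -/
def mapIndep {α β : Type} (f : α → PMF β) : List α → PMF (List β)
  | [] => PMF.pure []
  | a :: l => (f a).bind fun b => (mapIndep f l).map fun l' => b :: l'

/-! ## Channels -/

/-- A binary channel: a randomized map from strings to strings. -/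
abbrev Channel : Type := List Bool → PMF (List Bool)

/-- `E ∘ F`: first apply `F`, then `E`. -/
def Channel.comp (E F : Channel) : Channel := fun x => (F x).bind E

/-- The binary symmetric channel with error rate `q`. -/
def BSC (q : unitInterval) : Channel :=
  mapIndep fun b => (ber q).map fun e => xor b e

/-- The binary deletion channel with deletion rate `p`. -/
def BDC (p : unitInterval) : Channel := fun x =>
  (mapIndep (fun b => (ber p).map fun d => if d then [] else [b]) x).map List.flatten

/-- `wt(x ⊕ y)`, for strings of equal length. -/
def diffWeight (x y : List Bool) : ℕ := (List.zipWith xor x y).count true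

/-- `E` is a length-preserving channel such that, on a uniform input of length `n`, it changes
more than `r * n` bits only with probability negligible in `n`. -/
def Channel.IsBounded (r : ℝ) (E : Channel) : Prop :=
  (∀ x, ∀ y ∈ (E x).support, y.length = x.length) ∧
  ∃ ν : ℕ → ℝ, Negligible ν ∧ ∀ n : ℕ,
    Pr ((uniformString n).bind fun x => (E x).map fun y => diffWeight y x)
      {w | r * (n : ℝ) < (w : ℝ)} ≤ ν n

/-! ## Polynomial-time randomized oracle algorithms

The machine model: programs over finitely many registers, each holding a bit string and used as
a stack, with fair coin tosses and oracle calls. Every instruction takes one step. In one step the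
longest register grows by at most one bit, or becomes an oracle answer, so that the model is
polynomially equivalent to (multi-tape, probabilistic, oracle) Turing machines. -/

inductive Prog : Type
  /-- do nothing -/
  | skip : Prog
  /-- put the bit `b` in front of register `r` -/
  | push (r : ℕ) (b : Bool) : Prog
  /-- remove the first bit of register `r` (if there is one) -/
  | pop (r : ℕ) : Prog
  /-- overwrite register `r'` by the contents of register `r` -/
  | copy (r r' : ℕ) : Prog
  /-- put a fresh uniform bit in front of register `r` -/
  | flip (r : ℕ) : Prog
  /-- query the oracle at the contents of register `r`, and store its answer in register `r'` -/
  | query (r r' : ℕ) : Prog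
  /-- first `P`, then `Q` -/
  | seq (P Q : Prog) : Prog
  /-- branch: register `r` is empty, or starts with `0`, or starts with `1` -/
  | branch (r : ℕ) (P P₀ P₁ : Prog) : Prog
  /-- repeat `P` as long as register `r` is not empty -/
  | loop (r : ℕ) (P : Prog) : Prog

/-- The contents of the registers. -/
abbrev State : Type := ℕ → List Bool

/-- A configuration: the programs that are still to be executed, and the registers. -/
abbrev Config : Type := List Prog × State

/-- A (stateless, randomized) oracle: each call is answered with fresh randomness. -/
abbrev Oracle : Type := List Bool → PMF (List Bool)

/-- The oracle of an algorithm that has no oracle: it always answers with the empty string. -/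
def noOracle : Oracle := fun _ => PMF.pure []

/-- One step of computation. A configuration with nothing left to execute has halted. -/
def step (O : Oracle) : Config → PMF Config
  | ([], s) => PMF.pure ([], s)
  | (Prog.skip :: k, s) => PMF.pure (k, s)
  | (Prog.push r b :: k, s) => PMF.pure (k, Function.update s r (b :: s r))
  | (Prog.pop r :: k, s) => PMF.pure (k, Function.update s r (s r).tail)
  | (Prog.copy r r' :: k, s) => PMF.pure (k, Function.update s r' (s r))
  | (Prog.flip r :: k, s) => fairBit.map fun b => (k, Function.update s r (b :: s r))
  | (Prog.query r r' :: k, s) => (O (s r)).map fun y => (k, Function.update s r' y)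
  | (Prog.seq P Q :: k, s) => PMF.pure (P :: Q :: k, s)
  | (Prog.branch r P P₀ P₁ :: k, s) =>
      match s r with
      | [] => PMF.pure (P :: k, s)
      | false :: _ => PMF.pure (P₀ :: k, s)
      | true :: _ => PMF.pure (P₁ :: k, s)
  | (Prog.loop r P :: k, s) =>
      match s r with
      | [] => PMF.pure (k, s)
      | _ :: _ => PMF.pure (P :: Prog.loop r P :: k, s)

/-- `t` steps of computation. -/
def steps (O : Oracle) : ℕ → Config → PMF Config
  | 0, c => PMF.pure c
  | t + 1, c => (step O c).bind (steps O t)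

/-- The start of `P` on the inputs `xs`: input number `i` is in register `i`, and all other
registers are empty. -/
def initial (P : Prog) (xs : List (List Bool)) : Config := ([P], fun i => xs.getD i [])

/-- The algorithm halts within `t` steps, whatever the outcomes of the coins and the oracle. -/
def HaltsWithin (O : Oracle) (P : Prog) (xs : List (List Bool)) (t : ℕ) : Prop :=
  ∀ c ∈ (steps O t (initial P xs)).support, c.1 = []

/-- The law of the registers after `t` steps. -/
def finalState (O : Oracle) (P : Prog) (xs : List (List Bool)) (t : ℕ) : PMF State :=
  (steps O t (initial P xs)).map Prod.snd

/-- Without an oracle and on the inputs `xs`, the algorithm `P` halts within `t` steps, and what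
`out` reads off the registers then has the law `μ`. -/
def Computes {α : Type} (P : Prog) (xs : List (List Bool)) (t : ℕ) (out : State → α)
    (μ : PMF α) : Prop :=
  HaltsWithin noOracle P xs t ∧ (finalState noOracle P xs t).map out = μ

/-- `1^n`. -/
def unary (n : ℕ) : List Bool := List.replicate n true

/-- `1^n ↦ 1^{f n}` is computable in polynomial time. -/
def PolyTimeLength (f : ℕ → ℕ) : Prop :=
  ∃ (P : Prog) (T : Polynomial ℕ), ∀ n : ℕ,
    Computes P [unary n] (T.eval n) (fun s => s 0) (PMF.pure (unary (f n)))

/-! ## Pseudorandom codes -/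

/-- The data of a pseudorandom code over the binary alphabet. The first argument of all three
randomized algorithms is the security parameter. A key pair consists of the decoding key and the
encoding key, in this order; `none` is the symbol `⊥`. -/
structure Scheme where
  decKeyLen : ℕ → ℕ
  encKeyLen : ℕ → ℕ
  blockLen : ℕ → ℕ
  msgLen : ℕ → ℕ
  keyGen : ℕ → PMF (List Bool × List Bool)
  encode : ℕ → List Bool → List Bool → PMF (List Bool)
  decode : ℕ → List Bool → List Bool → PMF (Option (List Bool))

/-- Secret-key or public-key codes. -/
inductive KeyMode : Type
  | secretKey
  | publicKey

/-- What the adversary knows of the encoding key. -/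
def KeyMode.view : KeyMode → List Bool → List Bool
  | KeyMode.secretKey, _ => []
  | KeyMode.publicKey, ek => ek

/-- The lengths of keys, messages and codewords. In a secret-key code the decoding key and the
encoding key are one and the same. -/
structure Scheme.WellTyped (S : Scheme) (mode : KeyMode) : Prop where
  keyGen : ∀ sec : ℕ, ∀ keys ∈ (S.keyGen sec).support,
    keys.1.length = S.decKeyLen sec ∧ keys.2.length = S.encKeyLen sec
  sameKey : mode = KeyMode.secretKey →
    ∀ sec : ℕ, ∀ keys ∈ (S.keyGen sec).support, keys.1 = keys.2
  encode : ∀ (sec : ℕ) (ek msg : List Bool), ek.length = S.encKeyLen sec →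
    msg.length = S.msgLen sec → ∀ x ∈ (S.encode sec ek msg).support, x.length = S.blockLen sec
  decode : ∀ (sec : ℕ) (dk c : List Bool), dk.length = S.decKeyLen sec →
    ∀ msg : List Bool, some msg ∈ (S.decode sec dk c).support → msg.length = S.msgLen sec

/-- The representation of decoder outputs by strings. -/
def encodeOption : Option (List Bool) → List Bool
  | none => []
  | some msg => true :: msg

/-- The three algorithms run in time polynomial in the total length of their inputs, the first of
which is the security parameter in unary. -/
structure Scheme.PolyTime (S : Scheme) : Prop where
  keyGen : ∃ (P : Prog) (T : Polynomial ℕ), ∀ sec : ℕ,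
    Computes P [unary sec] (T.eval sec) (fun s => (s 0, s 1)) (S.keyGen sec)
  encode : ∃ (P : Prog) (T : Polynomial ℕ), ∀ (sec : ℕ) (ek msg : List Bool),
    ek.length = S.encKeyLen sec → msg.length = S.msgLen sec →
      Computes P [unary sec, ek, msg] (T.eval (sec + ek.length + msg.length)) (fun s => s 0)
        (S.encode sec ek msg)
  decode : ∃ (P : Prog) (T : Polynomial ℕ), ∀ (sec : ℕ) (dk c : List Bool),
    dk.length = S.decKeyLen sec →
      Computes P [unary sec, dk, c] (T.eval (sec + dk.length + c.length)) (fun s => s 0)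
        ((S.decode sec dk c).map encodeOption)

/-- Error correction for the channel `E`. -/
def Scheme.Robust (S : Scheme) (E : Channel) : Prop :=
  ∃ ν : ℕ → ℝ, Negligible ν ∧ ∀ (sec : ℕ) (msg : List Bool), msg.length = S.msgLen sec →
    1 - ν sec ≤
      Pr ((S.keyGen sec).bind fun keys => (S.encode sec keys.2 msg).bind fun x =>
          (E x).bind fun y => S.decode sec keys.1 y)
        {some msg}

/-- A fixed string decodes to `⊥` with overwhelming probability over the choice of the keys. -/
def Scheme.Sound (S : Scheme) : Prop :=
  ∃ ν : ℕ → ℝ, Negligible ν ∧ ∀ (sec : ℕ) (c : List Bool),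
    1 - ν sec ≤ Pr ((S.keyGen sec).bind fun keys => S.decode sec keys.1 c) {none}

/-- The oracle `Encode(1^sec, ek, ·)`. A query that is not a message is rejected with the empty
string. -/
def Scheme.encodeOracle (S : Scheme) (sec : ℕ) (ek : List Bool) : Oracle := fun msg =>
  if msg.length = S.msgLen sec then S.encode sec ek msg else PMF.pure []

/-- The oracle that answers every message with a fresh uniform string of the length of a codeword.
A query that is not a message is rejected with the empty string. -/
def Scheme.uniformOracle (S : Scheme) (sec : ℕ) : Oracle := fun msg =>
  if msg.length = S.msgLen sec then uniformString (S.blockLen sec) else PMF.pure []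

/-- `A` runs in time `T` on security parameters and encoding keys, with any oracle whose answers
are as long as codewords (or empty, for rejected queries). -/
def Scheme.AdversaryTime (S : Scheme) (mode : KeyMode) (A : Prog) (T : Polynomial ℕ) : Prop :=
  ∀ (sec : ℕ) (ek : List Bool), ek.length = S.encKeyLen sec →
    ∀ O : Oracle, (∀ q, ∀ y ∈ (O q).support, y.length = S.blockLen sec ∨ y = []) →
      HaltsWithin O A [unary sec, mode.view ek] (T.eval sec)

/-- The probability that `A` outputs `1` when it has access to the oracle `O ek`, for a random
encoding key `ek`. -/
def Scheme.acceptProb (S : Scheme) (mode : KeyMode) (A : Prog) (t sec : ℕ)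
    (O : List Bool → Oracle) : ℝ :=
  Pr ((S.keyGen sec).bind fun keys =>
      finalState (O keys.2) A [unary sec, mode.view keys.2] t)
    {s | s 0 = [true]}

/-- No polynomial-time adversary tells the encoding oracle from the uniform oracle. -/
def Scheme.Pseudorandom (S : Scheme) (mode : KeyMode) : Prop :=
  ∀ (A : Prog) (T : Polynomial ℕ), S.AdversaryTime mode A T →
    Negligible fun sec =>
      |S.acceptProb mode A (T.eval sec) sec (fun ek => S.encodeOracle sec ek) -
        S.acceptProb mode A (T.eval sec) sec (fun _ => S.uniformOracle sec)|

/-- `S` is a (secret-key or public-key) pseudorandom code with robustness to the channel `E`. -/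
structure Scheme.IsPRC (S : Scheme) (mode : KeyMode) (E : Channel) : Prop where
  wellTyped : S.WellTyped mode
  polyTime : S.PolyTime
  robust : S.Robust E
  sound : S.Sound
  pseudorandom : S.Pseudorandom mode

/-! ## The majority code -/

/-- The majority of the bits of `y`, where a tie is resolved by a random bit. -/
def maj (y : List Bool) : PMF Bool :=
  if y.count false < y.count true then PMF.pure true
  else if y.count true < y.count false then PMF.pure false
  else fairBit

/-- The strings of odd length `m` with majority `b`; there are no ties among them. -/
def majSet (m : ℕ) (b : Bool) : Finset (Fin m → Bool) :=
  Finset.univ.filter fun y => (List.ofFn y).count (!b) < (List.ofFn y).count b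

theorem majSet_nonempty {m : ℕ} (hm : Odd m) (b : Bool) : (majSet m b).Nonempty := by
  refine ⟨fun _ => b, ?_⟩
  have h : (List.ofFn fun _ : Fin m => b) = List.replicate m b := by simp
  simp [majSet, h, List.count_replicate, hm.pos]

/-- A uniform string of odd length `m` conditioned on its majority being `b`. -/
def majEncBit (m : ℕ) (hm : Odd m) (b : Bool) : PMF (List Bool) :=
  (PMF.uniformOfFinset (majSet m b) (majSet_nonempty hm b)).map List.ofFn

/-- Encode every bit of `x` by a block of length `m`, independently. -/
def majEnc (m : ℕ) (hm : Odd m) (x : List Bool) : PMF (List Bool) :=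
  (mapIndep (majEncBit m hm) x).map List.flatten

/-- The even partition of `z` into `n` contiguous blocks: block `i` runs from position
`⌊i * |z| / n⌋` to position `⌊(i + 1) * |z| / n⌋`. -/
def blocks (n : ℕ) (z : List Bool) : List (List Bool) :=
  (List.range n).map fun i =>
    (z.drop (i * z.length / n)).take ((i + 1) * z.length / n - i * z.length / n)

/-- The majorities of the `n` blocks of `z`. -/
def majDec (n : ℕ) (z : List Bool) : PMF (List Bool) := mapIndep maj (blocks n z)

/-- The composition of a pseudorandom code with the majority code. Each bit of a codeword of
length `n` becomes a block of length `m n`. -/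
def Scheme.del (S : Scheme) (m : ℕ → ℕ) (hm : ∀ n, Odd (m n)) : Scheme where
  decKeyLen := S.decKeyLen
  encKeyLen := S.encKeyLen
  blockLen := fun sec => S.blockLen sec * m (S.blockLen sec)
  msgLen := S.msgLen
  keyGen := S.keyGen
  encode := fun sec ek msg =>
    (S.encode sec ek msg).bind (majEnc (m (S.blockLen sec)) (hm (S.blockLen sec)))
  decode := fun sec dk z => (majDec (S.blockLen sec) z).bind (S.decode sec dk)

end PRC

end

noncomputable section

namespace PRC

/-! ## Discrete probability -/

/-! Sending the composed code over `(BSC q).comp (BDC p)` amounts to sending the inner code over the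
single channel `innerChannel`: majority encoding, transmission, majority decoding. The hypothesis on
the inner code is used for this channel only, so the heart of the proof is that `innerChannel` is
(1/2 - ε)-bounded (`isBounded_innerChannel`), with ε = g² / 512, where g = (1 - p)(1 - 2q) is the
probability that a position is neither deleted nor replaced by a fresh bit.

For a uniform input x the encoding y is a uniform string, and x consists of the majorities of its
blocks (`uniformString_bind_majEncBit`). Noise of rate q is replacement by a fresh fair bit with
probability 2q (`channel_eq`). Fix the pattern σ of deletions and replacements. Then input bit i is
the sign of a sum of independent fair signs over an index set B, and decoded bit i is the sign of
such a sum over a set J (`errors_eq`). With blocks of length m = 2n² + 1 the numbers of kept and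
copied positions in a prefix fluctuate by about √(nm), so far below m that all of them are within δm
of their means except with probability exponentially small in n (`Prb_not_regular_le`). For such σ
the blocks are displaced by a small part of their length, and B ∩ J has at least gm/2 elements
(`Regular.le_card_inter`).

Signs of overlapping sums are correlated: with C = B ∩ J, the mean of their product is at least |C|²
/ (16 |B| |J|) (`le_Ex_sign_mul_sign`). Given the signs in C the two are independent, with
conditional means that are odd increasing functions of the sum over C; the product of the means is
the product of their absolute values, and Chebyshev's association inequality separates the factors.
So every bit is decoded with a constant advantage over guessing. Bits at distance at least 3 depend
on disjoint sets of coins, and a Chernoff bound in each residue class mod 3 bounds the number of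
errors.

Soundness holds because majority decoding ignores the keys. Pseudorandomness holds because majority
encoding maps uniform strings to uniform strings, so that an attack on the composed code is
simulated against the inner code (`pseudorandom_del`). That the algorithms and the simulation run in
polynomial time is proved on explicit programs, by the compositional correctness statement `Spec`.
-/

theorem Pr_nonneg {α : Type} (μ : PMF α) (S : Set α) : 0 ≤ Pr μ S := ENNReal.toReal_nonneg

theorem toOuterMeasure_le_one {α : Type} (μ : PMF α) (S : Set α) : μ.toOuterMeasure S ≤ 1 := by
  rw [PMF.toOuterMeasure_apply, ← μ.tsum_coe]
  exact ENNReal.tsum_le_tsum fun a => Set.indicator_le_self' (fun _ _ => zero_le) a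

theorem toOuterMeasure_ne_top {α : Type} (μ : PMF α) (S : Set α) : μ.toOuterMeasure S ≠ ⊤ :=
  ((toOuterMeasure_le_one μ S).trans_lt ENNReal.one_lt_top).ne

theorem Pr_map {α β : Type} (μ : PMF α) (f : α → β) (S : Set β) :
    Pr (μ.map f) S = Pr μ (f ⁻¹' S) := by
  rw [Pr, PMF.toOuterMeasure_map_apply, Pr]

theorem le_Pr_bind {α β : Type} (μ : PMF α) (f : α → PMF β) (S : Set β) (t : ℝ)
    (h : ∀ a ∈ μ.support, t ≤ Pr (f a) S) : t ≤ Pr (μ.bind f) S := by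
  refine (ENNReal.ofReal_le_iff_le_toReal (toOuterMeasure_ne_top _ _)).1 ?_
  rw [PMF.toOuterMeasure_bind_apply]
  calc ENNReal.ofReal t = ∑' a, μ a * ENNReal.ofReal t := by
        rw [ENNReal.tsum_mul_right, μ.tsum_coe, one_mul]
    _ ≤ _ := by
        refine ENNReal.tsum_le_tsum fun a => ?_
        by_cases ha : a ∈ μ.support
        · gcongr
          exact (ENNReal.ofReal_le_iff_le_toReal (toOuterMeasure_ne_top _ _)).2 (h a ha)
        · rw [PMF.mem_support_iff, not_not] at ha
          simp [ha]

/-- If the event `S` has probability at most `t` conditionally on every value outside `B`, it has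
probability at most `Pr μ B + t`. -/
theorem Pr_bind_le {α β : Type} (μ : PMF α) (f : α → PMF β) (S : Set β) (B : Set α) (t : ℝ)
    (ht : 0 ≤ t) (h : ∀ a ∉ B, Pr (f a) S ≤ t) : Pr (μ.bind f) S ≤ Pr μ B + t := by
  rw [← ENNReal.ofReal_le_ofReal_iff (add_nonneg (Pr_nonneg _ _) ht),
    ENNReal.ofReal_add (Pr_nonneg _ _) ht]
  simp only [Pr, ENNReal.ofReal_toReal (toOuterMeasure_ne_top _ _)]
  rw [PMF.toOuterMeasure_bind_apply, PMF.toOuterMeasure_apply]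
  calc ∑' a, μ a * (f a).toOuterMeasure S
      ≤ ∑' a, (B.indicator μ a + μ a * ENNReal.ofReal t) := by
        refine ENNReal.tsum_le_tsum fun a => ?_
        by_cases ha : a ∈ B
        · rw [Set.indicator_of_mem ha]
          exact le_add_right (mul_le_of_le_one_right' (toOuterMeasure_le_one _ _))
        · refine le_add_left ?_
          gcongr
          rw [ENNReal.le_ofReal_iff_toReal_le (toOuterMeasure_ne_top _ _) ht]
          exact h a ha
    _ = _ := by rw [ENNReal.tsum_add, ENNReal.tsum_mul_right, μ.tsum_coe, one_mul]

theorem bind_congr_support {α β : Type} (μ : PMF α) (f g : α → PMF β)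
    (h : ∀ a ∈ μ.support, f a = g a) : μ.bind f = μ.bind g := by
  ext b
  rw [PMF.bind_apply, PMF.bind_apply]
  refine tsum_congr fun a => ?_
  by_cases ha : a ∈ μ.support
  · rw [h a ha]
  · rw [PMF.mem_support_iff, not_not] at ha
    simp [ha]

theorem map_congr_support {α β : Type} (μ : PMF α) (f g : α → β)
    (h : ∀ a ∈ μ.support, f a = g a) : μ.map f = μ.map g :=
  bind_congr_support μ _ _ fun a ha => by simp [h a ha]

theorem map_bind_fun {α β γ : Type} (μ : PMF α) (f : α → PMF β) (g : β → γ) :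
    (μ.bind f).map g = μ.bind fun a => (f a).map g := by
  rw [PMF.map_bind]

theorem bind_map_fun {α β γ : Type} (μ : PMF α) (f : α → β) (g : β → PMF γ) :
    (μ.map f).bind g = μ.bind fun a => g (f a) := by
  rw [PMF.bind_map]; rfl

theorem map_eq_bind {α β : Type} (μ : PMF α) (f : α → β) :
    μ.map f = μ.bind fun a => PMF.pure (f a) := rfl

/-! ## Independent entries -/

section mapIndep

variable {α β γ : Type}

theorem mapIndep_cons (f : α → PMF β) (a : α) (l : List α) :
    mapIndep f (a :: l) = (f a).bind fun b => (mapIndep f l).map fun l' => b :: l' := rfl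

theorem length_of_mem_support_mapIndep (f : α → PMF β) (l : List α) :
    ∀ l' ∈ (mapIndep f l).support, l'.length = l.length := by
  induction l with
  | nil => intro l' h; simp_all [mapIndep]
  | cons a l ih =>
    intro l' h
    simp only [mapIndep, PMF.mem_support_bind_iff, PMF.mem_support_map_iff] at h
    obtain ⟨b, -, l'', h, rfl⟩ := h
    simp [ih _ h]

theorem forall_of_mem_support_mapIndep (f : α → PMF β) (p : β → Prop)
    (hp : ∀ a, ∀ b ∈ (f a).support, p b) (l : List α) :
    ∀ l' ∈ (mapIndep f l).support, ∀ b ∈ l', p b := by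
  induction l with
  | nil => intro l' h; simp_all [mapIndep]
  | cons a l ih =>
    intro l' h
    simp only [mapIndep, PMF.mem_support_bind_iff, PMF.mem_support_map_iff] at h
    obtain ⟨b, hb, l'', h, rfl⟩ := h
    intro x hx
    rcases List.mem_cons.1 hx with rfl | hx
    · exact hp _ _ hb
    · exact ih _ h _ hx

theorem mapIndep_append (f : α → PMF β) (l₁ l₂ : List α) :
    mapIndep f (l₁ ++ l₂) =
      (mapIndep f l₁).bind fun x => (mapIndep f l₂).map fun y => x ++ y := by
  induction l₁ with
  | nil => simp only [List.nil_append, mapIndep, PMF.pure_bind]; exact (PMF.map_id _).symm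
  | cons a l ih =>
    simp only [List.cons_append, mapIndep, ih, map_bind_fun, PMF.map_comp, PMF.bind_bind,
      bind_map_fun]
    rfl

/-- Moving a register bit by bit reverses it; this identity absorbs such reversals in the laws
computed by the programs. -/
theorem mapIndep_reverse (f : α → PMF β) (l : List α) :
    mapIndep f l.reverse = (mapIndep f l).map List.reverse := by
  induction l with
  | nil => simp [mapIndep, PMF.pure_map]
  | cons a l ih =>
    simp only [List.reverse_cons, mapIndep_append, ih, mapIndep, PMF.pure_map, map_bind_fun,
      PMF.map_comp, bind_map_fun]
    rw [PMF.bind_comm]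
    simp [map_eq_bind, Function.comp_def]

theorem mapIndep_bind (f : α → PMF β) (g : β → PMF γ) (l : List α) :
    (mapIndep f l).bind (mapIndep g) = mapIndep (fun a => (f a).bind g) l := by
  induction l with
  | nil => simp [mapIndep]
  | cons a l ih =>
    simp only [mapIndep, ← ih, map_bind_fun, PMF.bind_bind, bind_map_fun]
    congr 1; funext b
    rw [PMF.bind_comm]

theorem mapIndep_flatten (f : α → PMF β) (L : List (List α)) :
    mapIndep f L.flatten = (mapIndep (mapIndep f) L).map List.flatten := by
  induction L with
  | nil => simp [mapIndep, PMF.pure_map]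
  | cons l L ih =>
    simp only [List.flatten_cons, mapIndep_append, ih, mapIndep, map_bind_fun, PMF.map_comp]
    rfl

end mapIndep

/-! ### Uniform strings as independent fair bits. -/

theorem uniformString_zero : uniformString 0 = PMF.pure [] := by
  rw [uniformString, map_congr_support _ _ (fun _ => []) (fun a _ => by simp)]
  exact PMF.map_const _ _

theorem map_uniformOfFintype_equiv {α β : Type} [Fintype α] [Nonempty α] [Fintype β] [Nonempty β]
    (e : α ≃ β) : (PMF.uniformOfFintype α).map e = PMF.uniformOfFintype β := by
  classical
  ext b
  rw [PMF.map_apply, tsum_eq_single (e.symm b)]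
  · simp [Fintype.card_congr e]
  · intro a ha
    rw [if_neg]
    rintro rfl
    simp at ha

theorem bind_uniformOfFintype_prod {α β γ : Type} [Fintype α] [Nonempty α] [Fintype β] [Nonempty β]
    (F : α → β → γ) :
    ((PMF.uniformOfFintype α).bind fun a => (PMF.uniformOfFintype β).map (F a)) =
      (PMF.uniformOfFintype (α × β)).map fun x => F x.1 x.2 := by
  have h : (PMF.uniformOfFintype (α × β)) =
      (PMF.uniformOfFintype α).bind fun a => (PMF.uniformOfFintype β).map fun b => (a, b) := by
    classical
    ext ⟨a, b⟩
    rw [PMF.bind_apply, tsum_eq_single a, PMF.map_apply, tsum_eq_single b]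
    · simp [ENNReal.mul_inv]
    · intro b' hb
      rw [if_neg]
      simp [hb.symm]
    · intro a' ha
      rw [PMF.map_apply, ENNReal.tsum_eq_zero.2, mul_zero]
      intro b'
      rw [if_neg]
      simp [ha.symm]
  rw [h, map_bind_fun]
  simp only [PMF.map_comp]
  rfl

theorem uniformString_succ (n : ℕ) :
    uniformString (n + 1) = fairBit.bind fun b => (uniformString n).map fun l => b :: l := by
  rw [uniformString, ← map_uniformOfFintype_equiv (Fin.consEquiv fun _ : Fin (n + 1) => Bool)]
  simp only [uniformString, PMF.map_comp]
  rw [fairBit, bind_uniformOfFintype_prod]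
  refine map_congr_support _ _ _ fun a _ => ?_
  simp [Fin.consEquiv, List.ofFn_succ]

/-- The list supplies nothing but its length. In this form the lemmas on `mapIndep` apply to uniform
strings. -/
theorem uniformString_eq_mapIndep {α : Type} (l : List α) :
    uniformString l.length = mapIndep (fun _ => fairBit) l := by
  induction l with
  | nil => exact uniformString_zero
  | cons a l ih => rw [List.length_cons, uniformString_succ, ih]; rfl

theorem uniformString_add (a b : ℕ) :
    uniformString (a + b) =
      (uniformString a).bind fun x => (uniformString b).map fun y => x ++ y := by
  have h := uniformString_eq_mapIndep (List.replicate a () ++ List.replicate b ())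
  have ha := uniformString_eq_mapIndep (List.replicate a ())
  have hb := uniformString_eq_mapIndep (List.replicate b ())
  rw [mapIndep_append] at h
  simp only [List.length_append, List.length_replicate] at h ha hb
  rw [h, ha, hb]

theorem map_reverse_uniformString (n : ℕ) :
    (uniformString n).map List.reverse = uniformString n := by
  have h := uniformString_eq_mapIndep (List.replicate n ())
  rw [List.length_replicate] at h
  rw [h, ← mapIndep_reverse, List.reverse_replicate]

theorem length_of_mem_support_uniformString {n : ℕ} {l : List Bool}
    (h : l ∈ (uniformString n).support) : l.length = n := by
  rw [uniformString, PMF.mem_support_map_iff] at h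
  obtain ⟨f, -, rfl⟩ := h
  simp

/-! ## Laws of halting computations -/

/-- From the configuration `c`, the computation halts within `t` steps, and the registers then
have the law `ν`. -/
def HaltsWithLaw (O : Oracle) (c : Config) (t : ℕ) (ν : PMF State) : Prop :=
  steps O t c = ν.map fun s => ([], s)

theorem steps_nil (O : Oracle) (t : ℕ) (s : State) : steps O t ([], s) = PMF.pure ([], s) := by
  induction t with
  | zero => rfl
  | succ t ih => simp [steps, step, ih]

theorem steps_add (O : Oracle) (t u : ℕ) (c : Config) :
    steps O (t + u) c = (steps O t c).bind (steps O u) := by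
  induction t generalizing c with
  | zero => simp [steps]
  | succ t ih =>
    rw [Nat.succ_add]
    simp only [steps, PMF.bind_bind]
    congr 1; funext c'; exact ih c'

/-- A halted configuration is a fixed point of `step`, so time bounds may be relaxed freely. -/
theorem HaltsWithLaw.mono {O : Oracle} {c : Config} {t u : ℕ} {ν : PMF State} (h : HaltsWithLaw O c t ν)
    (htu : t ≤ u) : HaltsWithLaw O c u ν := by
  obtain ⟨d, rfl⟩ := Nat.exists_eq_add_of_le htu
  rw [HaltsWithLaw, steps_add, h, bind_map_fun]
  simp only [steps_nil]
  rfl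

theorem HaltsWithLaw.nil (O : Oracle) (s : State) (t : ℕ) : HaltsWithLaw O ([], s) t (PMF.pure s) := by
  rw [HaltsWithLaw, steps_nil, PMF.pure_map]

/-- `c` halts within `t` steps, whatever the outcomes of the coins and the oracle. -/
def Halts (O : Oracle) (c : Config) (t : ℕ) : Prop := ∀ c' ∈ (steps O t c).support, c'.1 = []

/-- The law of the registers after `t` steps. -/
def law (O : Oracle) (c : Config) (t : ℕ) : PMF State := (steps O t c).map Prod.snd

theorem Halts.haltsWithLaw {O : Oracle} {c : Config} {t : ℕ} (h : Halts O c t) : HaltsWithLaw O c t (law O c t) := by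
  rw [HaltsWithLaw, law, PMF.map_comp]
  conv_lhs => rw [← PMF.map_id (steps O t c)]
  refine map_congr_support _ _ _ fun c' hc' => ?_
  have := h c' hc'
  obtain ⟨l, s⟩ := c'
  simp_all

theorem HaltsWithLaw.halts {O : Oracle} {c : Config} {t : ℕ} {ν : PMF State} (h : HaltsWithLaw O c t ν) :
    Halts O c t := by
  intro c' hc'
  rw [h, PMF.mem_support_map_iff] at hc'
  obtain ⟨s, -, rfl⟩ := hc'
  rfl

theorem HaltsWithLaw.law_eq {O : Oracle} {c : Config} {t : ℕ} {ν : PMF State} (h : HaltsWithLaw O c t ν) :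
    law O c t = ν := by
  rw [law, h, PMF.map_comp]
  exact PMF.map_id _

theorem Halts.of_step {O : Oracle} {c : Config} {t : ℕ} (h : Halts O c (t + 1)) :
    ∀ c' ∈ (step O c).support, Halts O c' t := by
  intro c' hc' c'' hc''
  refine h c'' ?_
  rw [steps, PMF.mem_support_bind_iff]
  exact ⟨c', hc', hc''⟩

theorem law_succ (O : Oracle) (c : Config) (t : ℕ) :
    law O c (t + 1) = (step O c).bind fun c' => law O c' t := by
  rw [law, steps, map_bind_fun]; rfl

/-- Started on the registers `s`, the program `P` takes at most `t` steps and leaves the registers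
with the law `ν`. -/
def Spec (O : Oracle) (P : Prog) (s : State) (t : ℕ) (ν : PMF State) : Prop :=
  ∀ (k : List Prog) (T : ℕ) (f : State → PMF State), (∀ s' ∈ ν.support, HaltsWithLaw O (k, s') T (f s')) →
    HaltsWithLaw O (P :: k, s) (t + T) (ν.bind f)

theorem Spec.haltsWithLaw {O : Oracle} {P : Prog} {s : State} {t : ℕ} {ν : PMF State}
    (h : Spec O P s t ν) : HaltsWithLaw O ([P], s) t ν := by
  have := h [] 0 PMF.pure fun s' _ => HaltsWithLaw.nil O s' 0
  simpa using this

theorem Spec.mono {O : Oracle} {P : Prog} {s : State} {t u : ℕ} {ν : PMF State}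
    (h : Spec O P s t ν) (htu : t ≤ u) : Spec O P s u ν :=
  fun k T f hf => (h k T f hf).mono (by omega)

theorem Spec.congr {O : Oracle} {P : Prog} {s s' : State} {t u : ℕ} {ν ν' : PMF State}
    (h : Spec O P s' t ν') (hs : s = s') (htu : t ≤ u) (hν : ν = ν') : Spec O P s u ν := by
  subst hs hν
  exact h.mono htu

/-- One step looks only at the head of the stack of programs, so whatever lies below `l` is inert
until `l` is used up. A run that finishes `l` early merely leaves some of the `t` steps unused. -/
theorem haltsWithLaw_append {O : Oracle} (t : ℕ) : ∀ (l : List Prog) (s : State), Halts O (l, s) t →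
    ∀ (k : List Prog) (T : ℕ) (f : State → PMF State),
      (∀ s' ∈ (law O (l, s) t).support, HaltsWithLaw O (k, s') T (f s')) →
      HaltsWithLaw O (l ++ k, s) (t + T) ((law O (l, s) t).bind f) := by
  induction t with
  | zero =>
    intro l s h k T f hf
    have hl : l = [] := h (l, s) (by simp [steps])
    subst hl
    simp only [law, steps, PMF.pure_map, PMF.pure_bind, List.nil_append] at hf ⊢
    exact (hf _ (by simp)).mono (by simp)
  | succ t ih =>
    intro l s h k T f hf
    match l with
    | [] =>
      simp only [law, steps_nil, PMF.pure_map, PMF.pure_bind, List.nil_append] at hf ⊢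
      exact (hf _ (by simp)).mono (by simp)
    | P :: l =>
      have hstep : step O (P :: l ++ k, s) =
          (step O (P :: l, s)).map fun c => (c.1 ++ k, c.2) := by
        cases P <;> simp only [List.cons_append, step, PMF.pure_map, PMF.map_comp] <;>
          first
          | rfl
          | (split <;> simp [PMF.pure_map])
      rw [law_succ, PMF.bind_bind, show t + 1 + T = (t + T) + 1 by omega]
      rw [law_succ] at hf
      have key : ∀ c' ∈ (step O (P :: l, s)).support,
          HaltsWithLaw O (c'.1 ++ k, c'.2) (t + T) ((law O c' t).bind f) := by
        intro c' hc'
        refine ih c'.1 c'.2 (h.of_step c' hc') k T f fun s' hs' => hf s' ?_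
        rw [PMF.mem_support_bind_iff]
        exact ⟨c', hc', hs'⟩
      rw [HaltsWithLaw, steps, hstep, bind_map_fun, map_bind_fun]
      exact bind_congr_support _ _ _ key

/-- A run of `P` alone already determines its behaviour on top of any stack. This is how programs
known only through `Computes` enter the calculus. -/
theorem Halts.spec {O : Oracle} {P : Prog} {s : State} {t : ℕ} (h : Halts O ([P], s) t) :
    Spec O P s t (law O ([P], s) t) :=
  fun k T f hf => haltsWithLaw_append t [P] s h k T f hf

/-! ### Rules for single instructions and for control structures. -/

section rules

variable {O : Oracle} {s : State}

theorem spec_of_step {P : Prog} {ν : PMF State}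
    (h : ∀ k, step O (P :: k, s) = ν.map fun s' => (k, s')) : Spec O P s 1 ν := by
  intro k T f hf
  rw [HaltsWithLaw, add_comm, steps, h, bind_map_fun, map_bind_fun]
  exact bind_congr_support _ _ _ hf

theorem spec_skip : Spec O Prog.skip s 1 (PMF.pure s) :=
  spec_of_step fun k => by simp [step, PMF.pure_map]

theorem spec_push (r : ℕ) (b : Bool) :
    Spec O (Prog.push r b) s 1 (PMF.pure (Function.update s r (b :: s r))) :=
  spec_of_step fun k => by simp [step, PMF.pure_map]

theorem spec_pop (r : ℕ) :
    Spec O (Prog.pop r) s 1 (PMF.pure (Function.update s r (s r).tail)) :=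
  spec_of_step fun k => by simp [step, PMF.pure_map]

theorem spec_copy (r r' : ℕ) :
    Spec O (Prog.copy r r') s 1 (PMF.pure (Function.update s r' (s r))) :=
  spec_of_step fun k => by simp [step, PMF.pure_map]

theorem spec_flip (r : ℕ) :
    Spec O (Prog.flip r) s 1 (fairBit.map fun b => Function.update s r (b :: s r)) :=
  spec_of_step fun k => by simp [step, PMF.map_comp, Function.comp_def]

theorem spec_query (r r' : ℕ) :
    Spec O (Prog.query r r') s 1 ((O (s r)).map fun y => Function.update s r' y) :=
  spec_of_step fun k => by simp [step, PMF.map_comp, Function.comp_def]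

/-- A first step that deterministically leads to another stack of programs. -/
theorem spec_of_unfold {P : Prog} {t : ℕ} {ν : PMF State} (Q : List Prog)
    (h : ∀ k, step O (P :: k, s) = PMF.pure (Q ++ k, s))
    (hQ : ∀ (k : List Prog) (T : ℕ) (f : State → PMF State),
      (∀ s' ∈ ν.support, HaltsWithLaw O (k, s') T (f s')) → HaltsWithLaw O (Q ++ k, s) (t + T) (ν.bind f)) :
    Spec O P s (t + 1) ν := by
  intro k T f hf
  rw [HaltsWithLaw, show t + 1 + T = (t + T) + 1 by omega, steps, h, PMF.pure_bind]
  exact hQ k T f hf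

/-- The stack below `P` is taken to be `Q :: k`; this is why `Spec` quantifies over all
continuations. -/
theorem Spec.seq_bind {P Q : Prog} {t u : ℕ} {ν : PMF State} {g : State → PMF State}
    (hP : Spec O P s t ν) (hQ : ∀ s' ∈ ν.support, Spec O Q s' u (g s')) :
    Spec O (Prog.seq P Q) s (t + u + 1) (ν.bind g) := by
  refine spec_of_unfold [P, Q] (fun k => rfl) fun k T f hf => ?_
  rw [PMF.bind_bind, add_assoc]
  refine hP (Q :: k) (u + T) _ fun s' hs' => hQ s' hs' k T f fun s'' hs'' => hf s'' ?_
  rw [PMF.mem_support_bind_iff]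
  exact ⟨s', hs', hs''⟩

theorem Spec.seq {P Q : Prog} {t u : ℕ} {s' : State} {ν : PMF State}
    (hP : Spec O P s t (PMF.pure s')) (hQ : Spec O Q s' u ν) :
    Spec O (Prog.seq P Q) s (t + u + 1) ν := by
  have := hP.seq_bind (Q := Q) (u := u) (g := fun _ => ν) (by
    intro s'' h
    rw [PMF.support_pure, Set.mem_singleton_iff] at h
    rwa [h])
  simpa using this

theorem spec_branch_nil {r : ℕ} {P P₀ P₁ : Prog} {t : ℕ} {ν : PMF State} (hr : s r = [])
    (h : Spec O P s t ν) : Spec O (Prog.branch r P P₀ P₁) s (t + 1) ν :=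
  spec_of_unfold [P] (fun k => by simp [step, hr]) h

theorem spec_branch_cons {r : ℕ} {P P₀ P₁ : Prog} {t : ℕ} {ν : PMF State} {b : Bool}
    {l : List Bool} (hr : s r = b :: l) (h : Spec O (if b then P₁ else P₀) s t ν) :
    Spec O (Prog.branch r P P₀ P₁) s (t + 1) ν :=
  spec_of_unfold [if b then P₁ else P₀] (fun k => by cases b <;> simp [step, hr]) h

theorem spec_loop_nil {r : ℕ} {P : Prog} (hr : s r = []) :
    Spec O (Prog.loop r P) s 1 (PMF.pure s) :=
  (spec_of_unfold (t := 0) [] (fun k => by simp [step, hr]) fun k T f hf => by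
    simpa using hf s (by simp))

theorem spec_loop_cons {r : ℕ} {P : Prog} {t u : ℕ} {b : Bool} {l : List Bool} {ν : PMF State}
    {g : State → PMF State} (hr : s r = b :: l)
    (hP : Spec O P s t ν) (hL : ∀ s' ∈ ν.support, Spec O (Prog.loop r P) s' u (g s')) :
    Spec O (Prog.loop r P) s (t + u + 1) (ν.bind g) := by
  refine spec_of_unfold [P, Prog.loop r P] (fun k => by simp [step, hr]) fun k T f hf => ?_
  rw [PMF.bind_bind, add_assoc]
  refine hP (Prog.loop r P :: k) (u + T) _
    fun s' hs' => hL s' hs' k T f fun s'' hs'' => hf s'' ?_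
  rw [PMF.mem_support_bind_iff]
  exact ⟨s', hs', hs''⟩

theorem Spec.law_eq {P : Prog} {t : ℕ} {ν : PMF State} (h : Spec O P s t ν) :
    law O ([P], s) t = ν :=
  h.haltsWithLaw.law_eq

/-- Intermediate states are described by data `x` through `I`, which need not be injective. Hence
the law after `Q` is first written as a function of the state, by `law`, and only then identified
with `g x`. -/
theorem Spec.seq_map {X : Type} {P Q : Prog} {t u : ℕ} {μ : PMF X} {I : X → State}
    {g : X → PMF State} (hP : Spec O P s t (μ.map I))
    (hQ : ∀ x ∈ μ.support, Spec O Q (I x) u (g x)) :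
    Spec O (Prog.seq P Q) s (t + u + 1) (μ.bind g) := by
  have := hP.seq_bind (Q := Q) (u := u) (g := fun s' => law O ([Q], s') u) (by
    intro s' hs'
    rw [PMF.mem_support_map_iff] at hs'
    obtain ⟨x, hx, rfl⟩ := hs'
    rw [(hQ x hx).law_eq]
    exact hQ x hx)
  rw [bind_map_fun] at this
  rwa [bind_congr_support _ _ _ fun x hx => (hQ x hx).law_eq] at this

theorem spec_loop_map {X : Type} {r : ℕ} {P : Prog} {t u : ℕ} {b : Bool} {l : List Bool}
    {μ : PMF X} {I : X → State} {g : X → PMF State} (hr : s r = b :: l)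
    (hP : Spec O P s t (μ.map I)) (hL : ∀ x ∈ μ.support, Spec O (Prog.loop r P) (I x) u (g x)) :
    Spec O (Prog.loop r P) s (t + u + 1) (μ.bind g) := by
  have := spec_loop_cons (u := u) (g := fun s' => law O ([Prog.loop r P], s') u) hr hP (by
    intro s' hs'
    rw [PMF.mem_support_map_iff] at hs'
    obtain ⟨x, hx, rfl⟩ := hs'
    rw [(hL x hx).law_eq]
    exact hL x hx)
  rw [bind_map_fun] at this
  rwa [bind_congr_support _ _ _ fun x hx => (hL x hx).law_eq] at this

end rules

/-- Pop the bits of register `r` one by one, and run `P₀` or `P₁` for each of them. -/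
def forBits (r : ℕ) (P₀ P₁ : Prog) : Prog :=
  Prog.loop r (Prog.branch r Prog.skip
    (Prog.seq (Prog.pop r) P₀) (Prog.seq (Prog.pop r) P₁))

/-- Fold of a randomized update over a list. -/
def foldP {α X : Type} (β : α → X → PMF X) : List α → X → PMF X
  | [], x => PMF.pure x
  | a :: l, x => (β a x).bind (foldP β l)

/-- `I l x` describes the registers when the bits `l` are still to be processed. -/
theorem spec_forBits {O : Oracle} {X : Type} {r : ℕ} {P₀ P₁ : Prog} {t : ℕ}
    (I : List Bool → X → State) (β : Bool → X → PMF X) (Q : List Bool → X → Prop)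
    (hI : ∀ l x, I l x r = l)
    (hpop : ∀ b l x, Function.update (I (b :: l) x) r l = I l x)
    (hbody : ∀ b l x, Q (b :: l) x →
      Spec O (if b then P₁ else P₀) (I l x) t ((β b x).map (I l)))
    (hQ : ∀ b l x, Q (b :: l) x → ∀ x' ∈ (β b x).support, Q l x') :
    ∀ l x, Q l x →
      Spec O (forBits r P₀ P₁) (I l x) (l.length * (t + 4) + 1) ((foldP β l x).map (I [])) := by
  intro l
  induction l with
  | nil =>
    intro x _
    refine (spec_loop_nil (hI _ _)).congr rfl (by simp) ?_
    rw [foldP, PMF.pure_map]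
  | cons b l ih =>
    intro x hx
    -- Apart from the body, each bit costs four steps: the loop test, the branch, the `seq` and the
    -- `pop`. The final `+ 1` is the last loop test. The empty case of the branch is never reached.
    have hP : Spec O (Prog.branch r Prog.skip (Prog.seq (Prog.pop r) P₀)
        (Prog.seq (Prog.pop r) P₁)) (I (b :: l) x) (1 + t + 1 + 1) ((β b x).map (I l)) := by
      refine spec_branch_cons (hI _ _) ?_
      have h1 := (spec_pop (O := O) (s := I (b :: l) x) r)
      rw [hI, List.tail_cons, hpop] at h1
      have h2 := h1.seq (hbody b l x hx)
      cases b <;> simpa using h2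
    have := spec_loop_map (hI _ _) hP fun x' hx' => ih x' (hQ b l x hx x' hx')
    refine this.congr rfl ?_ ?_
    · simp only [List.length_cons]; ring_nf; omega
    · rw [foldP, map_bind_fun]

/-- `forBits` with a deterministic body. -/
theorem spec_forBits_pure {O : Oracle} {X : Type} {r : ℕ} {P₀ P₁ : Prog} {t : ℕ}
    (I : List Bool → X → State) (β : Bool → X → X) (Q : List Bool → X → Prop)
    (hI : ∀ l x, I l x r = l)
    (hpop : ∀ b l x, Function.update (I (b :: l) x) r l = I l x)
    (hbody : ∀ b l x, Q (b :: l) x →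
      Spec O (if b then P₁ else P₀) (I l x) t (PMF.pure (I l (β b x))))
    (hQ : ∀ b l x, Q (b :: l) x → Q l (β b x)) (l : List Bool) (x : X) (hx : Q l x) :
    Spec O (forBits r P₀ P₁) (I l x) (l.length * (t + 4) + 1)
      (PMF.pure (I [] (l.foldl (fun x b => β b x) x))) := by
  refine (spec_forBits (t := t) I (fun b x => PMF.pure (β b x)) Q hI hpop ?_ ?_ l x hx).congr rfl
    le_rfl ?_
  · intro b l x h
    rw [PMF.pure_map]
    exact hbody b l x h
  · intro b l x h x' hx'
    rw [PMF.support_pure, Set.mem_singleton_iff] at hx'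
    rw [hx']
    exact hQ b l x h
  · clear hx
    induction l generalizing x with
    | nil => simp [foldP, PMF.pure_map]
    | cons b l ih => simpa [foldP] using ih (β b x)

/-- The invariant of a fold that collects independent outputs in front of an accumulator. -/
theorem foldP_mapIndep {α β Y : Type} (f : α → PMF β) (g : β → Y → Y) (l : List α) (acc : Y) :
    foldP (fun a y => (f a).map fun b => g b y) l acc =
      (mapIndep f l).map fun l' => l'.foldl (fun y b => g b y) acc := by
  induction l generalizing acc with
  | nil => simp [foldP, mapIndep, PMF.pure_map]
  | cons a l ih =>
    simp only [foldP, mapIndep, bind_map_fun, map_bind_fun, PMF.map_comp]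
    congr 1; funext b
    rw [ih]
    rfl

/-! ## Translation of programs -/

/-- Rename the registers by `ρ`, and replace oracle queries by the subroutine `sub`. -/
def Prog.translate (ρ : ℕ → ℕ) (sub : ℕ → ℕ → Prog) : Prog → Prog
  | Prog.skip => Prog.skip
  | Prog.push r b => Prog.push (ρ r) b
  | Prog.pop r => Prog.pop (ρ r)
  | Prog.copy r r' => Prog.copy (ρ r) (ρ r')
  | Prog.flip r => Prog.flip (ρ r)
  | Prog.query r r' => sub (ρ r) (ρ r')
  | Prog.seq P Q => Prog.seq (P.translate ρ sub) (Q.translate ρ sub)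
  | Prog.branch r P P₀ P₁ =>
      Prog.branch (ρ r) (P.translate ρ sub) (P₀.translate ρ sub) (P₁.translate ρ sub)
  | Prog.loop r P => Prog.loop (ρ r) (P.translate ρ sub)

section translate

variable {ρ : ℕ → ℕ} {sub : ℕ → ℕ → Prog} {emb : State → State} {O O' : Oracle} {C : ℕ}

theorem haltsWithLaw_of_spec {P : Prog} {s : State} {k : List Prog} {T : ℕ} {X : Type} {μ : PMF X}
    {I : X → State} {g : X → PMF State} (h : Spec O P s C (μ.map I))
    (hk : ∀ x ∈ μ.support, HaltsWithLaw O (k, I x) T (g x)) : HaltsWithLaw O (P :: k, s) (C + T) (μ.bind g) := by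
  have := h k T (fun s' => law O (k, s') T) (by
    intro s' hs'
    rw [PMF.mem_support_map_iff] at hs'
    obtain ⟨x, hx, rfl⟩ := hs'
    exact (hk x hx).halts.haltsWithLaw)
  rw [bind_map_fun] at this
  rwa [bind_congr_support _ _ _ fun x hx => (hk x hx).law_eq] at this

/-- Step-by-step simulation: each step of the original run costs at most `C` steps of the translated
one, `C` being the cost of the subroutine that answers a query. -/
theorem haltsWithLaw_translate (hC : 1 ≤ C) (hemb : ∀ a r, emb a (ρ r) = a r)
    (hupd : ∀ a r v, Function.update (emb a) (ρ r) v = emb (Function.update a r v))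
    (hsub : ∀ a r r', Spec O (sub (ρ r) (ρ r')) (emb a) C
      ((O' (a r)).map fun y => emb (Function.update a r' y)))
    (t : ℕ) : ∀ (l : List Prog) (a : State), Halts O' (l, a) t →
      HaltsWithLaw O (l.map (Prog.translate ρ sub), emb a) (t * C) ((law O' (l, a) t).map emb) := by
  induction t with
  | zero =>
    intro l a h
    have hl : l = [] := h (l, a) (by simp [steps])
    subst hl
    simp only [law, steps, PMF.pure_map, List.map_nil]
    exact HaltsWithLaw.nil _ _ _
  | succ t ih =>
    intro l a h
    -- The instructions that act on the registers.
    have halt : ∀ (μ : PMF State) (P : Prog) (k : List Prog), l = P :: k →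
        step O' (P :: k, a) = μ.map (fun a' => (k, a')) →
        Spec O (P.translate ρ sub) (emb a) C (μ.map emb) →
        HaltsWithLaw O (l.map (Prog.translate ρ sub), emb a) ((t + 1) * C)
          ((law O' (l, a) (t + 1)).map emb) := by
      rintro μ P k rfl hstep hspec
      rw [law_succ, hstep, bind_map_fun, map_bind_fun, add_mul, one_mul, add_comm]
      refine haltsWithLaw_of_spec hspec fun a' ha' => ih k a' (h.of_step _ ?_)
      rw [hstep, PMF.mem_support_map_iff]
      exact ⟨a', ha', rfl⟩
    -- The control instructions, which only rearrange the stack of programs.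
    have jump : ∀ (P : Prog) (k Q : List Prog), l = P :: k →
        step O' (P :: k, a) = PMF.pure (Q, a) →
        step O ((P :: k).map (Prog.translate ρ sub), emb a) =
          PMF.pure (Q.map (Prog.translate ρ sub), emb a) →
        HaltsWithLaw O (l.map (Prog.translate ρ sub), emb a) ((t + 1) * C)
          ((law O' (l, a) (t + 1)).map emb) := by
      rintro P k Q rfl hstep hstep'
      have hQ := ih Q a (h.of_step _ (by rw [hstep]; simp))
      rw [law_succ, hstep, PMF.pure_bind]
      refine HaltsWithLaw.mono (t := t * C + 1) ?_ (by rw [add_mul]; omega)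
      rw [HaltsWithLaw, steps, hstep', PMF.pure_bind]
      exact hQ
    match l with
    | [] =>
      rw [law, steps_nil, PMF.pure_map, PMF.pure_map]
      exact HaltsWithLaw.nil _ _ _
    | Prog.skip :: k =>
      refine halt (PMF.pure a) _ k rfl (by simp [step, PMF.pure_map]) ?_
      exact spec_skip.congr rfl hC (by simp [PMF.pure_map])
    | Prog.push r b :: k =>
      refine halt (PMF.pure _) _ k rfl (by simp only [step, PMF.pure_map]; rfl) ?_
      exact (spec_push _ _).congr rfl hC (by simp [PMF.pure_map, hemb, hupd])
    | Prog.pop r :: k =>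
      refine halt (PMF.pure _) _ k rfl (by simp only [step, PMF.pure_map]; rfl) ?_
      exact (spec_pop _).congr rfl hC (by simp [PMF.pure_map, hemb, hupd])
    | Prog.copy r r' :: k =>
      refine halt (PMF.pure _) _ k rfl (by simp only [step, PMF.pure_map]; rfl) ?_
      exact (spec_copy _ _).congr rfl hC (by simp [PMF.pure_map, hemb, hupd])
    | Prog.flip r :: k =>
      refine halt (fairBit.map fun b => Function.update a r (b :: a r)) _ k rfl
        (by simp [step, PMF.map_comp, Function.comp_def]) ?_
      exact (spec_flip _).congr rfl hC (by simp [PMF.map_comp, Function.comp_def, hemb, hupd])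
    | Prog.query r r' :: k =>
      refine halt ((O' (a r)).map fun y => Function.update a r' y) _ k rfl
        (by simp [step, PMF.map_comp, Function.comp_def]) ?_
      exact (hsub a r r').congr rfl le_rfl (by simp [PMF.map_comp, Function.comp_def])
    | Prog.seq P Q :: k => exact jump _ k (P :: Q :: k) rfl rfl rfl
    | Prog.branch r P P₀ P₁ :: k =>
      rcases hr : a r with _ | ⟨_ | _, l'⟩
      · exact jump _ k (P :: k) rfl (by simp [step, hr])
          (by simp [Prog.translate, step, hemb, hr])
      · exact jump _ k (P₀ :: k) rfl (by simp [step, hr])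
          (by simp [Prog.translate, step, hemb, hr])
      · exact jump _ k (P₁ :: k) rfl (by simp [step, hr])
          (by simp [Prog.translate, step, hemb, hr])
    | Prog.loop r P :: k =>
      rcases hr : a r with _ | ⟨b, l'⟩
      · exact jump _ k k rfl (by simp [step, hr]) (by simp [Prog.translate, step, hemb, hr])
      · exact jump _ k (P :: Prog.loop r P :: k) rfl (by simp [step, hr])
          (by simp [Prog.translate, step, hemb, hr])

theorem spec_translate (hC : 1 ≤ C) (hemb : ∀ a r, emb a (ρ r) = a r)
    (hupd : ∀ a r v, Function.update (emb a) (ρ r) v = emb (Function.update a r v))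
    (hsub : ∀ a r r', Spec O (sub (ρ r) (ρ r')) (emb a) C
      ((O' (a r)).map fun y => emb (Function.update a r' y)))
    {t : ℕ} {P : Prog} {a : State} (h : Halts O' ([P], a) t) :
    Spec O (P.translate ρ sub) (emb a) (t * C) ((law O' ([P], a) t).map emb) := by
  have hf := haltsWithLaw_translate hC hemb hupd hsub t [P] a h
  rw [← hf.law_eq]
  exact hf.halts.spec

/-- A renamed program acts on the renamed registers only. -/
theorem spec_rename (hemb : ∀ a r, emb a (ρ r) = a r)
    (hupd : ∀ a r v, Function.update (emb a) (ρ r) v = emb (Function.update a r v))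
    {t : ℕ} {P : Prog} {a : State} (h : Halts O ([P], a) t) :
    Spec O (P.translate ρ Prog.query) (emb a) t ((law O ([P], a) t).map emb) := by
  have := spec_translate (O := O) (O' := O) (sub := Prog.query) (C := 1) le_rfl hemb hupd (fun a r r' =>
    (spec_query (O := O) _ _).congr rfl le_rfl (by simp [hemb, hupd])) h
  rwa [mul_one] at this

end translate

/-- A program without queries: its behaviour does not depend on the oracle. -/
theorem computes_iff {α : Type} {P : Prog} {xs : List (List Bool)} {t : ℕ} {out : State → α}
    {μ : PMF α} : Computes P xs t out μ ↔
      Halts noOracle ([P], fun i => xs.getD i []) t ∧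
        (law noOracle ([P], fun i => xs.getD i []) t).map out = μ := Iff.rfl

theorem Spec.computes {α : Type} {P : Prog} {xs : List (List Bool)} {t : ℕ} {out : State → α}
    {ν : PMF State} (h : Spec noOracle P (fun i => xs.getD i []) t ν) :
    Computes P xs t out (ν.map out) :=
  computes_iff.2 ⟨h.haltsWithLaw.halts, by rw [h.law_eq]⟩

/-! ## Layout of the registers -/

/-- The first registers hold the entries of `L`, and the others are given by `a`. -/
def st (L : List (List Bool)) (a : State) : State :=
  fun i => if h : i < L.length then L[i] else a (i - L.length)

theorem st_low {L : List (List Bool)} {a : State} {i : ℕ} (h : i < L.length) :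
    st L a i = L[i] := by
  simp [st, h]

theorem update_st_low {L : List (List Bool)} {a : State} {i : ℕ} (h : i < L.length)
    (v : List Bool) : Function.update (st L a) i v = st (L.set i v) a := by
  funext j
  by_cases hj : j = i
  · subst hj
    simp [st, h]
  · rw [Function.update_of_ne hj]
    simp [st, Ne.symm hj]

theorem st_high {L : List (List Bool)} {a : State} (r : ℕ) : st L a (r + L.length) = a r := by
  simp [st]

theorem update_st_high {L : List (List Bool)} {a : State} (r : ℕ) (v : List Bool) :
    Function.update (st L a) (r + L.length) v = st L (Function.update a r v) := by
  funext j
  by_cases hj : j = r + L.length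
  · subst hj
    simp [st]
  · rw [Function.update_of_ne hj]
    by_cases hl : j < L.length
    · simp [st, hl]
    · have : j - L.length ≠ r := by omega
      simp [st, hl, Function.update_of_ne this]

/-- The empty registers. -/
def blank : State := fun _ => []

/-- The inputs are padded with empty registers to the eleven working registers that the programs
below use. -/
theorem initial_eq_st (xs : List (List Bool)) (k : ℕ) :
    (fun i => xs.getD i []) = st (xs ++ List.replicate k []) blank := by
  funext i
  simp only [st, blank]
  split
  · rename_i h
    rw [List.getElem_append]
    split
    · rename_i h'
      simp [h']
    · rename_i h'
      rw [List.getD_eq_default _ _ (by omega)]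
      simp
  · rename_i h
    rw [List.getD_eq_default]
    simp at h; omega

/-- The even registers hold `a`, and the odd ones `b`. -/
def interleave (a b : State) : State := fun i => if i % 2 = 0 then a (i / 2) else b (i / 2)

theorem interleave_even (a b : State) (r : ℕ) : interleave a b (2 * r) = a r := by
  simp [interleave]

theorem interleave_odd (a b : State) (r : ℕ) : interleave a b (2 * r + 1) = b r := by
  have : (2 * r + 1) / 2 = r := by omega
  simp [interleave, this]

theorem update_interleave_even (a b : State) (r : ℕ) (v : List Bool) :
    Function.update (interleave a b) (2 * r) v = interleave (Function.update a r v) b := by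
  funext j
  by_cases hj : j = 2 * r
  · subst hj; simp [interleave]
  · rw [Function.update_of_ne hj]
    by_cases h2 : j % 2 = 0
    · have : j / 2 ≠ r := by omega
      simp [interleave, h2, Function.update_of_ne this]
    · simp [interleave, h2]

theorem update_interleave_odd (a b : State) (r : ℕ) (v : List Bool) :
    Function.update (interleave a b) (2 * r + 1) v = interleave a (Function.update b r v) := by
  funext j
  by_cases hj : j = 2 * r + 1
  · subst hj
    have : (2 * r + 1) / 2 = r := by omega
    simp [interleave, this]
  · rw [Function.update_of_ne hj]
    by_cases h2 : j % 2 = 0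
    · simp [interleave, h2]
    · have : j / 2 ≠ r := by omega
      simp [interleave, h2, Function.update_of_ne this]

theorem interleave_blank : interleave blank blank = blank := by
  funext j
  simp [interleave, blank]

/-! ## Laws of majorities -/

/-- The majority of `a` ones and `b` zeros. -/
def majCount (a b : ℕ) : PMF Bool :=
  if b < a then PMF.pure true else if a < b then PMF.pure false else fairBit

/-- Whether most of the bits of `l` are ones. -/
def majBit (l : List Bool) : Bool := decide (l.count false < l.count true)

theorem count_add_count (l : List Bool) : l.count true + l.count false = l.length := by
  simp

theorem maj_eq_of_odd {l : List Bool} (h : Odd l.length) : maj l = PMF.pure (majBit l) := by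
  have h2 := count_add_count l
  have : l.count true ≠ l.count false := by
    intro h3
    rw [← h2, h3, ← two_mul] at h
    exact absurd h (by simp)
  rw [maj, majBit]
  split_ifs with h1 h3
  · simp [h1]
  · simp [h1]
  · omega

theorem count_map_not (l : List Bool) (b : Bool) : (l.map not).count b = l.count (!b) := by
  induction l with
  | nil => rfl
  | cons a l ih => cases a <;> cases b <;> simp_all

theorem majBit_map_not {l : List Bool} (h : Odd l.length) :
    majBit (l.map not) = !majBit l := by
  have h2 := count_add_count l
  have : l.count true ≠ l.count false := by
    intro h3
    rw [← h2, h3, ← two_mul] at h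
    exact absurd h (by simp)
  simp only [majBit, count_map_not, Bool.not_false, Bool.not_true]
  rw [← decide_not, decide_eq_decide]
  omega

theorem mem_majSet {m : ℕ} (hm : Odd m) {b : Bool} {y : Fin m → Bool} :
    y ∈ majSet m b ↔ majBit (List.ofFn y) = b := by
  have h2 := count_add_count (List.ofFn y)
  rw [List.length_ofFn] at h2
  have : (List.ofFn y).count true ≠ (List.ofFn y).count false := by
    intro h3
    rw [← h2, h3, ← two_mul] at hm
    exact absurd hm (by simp)
  simp only [majSet, Finset.mem_filter, Finset.mem_univ, true_and, majBit]
  cases b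
  · simp; omega
  · simp

/-- Complement all bits. -/
def flipAll {ι : Type} : Equiv.Perm (ι → Bool) where
  toFun y := fun i => !y i
  invFun y := fun i => !y i
  left_inv y := by simp
  right_inv y := by simp

theorem ofFn_flipAll {m : ℕ} (y : Fin m → Bool) :
    List.ofFn (flipAll y) = (List.ofFn y).map not := by
  rw [List.map_ofFn]; rfl

theorem majBit_flipAll {m : ℕ} (hm : Odd m) (y : Fin m → Bool) :
    majBit (List.ofFn (flipAll y)) = !majBit (List.ofFn y) := by
  rw [ofFn_flipAll, majBit_map_not (by simpa using hm)]

/-- For odd `m` complementation exchanges the two majority classes, which partition the cube. -/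
theorem two_mul_card_majSet {m : ℕ} (hm : Odd m) (b : Bool) : 2 * (majSet m b).card = 2 ^ m := by
  classical
  have h1 : (majSet m b).card = (majSet m (!b)).card := by
    refine Finset.card_equiv flipAll fun y => ?_
    rw [mem_majSet hm, mem_majSet hm, majBit_flipAll hm]
    simp
  have h2 : majSet m b ∪ majSet m (!b) = Finset.univ := by
    ext y
    simp only [Finset.mem_union, mem_majSet hm, Finset.mem_univ, iff_true]
    cases b <;> cases majBit (List.ofFn y) <;> simp
  have h3 : Disjoint (majSet m b) (majSet m (!b)) := by
    rw [Finset.disjoint_left]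
    intro y h h'
    rw [mem_majSet hm] at h h'
    rw [h] at h'
    cases b <;> simp at h'
  have h4 := Finset.card_union_of_disjoint h3
  rw [h2, Finset.card_univ, ← h1] at h4
  simp at h4
  omega

theorem uniformOfFintype_apply_bits {m : ℕ} (y : Fin m → Bool) :
    PMF.uniformOfFintype (Fin m → Bool) y = (2 ^ m : ENNReal)⁻¹ := by
  simp

theorem inv_card_majSet {m : ℕ} (hm : Odd m) (b : Bool) :
    ((majSet m b).card : ENNReal)⁻¹ = 2 * (2 ^ m : ENNReal)⁻¹ := by
  have h : (2 ^ m : ENNReal) = 2 * ((majSet m b).card : ENNReal) := by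
    exact_mod_cast (two_mul_card_majSet hm b).symm
  rw [h, ENNReal.mul_inv (by simp) (by simp), ← mul_assoc, ENNReal.mul_inv_cancel (by simp) (by simp),
    one_mul]

/-- Complement `y` unless its majority is `b`. -/
def fixMaj {m : ℕ} (b : Bool) (y : Fin m → Bool) : Fin m → Bool :=
  if majBit (List.ofFn y) = b then y else flipAll y

theorem majBit_fixMaj {m : ℕ} (hm : Odd m) (b : Bool) (y : Fin m → Bool) :
    majBit (List.ofFn (fixMaj b y)) = b := by
  rw [fixMaj]
  split_ifs with h
  · exact h
  · rw [majBit_flipAll hm]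
    cases b <;> simp_all

/-- A string of majority `b` has exactly two preimages, itself and its complement. So the
conditional distribution is sampled exactly, without rejection. -/
theorem map_fixMaj {m : ℕ} (hm : Odd m) (b : Bool) :
    (PMF.uniformOfFintype (Fin m → Bool)).map (fixMaj b) =
      PMF.uniformOfFinset (majSet m b) (majSet_nonempty hm b) := by
  classical
  ext y
  rw [PMF.map_apply, tsum_fintype]
  simp only [uniformOfFintype_apply_bits]
  by_cases hy : y ∈ majSet m b
  · rw [PMF.uniformOfFinset_apply_of_mem _ hy, inv_card_majSet hm]
    rw [mem_majSet hm] at hy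
    have hne : y ≠ flipAll y := by
      intro h
      have := majBit_flipAll hm y
      rw [← h] at this
      simp at this
    have : ∀ x : Fin m → Bool, y = fixMaj b x ↔ x ∈ ({y, flipAll y} : Finset (Fin m → Bool)) := by
      intro x
      simp only [Finset.mem_insert, Finset.mem_singleton]
      constructor
      · intro h
        rw [fixMaj] at h
        split_ifs at h with hx
        · exact Or.inl h.symm
        · right; rw [h]; funext i; simp [flipAll]
      · rintro (rfl | rfl)
        · rw [fixMaj, if_pos hy]
        · rw [fixMaj, if_neg]
          · funext i; simp [flipAll]
          · rw [majBit_flipAll hm, hy]; simp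
    simp only [this]
    rw [Finset.sum_ite_mem, Finset.univ_inter, Finset.sum_const, Finset.card_pair hne]
    simp
  · rw [PMF.uniformOfFinset_apply_of_notMem _ hy]
    refine Finset.sum_eq_zero fun x _ => if_neg ?_
    rintro rfl
    exact hy ((mem_majSet hm).2 (majBit_fixMaj hm b x))

/-- A random bit encoded by a random block with this majority: the block is uniform. -/
theorem fairBit_bind_majEncBit {m : ℕ} (hm : Odd m) :
    (fairBit.bind fun b => (majEncBit m hm b).map fun l => (b, l)) =
      (uniformString m).map fun l => (majBit l, l) := by
  have h : (fairBit.bind fun b =>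
      (PMF.uniformOfFinset (majSet m b) (majSet_nonempty hm b)).map fun y => (b, y)) =
      (PMF.uniformOfFintype (Fin m → Bool)).map fun y => (majBit (List.ofFn y), y) := by
    classical
    ext ⟨b, y⟩
    rw [PMF.bind_apply, tsum_eq_single b, PMF.map_apply, tsum_eq_single y, PMF.map_apply,
      tsum_eq_single y, uniformOfFintype_apply_bits]
    · by_cases hy : majBit (List.ofFn y) = b
      · rw [if_pos rfl, if_pos (by rw [hy]), PMF.uniformOfFinset_apply_of_mem _
          ((mem_majSet hm).2 hy), inv_card_majSet hm, ← mul_assoc]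
        simp [fairBit, ENNReal.inv_mul_cancel]
      · rw [PMF.uniformOfFinset_apply_of_notMem _ (by rwa [mem_majSet hm]),
          if_neg (c := (b, y) = (majBit (List.ofFn y), y)) (fun h => hy (congrArg Prod.fst h).symm)]
        simp
    · intro y' hy'; rw [if_neg]; simp [hy'.symm]
    · intro y' hy'; rw [if_neg]; simp [hy'.symm]
    · intro b' hb'
      rw [PMF.map_apply, ENNReal.tsum_eq_zero.2, mul_zero]
      intro y'
      rw [if_neg]
      simp [hb'.symm]
  have h2 := congrArg (PMF.map fun x : Bool × (Fin m → Bool) => (x.1, List.ofFn x.2)) h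
  rw [map_bind_fun, PMF.map_comp] at h2
  simp only [PMF.map_comp] at h2
  rw [uniformString, PMF.map_comp]
  simp only [majEncBit, PMF.map_comp]
  exact h2

/-- A block with majority `b` is sampled by complementing a uniform block if necessary. -/
theorem majEncBit_eq {m : ℕ} (hm : Odd m) (b : Bool) :
    majEncBit m hm b = (uniformString m).map fun l =>
      if majBit l = b then l else l.map not := by
  rw [majEncBit, ← map_fixMaj hm, PMF.map_comp, uniformString, PMF.map_comp]
  congr 1
  funext y
  simp only [Function.comp, fixMaj]
  split_ifs with h
  · rfl
  · rw [ofFn_flipAll]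

theorem majBit_reverse (l : List Bool) : majBit l.reverse = majBit l := by simp [majBit]

/-- Uniformity and majority are both insensitive to order; the encoding program outputs its blocks
reversed, and this makes that harmless. -/
theorem map_reverse_majEncBit {m : ℕ} (hm : Odd m) (b : Bool) :
    (majEncBit m hm b).map List.reverse = majEncBit m hm b := by
  rw [majEncBit_eq, PMF.map_comp]
  conv_rhs => rw [← map_reverse_uniformString, PMF.map_comp]
  congr 1
  funext l
  simp only [Function.comp, majBit_reverse]
  split_ifs <;> simp

theorem length_of_mem_support_majEncBit {m : ℕ} (hm : Odd m) (b : Bool) :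
    ∀ l ∈ (majEncBit m hm b).support, l.length = m := by
  intro l hl
  rw [majEncBit, PMF.mem_support_map_iff] at hl
  obtain ⟨y, -, rfl⟩ := hl
  simp

theorem length_of_mem_support_majEnc {m : ℕ} (hm : Odd m) (x : List Bool) :
    ∀ y ∈ (majEnc m hm x).support, y.length = x.length * m := by
  intro y hy
  rw [majEnc, PMF.mem_support_map_iff] at hy
  obtain ⟨L, hL, rfl⟩ := hy
  have h1 := length_of_mem_support_mapIndep _ _ _ hL
  have h2 := forall_of_mem_support_mapIndep _ (fun l => l.length = m)
    (length_of_mem_support_majEncBit hm) _ _ hL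
  rw [List.length_flatten, ← h1]
  clear h1 hL
  induction L with
  | nil => simp
  | cons l L ih =>
    rw [List.map_cons, List.sum_cons, ih fun b hb => h2 b (List.mem_cons_of_mem _ hb),
      h2 l (by simp), List.length_cons, add_mul, one_mul, add_comm]

/-- A uniform string together with its majority encoding: the encoding is uniform, and the string
consists of the majorities of the blocks. -/
theorem uniformString_bind_majEncBit {m : ℕ} (hm : Odd m) {α : Type} (l : List α) :
    ((uniformString l.length).bind fun x =>
        (mapIndep (majEncBit m hm) x).map fun L => (x, L)) =
      (mapIndep (fun _ => uniformString m) l).map fun L => (L.map majBit, L) := by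
  induction l with
  | nil => simp [uniformString_zero, mapIndep, PMF.pure_map]
  | cons a l ih =>
    rw [List.length_cons, uniformString_succ, PMF.bind_bind, mapIndep_cons, map_bind_fun]
    have e1 : ∀ b : Bool, ((uniformString l.length).map fun x => b :: x).bind (fun x =>
        (mapIndep (majEncBit m hm) x).map fun L => (x, L)) =
        (majEncBit m hm b).bind fun y => ((uniformString l.length).bind fun x =>
        (mapIndep (majEncBit m hm) x).map fun L => (x, L)).map
          fun z => (b :: z.1, y :: z.2) := by
      intro b
      rw [bind_map_fun]
      simp only [mapIndep_cons, map_bind_fun, PMF.map_comp]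
      rw [PMF.bind_comm]
      rfl
    simp only [e1, ih]
    have e2 := congrArg (fun μ => μ.bind fun z : Bool × List Bool =>
      ((mapIndep (fun _ => uniformString m) l).map fun L => (L.map majBit, L)).map
        fun w => (z.1 :: w.1, z.2 :: w.2)) (fairBit_bind_majEncBit hm)
    simp only [PMF.bind_bind, bind_map_fun, PMF.map_comp] at e2 ⊢
    exact e2

theorem mapIndep_uniformString {α : Type} (m : ℕ) (l : List α) :
    (mapIndep (fun _ => uniformString m) l).map List.flatten = uniformString (l.length * m) := by
  induction l with
  | nil => simp [mapIndep, PMF.pure_map, uniformString_zero]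
  | cons a l ih =>
    rw [List.length_cons, add_mul, one_mul, add_comm, uniformString_add, ← ih, mapIndep_cons,
      map_bind_fun]
    simp only [PMF.map_comp]
    rfl

/-- The reason why the majority code preserves pseudorandomness: it turns the uniform oracle of the
inner code into that of the composed code. -/
theorem uniformString_bind_majEnc {m : ℕ} (hm : Odd m) (n : ℕ) :
    (uniformString n).bind (majEnc m hm) = uniformString (n * m) := by
  have h := uniformString_bind_majEncBit hm (List.replicate n ())
  have h2 := congrArg (PMF.map fun z : List Bool × List (List Bool) => z.2.flatten) h
  rw [map_bind_fun, List.length_replicate, PMF.map_comp] at h2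
  simp only [PMF.map_comp] at h2
  have h3 := mapIndep_uniformString m (List.replicate n ())
  rw [List.length_replicate] at h3
  rw [← h3]
  exact h2

theorem length_blocks (n : ℕ) (z : List Bool) : (blocks n z).length = n := by simp [blocks]

theorem length_of_mem_support_majDec (n : ℕ) (z : List Bool) :
    ∀ x ∈ (majDec n z).support, x.length = n := by
  intro x hx
  rw [length_of_mem_support_mapIndep _ _ _ hx, length_blocks]

/-! ## A program for the majority encoding -/

section st

variable {O : Oracle} {L : List (List Bool)} {a : State}

theorem st_getD {i : ℕ} (h : i < L.length) : st L a i = L.getD i [] := by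
  simp [st, h]

theorem spec_st_push {i : ℕ} (b : Bool) (h : i < L.length) :
    Spec O (Prog.push i b) (st L a) 1 (PMF.pure (st (L.set i (b :: L.getD i [])) a)) := by
  have := spec_push (O := O) (s := st L a) i b
  rwa [update_st_low h, st_getD h] at this

theorem spec_st_pop {i : ℕ} (h : i < L.length) :
    Spec O (Prog.pop i) (st L a) 1 (PMF.pure (st (L.set i (L.getD i []).tail) a)) := by
  have := spec_pop (O := O) (s := st L a) i
  rwa [update_st_low h, st_getD h] at this

theorem spec_st_copy {i j : ℕ} (h : i < L.length) (h' : j < L.length) :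
    Spec O (Prog.copy i j) (st L a) 1 (PMF.pure (st (L.set j (L.getD i [])) a)) := by
  have := spec_copy (O := O) (s := st L a) i j
  rwa [update_st_low h', st_getD h] at this

theorem spec_st_flip {i : ℕ} (h : i < L.length) :
    Spec O (Prog.flip i) (st L a) 1 (fairBit.map fun b => st (L.set i (b :: L.getD i [])) a) := by
  have := spec_flip (O := O) (s := st L a) i
  simpa only [update_st_low h, st_getD h] using this

/-- A deterministic loop over register `r` whose body changes register `s` only. -/
theorem spec_st_forBits {r s t : ℕ} {P₀ P₁ : Prog} (hr : r < L.length) (hrs : r ≠ s)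
    (β : Bool → List Bool → List Bool)
    (hbody : ∀ b l x, Spec O (if b then P₁ else P₀) (st ((L.set r l).set s x) a) t
      (PMF.pure (st ((L.set r l).set s (β b x)) a))) :
    Spec O (forBits r P₀ P₁) (st L a) ((L.getD r []).length * (t + 4) + 1)
      (PMF.pure (st ((L.set r []).set s
        ((L.getD r []).foldl (fun x b => β b x) (L.getD s []))) a)) := by
  have hL : st L a = st ((L.set r (L.getD r [])).set s (L.getD s [])) a := by
    congr 1
    refine List.ext_getElem (by simp) fun i h1 h2 => ?_
    simp only [List.getElem_set]
    split_ifs with h3 h4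
    · subst h3; simp [h1]
    · subst h4; simp [h1]
    · rfl
  rw [hL]
  refine (spec_forBits_pure (t := t) (fun l x => st ((L.set r l).set s x) a) β (fun _ _ => True)
    ?_ ?_ (fun b l x _ => hbody b l x) (fun _ _ _ _ => trivial) _ _ trivial)
  · intro l x
    rw [st_low (by simpa using hr)]
    simp [hrs.symm]
  · intro b l x
    rw [update_st_low (by simpa using hr), List.set_comm _ _ hrs.symm, List.set_set]

theorem getD_set_self {s : ℕ} (x : List Bool) (hs : s < L.length) :
    (L.set s x).getD s [] = x := by
  simp [hs]

/-- Drop as many bits from register `s` as there are in register `r`. -/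
theorem spec_st_drop {r s : ℕ} (hr : r < L.length) (hrs : r ≠ s) (hs : s < L.length) :
    Spec O (forBits r (Prog.pop s) (Prog.pop s)) (st L a) ((L.getD r []).length * 5 + 1)
      (PMF.pure (st ((L.set r []).set s ((L.getD s []).drop (L.getD r []).length)) a)) := by
  refine (spec_st_forBits (t := 1) hr hrs (fun _ x => x.tail) ?_).congr rfl le_rfl ?_
  · intro b l x
    have := spec_st_pop (O := O) (L := (L.set r l).set s x) (a := a) (i := s) (by simpa using hs)
    rw [getD_set_self _ (by simpa using hs), List.set_set] at this
    simpa using this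
  · congr 3
    generalize L.getD r [] = l
    generalize L.getD s [] = x
    induction l generalizing x with
    | nil => simp
    | cons b l ih => simp [← ih]

/-- Move the bits of register `r` to register `s`, thereby reversing their order, and apply `f`
to each of them. -/
theorem spec_st_move {r s : ℕ} (f : Bool → Bool) (hr : r < L.length) (hrs : r ≠ s)
    (hs : s < L.length) :
    Spec O (forBits r (Prog.push s (f false)) (Prog.push s (f true))) (st L a)
      ((L.getD r []).length * 5 + 1)
      (PMF.pure (st ((L.set r []).set s (((L.getD r []).map f).reverse ++ L.getD s [])) a)) := by
  refine (spec_st_forBits (t := 1) hr hrs (fun b x => f b :: x) ?_).congr rfl le_rfl ?_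
  · intro b l x
    have := spec_st_push (O := O) (L := (L.set r l).set s x) (a := a) (i := s) (f b)
      (by simpa using hs)
    rw [getD_set_self _ (by simpa using hs), List.set_set] at this
    cases b <;> simpa using this
  · congr 3
    generalize L.getD r [] = l
    generalize L.getD s [] = x
    induction l generalizing x with
    | nil => simp
    | cons b l ih => simp [← ih]

end st

/-- Compare the lengths of registers 5 and 6, and push the result on register 8. -/
def majProg : Prog :=
  .seq (.copy 5 7) <| .seq (.copy 6 9) <| .seq (forBits 9 (.pop 7) (.pop 7)) <|
  .seq (.copy 6 9) <| .seq (forBits 5 (.pop 9) (.pop 9)) <| .seq (.copy 10 6) <|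
  .seq (.branch 7 (.branch 9 (.flip 8) (.push 8 false) (.push 8 false))
    (.push 8 true) (.push 8 true)) <|
  .seq (.copy 10 7) (.copy 10 9)

/-- Registers 7 and 9 receive the two truncated differences of the counts. At most one is nonempty,
and both are empty exactly for a tie, when a coin is tossed. Register 10 is always empty, so that
copying from it clears a register. -/
theorem spec_majProg {O : Oracle} {r0 r1 r2 r3 r4 r5 r6 r8 : List Bool} {a : State} :
    Spec O majProg (st [r0, r1, r2, r3, r4, r5, r6, [], r8, [], []] a)
      (5 * (r5.length + r6.length) + 20)
      ((majCount r5.length r6.length).map fun b =>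
        st [r0, r1, r2, r3, r4, [], [], [], b :: r8, [], []] a) := by
  have hbr : Spec O (.branch 7 (.branch 9 (.flip 8) (.push 8 false) (.push 8 false))
      (.push 8 true) (.push 8 true))
      (st [r0, r1, r2, r3, r4, [], [], r5.drop r6.length, r8, r6.drop r5.length, []] a) 3
      ((majCount r5.length r6.length).map fun b => st [r0, r1, r2, r3, r4, [], [],
        r5.drop r6.length, b :: r8, r6.drop r5.length, []] a) := by
    rcases h7 : r5.drop r6.length with _ | ⟨b, l⟩
    · rw [List.drop_eq_nil_iff] at h7
      refine Spec.mono (spec_branch_nil (by simp [st]) (t := 2) ?_) (by norm_num)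
      rcases h9 : r6.drop r5.length with _ | ⟨b, l⟩
      · rw [List.drop_eq_nil_iff] at h9
        refine Spec.mono (spec_branch_nil (by simp [st]) (t := 1) ?_) (by norm_num)
        rw [majCount, if_neg (by omega), if_neg (by omega)]
        exact spec_st_flip (by simp)
      · have := congrArg List.length h9
        simp only [List.length_drop, List.length_cons] at this
        refine Spec.mono (spec_branch_cons (b := b) (l := l) (by simp [st]) (t := 1) ?_)
          (by norm_num)
        have hm : majCount r5.length r6.length = PMF.pure false := by
          rw [majCount, if_neg (by omega), if_pos (by omega)]
        rw [hm, PMF.pure_map]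
        have := spec_st_push (O := O)
          (L := [r0, r1, r2, r3, r4, [], [], [], r8, b :: l, []]) (a := a) (i := 8) false (by simp)
        cases b <;> simpa using this
    · have := congrArg List.length h7
      simp only [List.length_drop, List.length_cons] at this
      refine Spec.mono (spec_branch_cons (b := b) (l := l) (by simp [st]) (t := 1) ?_)
        (by norm_num)
      have hm : majCount r5.length r6.length = PMF.pure true := by
        rw [majCount, if_pos (by omega)]
      rw [hm, PMF.pure_map]
      have := spec_st_push (O := O)
        (L := [r0, r1, r2, r3, r4, [], [], b :: l, r8, r6.drop r5.length, []]) (a := a) (i := 8)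
          true (by simp)
      cases b <;> simpa using this
  have hend : ∀ b, Spec O (.seq (.copy 10 7) (.copy 10 9))
      (st [r0, r1, r2, r3, r4, [], [], r5.drop r6.length, b :: r8, r6.drop r5.length, []] a) 3
      (PMF.pure (st [r0, r1, r2, r3, r4, [], [], [], b :: r8, [], []] a)) := by
    intro b
    exact ((spec_st_copy (by simp) (by simp)).seq (spec_st_copy (by simp) (by simp))).congr rfl
      le_rfl (by simp)
  -- The instructions are composed from the last one backwards.
  have h := hbr.seq_map fun b _ => hend b
  have h6 := (spec_st_copy (O := O) (a := a) (L := [r0, r1, r2, r3, r4, [], r6,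
    r5.drop r6.length, r8, r6.drop r5.length, []]) (i := 10) (j := 6) (by simp) (by simp)).seq h
  have h5 := (spec_st_drop (O := O) (a := a) (L := [r0, r1, r2, r3, r4, r5, r6,
    r5.drop r6.length, r8, r6, []]) (r := 5) (s := 9) (by simp) (by simp) (by simp)).seq h6
  have h4 := (spec_st_copy (O := O) (a := a) (L := [r0, r1, r2, r3, r4, r5, r6,
    r5.drop r6.length, r8, [], []]) (i := 6) (j := 9) (by simp) (by simp)).seq h5
  have h3 := (spec_st_drop (O := O) (a := a) (L := [r0, r1, r2, r3, r4, r5, r6,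
    r5, r8, r6, []]) (r := 9) (s := 7) (by simp) (by simp) (by simp)).seq h4
  have h2 := (spec_st_copy (O := O) (a := a) (L := [r0, r1, r2, r3, r4, r5, r6,
    r5, r8, [], []]) (i := 6) (j := 9) (by simp) (by simp)).seq h3
  have h1 := (spec_st_copy (O := O) (a := a) (L := [r0, r1, r2, r3, r4, r5, r6,
    [], r8, [], []]) (i := 5) (j := 7) (by simp) (by simp)).seq h2
  refine h1.congr rfl ?_ rfl
  simp
  omega

/-- The bits `1` (or `0`) of `l`, in unary. -/
def unaryCount (l : List Bool) (b : Bool) : List Bool := unary (l.count b)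

theorem unaryCount_cons (b : Bool) (l : List Bool) (c : Bool) :
    unaryCount (b :: l) c = if b = c then true :: unaryCount l c else unaryCount l c := by
  rw [unaryCount, List.count_cons]
  cases b <;> cases c <;> simp [unaryCount, unary, List.replicate_succ]

/-- As many random bits as there are bits in register 7 are put on register 4, and counted in
registers 5 and 6. -/
def sampleProg : Prog :=
  forBits 7
    (.seq (.flip 4) (.branch 4 .skip (.push 6 true) (.push 5 true)))
    (.seq (.flip 4) (.branch 4 .skip (.push 6 true) (.push 5 true)))

theorem foldP_fairBit (l x : List Bool) :
    foldP (fun _ x => fairBit.map fun b => b :: x) l x =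
      (uniformString l.length).map fun y => y ++ x := by
  have h := foldP_mapIndep (fun _ : Bool => fairBit) (fun b x => b :: x) l x
  rw [h, ← uniformString_eq_mapIndep]
  conv_rhs => rw [← map_reverse_uniformString, PMF.map_comp]
  congr 1
  funext y
  simp

/-- Register 7 serves only as a unary counter; both loop bodies agree because the values of its bits
do not matter. -/
theorem spec_sampleProg {O : Oracle} {r0 r1 r2 r3 r7 : List Bool} {a : State} :
    Spec O sampleProg (st [r0, r1, r2, r3, [], [], [], r7, [], [], []] a) (9 * r7.length + 1)
      ((uniformString r7.length).map fun y =>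
        st [r0, r1, r2, r3, y, unaryCount y true, unaryCount y false, [], [], [], []] a) := by
  refine (spec_forBits (t := 5) (fun l y => st [r0, r1, r2, r3, y, unaryCount y true,
    unaryCount y false, l, [], [], []] a) (fun _ x => fairBit.map fun b => b :: x)
    (fun _ _ => True) ?_ ?_ ?_ (fun _ _ _ _ _ _ => trivial) r7 [] trivial).congr rfl
    (by ring_nf; omega) ?_
  · intro l x; simp [st]
  · intro b l x; rw [update_st_low (by simp)]; simp
  · intro b l x _
    have h1 := spec_st_flip (O := O) (a := a) (L := [r0, r1, r2, r3, x, unaryCount x true,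
      unaryCount x false, l, [], [], []]) (i := 4) (by simp)
    have h2 := h1.seq_map (u := 2) (Q := .branch 4 .skip (.push 6 true) (.push 5 true))
      (g := fun b => PMF.pure (st [r0, r1, r2, r3, b :: x, unaryCount (b :: x) true,
        unaryCount (b :: x) false, l, [], [], []] a)) (by
      intro b _
      refine spec_branch_cons (b := b) (l := x) (by simp [st]) ?_
      cases b
      · exact (spec_st_push _ (by simp)).congr rfl le_rfl (by simp [unaryCount_cons])
      · exact (spec_st_push _ (by simp)).congr rfl le_rfl (by simp [unaryCount_cons]))
    simp only [ite_self]
    refine h2.congr rfl (by norm_num) ?_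
    rw [PMF.map_comp]
    rfl
  · rw [foldP_fairBit, PMF.map_comp]
    simp [Function.comp_def]

theorem maj_eq_majCount (y : List Bool) :
    maj y = majCount (unaryCount y true).length (unaryCount y false).length := by
  simp [maj, majCount, unaryCount, unary]

/-- Put a random block with majority `b` in front of register 1. Its length is that of
register 2. -/
def encBitProg (b : Bool) : Prog :=
  .seq (.copy 2 7) <| .seq sampleProg <| .seq majProg <|
  .seq (.branch 8 .skip
    (forBits 4 (.push 1 (xor b false)) (.push 1 (xor b true)))
    (forBits 4 (.push 1 (xor (!b) false)) (.push 1 (xor (!b) true))))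
  (.copy 10 8)

/-- A uniform block is sampled and complemented if its majority is not `b`: with majority 0 the bits
are xored with `b`, with majority 1 with `!b`. Moving the block reverses it, which
`map_reverse_majEncBit` undoes in law. -/
theorem spec_encBitProg {O : Oracle} {r0 r1 r3 : List Bool} {a : State} {m : ℕ} (hm : Odd m)
    (b : Bool) :
    Spec O (encBitProg b) (st [r0, r1, unary m, r3, [], [], [], [], [], [], []] a) (19 * m + 40)
      ((majEncBit m hm b).map fun y =>
        st [r0, y ++ r1, unary m, r3, [], [], [], [], [], [], []] a) := by
  have hlast : ∀ y : List Bool, y ∈ (uniformString m).support →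
      Spec O (.seq (.branch 8 .skip
        (forBits 4 (.push 1 (xor b false)) (.push 1 (xor b true)))
        (forBits 4 (.push 1 (xor (!b) false)) (.push 1 (xor (!b) true)))) (.copy 10 8))
        (st [r0, r1, unary m, r3, y, [], [], [], [majBit y], [], []] a) (5 * m + 4)
        (PMF.pure (st [r0, (if majBit y = b then y else y.map not).reverse ++ r1, unary m, r3,
          [], [], [], [], [], [], []] a)) := by
    intro y hy
    have hlen := length_of_mem_support_uniformString hy
    have h1 : Spec O (.branch 8 .skip
        (forBits 4 (.push 1 (xor b false)) (.push 1 (xor b true)))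
        (forBits 4 (.push 1 (xor (!b) false)) (.push 1 (xor (!b) true))))
        (st [r0, r1, unary m, r3, y, [], [], [], [majBit y], [], []] a) (5 * m + 2)
        (PMF.pure (st [r0, (if majBit y = b then y else y.map not).reverse ++ r1, unary m, r3,
          [], [], [], [], [majBit y], [], []] a)) := by
      refine spec_branch_cons (b := majBit y) (l := []) (by simp [st]) ?_
      have h0 := spec_st_move (O := O) (L := [r0, r1, unary m, r3, y, [], [], [], [majBit y],
        [], []]) (a := a) (r := 4) (s := 1) (xor b) (by simp) (by simp) (by simp)
      have h1 := spec_st_move (O := O) (L := [r0, r1, unary m, r3, y, [], [], [], [majBit y],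
        [], []]) (a := a) (r := 4) (s := 1) (xor (!b)) (by simp) (by simp) (by simp)
      have hf : y.map (xor false) = y := by
        conv_rhs => rw [← List.map_id y]
        exact List.map_congr_left fun b _ => by simp
      have ht : y.map (xor true) = y.map not := List.map_congr_left fun b _ => by simp
      cases hb : majBit y <;> rw [hb] at h0 h1
      · refine h0.congr (by simp) (by simp [hlen]; omega) ?_
        cases b <;> simp [hf, ht]
      · refine h1.congr (by simp) (by simp [hlen]; omega) ?_
        cases b <;> simp [hf, ht]
    exact (h1.seq (spec_st_copy (i := 10) (j := 8) (by simp) (by simp))).congr rfl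
      (by omega) (by simp)
  have h3 : ∀ y ∈ (uniformString m).support, Spec O (.seq majProg <|
      .seq (.branch 8 .skip
        (forBits 4 (.push 1 (xor b false)) (.push 1 (xor b true)))
        (forBits 4 (.push 1 (xor (!b) false)) (.push 1 (xor (!b) true)))) (.copy 10 8))
      (st [r0, r1, unary m, r3, y, unaryCount y true, unaryCount y false, [], [], [], []] a)
      (10 * m + 25) (PMF.pure (st [r0, (if majBit y = b then y else y.map not).reverse ++ r1,
        unary m, r3, [], [], [], [], [], [], []] a)) := by
    intro y hy
    have hlen := length_of_mem_support_uniformString hy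
    have h := spec_majProg (O := O) (a := a) (r0 := r0) (r1 := r1) (r2 := unary m) (r3 := r3)
      (r4 := y) (r5 := unaryCount y true) (r6 := unaryCount y false) (r8 := [])
    rw [← maj_eq_majCount, maj_eq_of_odd (by rwa [hlen]), PMF.pure_map] at h
    refine (h.seq (hlast y hy)).mono ?_
    have := count_add_count y
    simp only [unaryCount, unary, List.length_replicate]
    omega
  have h2 := (spec_sampleProg (O := O) (a := a) (r0 := r0) (r1 := r1) (r2 := unary m) (r3 := r3)
    (r7 := unary m)).seq_map (fun y hy => h3 y (by simpa [unary] using hy))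
  have h1 := (spec_st_copy (O := O) (a := a) (L := [r0, r1, unary m, r3, [], [], [], [], [],
    [], []]) (i := 2) (j := 7) (by simp) (by simp)).seq h2
  refine h1.congr rfl ?_ ?_
  · simp [unary]; omega
  · rw [← map_reverse_majEncBit, majEncBit_eq, PMF.map_comp, PMF.map_comp]
    simp only [unary, List.length_replicate]
    rfl

/-- The block length of the majority code. -/
def expansion (n : ℕ) : ℕ := 2 * (n * n) + 1

theorem odd_expansion (n : ℕ) : Odd (expansion n) := ⟨n * n, rfl⟩

/-- The length `n` of register 0 determines the length `expansion n` of register 2. -/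
def expansionProg : Prog :=
  .seq (.copy 0 7) <|
  .seq (forBits 7
    (.seq (.copy 0 5) (forBits 5 (.seq (.push 2 true) (.push 2 true))
      (.seq (.push 2 true) (.push 2 true))))
    (.seq (.copy 0 5) (forBits 5 (.seq (.push 2 true) (.push 2 true))
      (.seq (.push 2 true) (.push 2 true)))))
  (.push 2 true)

theorem unary_add (a b : ℕ) : unary (a + b) = unary a ++ unary b := by
  simp [unary]

theorem foldl_unary (l : List Bool) (c d : ℕ) :
    l.foldl (fun x _ => unary c ++ x) (unary d) = unary (l.length * c + d) := by
  induction l generalizing d with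
  | nil => simp
  | cons b l ih =>
    rw [List.foldl_cons, ← unary_add, ih, List.length_cons]
    congr 1; ring

/-- Two nested loops over the string push two bits for each pair of positions, and one last bit
makes the length odd. -/
theorem spec_expansionProg {O : Oracle} {y : List Bool} {a : State} :
    Spec O expansionProg (st [y, [], [], [], [], [], [], [], [], [], []] a)
      (y.length * (7 * y.length + 7) + 6)
      (PMF.pure (st [y, [], unary (expansion y.length), [], [], [], [], [], [], [], []] a)) := by
  have hin : ∀ l x : List Bool, Spec O (.seq (.copy 0 5) (forBits 5
      (.seq (.push 2 true) (.push 2 true)) (.seq (.push 2 true) (.push 2 true))))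
      (st [y, [], x, [], [], [], [], l, [], [], []] a) (7 * y.length + 3)
      (PMF.pure (st [y, [], y.foldl (fun x _ => unary 2 ++ x) x, [], [], [], [], l, [], [], []]
        a)) := by
    intro l x
    have h := spec_st_forBits (O := O) (a := a) (L := [y, [], x, [], [], y, [], l, [], [], []])
      (r := 5) (s := 2) (t := 3) (P₀ := .seq (.push 2 true) (.push 2 true))
      (P₁ := .seq (.push 2 true) (.push 2 true)) (by simp) (by simp)
      (fun _ x => unary 2 ++ x) (by
        intro b l' x'
        rw [ite_self]
        exact ((spec_st_push _ (by simp)).seq (spec_st_push _ (by simp))).congr rfl le_rfl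
          (by simp [unary]))
    have h' := (spec_st_copy (O := O) (a := a) (L := [y, [], x, [], [], [], [], l, [], [], []])
      (i := 0) (j := 5) (by simp) (by simp)).seq h
    exact h'.congr rfl (by simp; omega) (by simp)
  have h := spec_forBits_pure (O := O) (t := 7 * y.length + 3) (r := 7)
    (P₀ := .seq (.copy 0 5) (forBits 5
      (.seq (.push 2 true) (.push 2 true)) (.seq (.push 2 true) (.push 2 true))))
    (P₁ := .seq (.copy 0 5) (forBits 5
      (.seq (.push 2 true) (.push 2 true)) (.seq (.push 2 true) (.push 2 true))))
    (fun l d => st [y, [], unary d, [], [], [], [], l, [], [], []] a)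
    (fun _ d => y.length * 2 + d) (fun _ _ => True) (by intro l x; simp [st])
    (by intro b l x; rw [update_st_low (by simp)]; simp)
    (by
      intro b l d _
      rw [ite_self]
      refine (hin l (unary d)).congr rfl le_rfl ?_
      rw [foldl_unary])
    (fun _ _ _ _ => trivial) y 0 trivial
  have h2 := h.seq (spec_st_push (i := 2) true (by simp))
  have h1 := (spec_st_copy (O := O) (a := a) (L := [y, [], [], [], [], [], [], [], [], [], []])
    (i := 0) (j := 7) (by simp) (by simp)).seq h2
  have htime : y.length * (7 * y.length + 3 + 4) = y.length * (7 * y.length + 7) := rfl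
  refine h1.congr rfl (by omega) ?_
  have hfold : ∀ (l : List Bool) (d : ℕ),
      l.foldl (fun x _ => y.length * 2 + x) d = l.length * (y.length * 2) + d := by
    intro l
    induction l with
    | nil => simp
    | cons b l ih => intro d; rw [List.foldl_cons, ih, List.length_cons]; ring
  simp only [hfold, List.set_cons_succ, List.set_cons_zero, List.getD_cons_succ,
    List.getD_cons_zero]
  congr 3
  rw [expansion, show 2 * (y.length * y.length) = y.length * (y.length * 2) + 0 by ring]
  rfl

/-- The majority encoding of register 0 is stored in register 1, and register 0 is cleared. -/
def majEncProg : Prog :=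
  .seq expansionProg <| .seq (forBits 0 (.push 3 false) (.push 3 true)) <|
  .seq (forBits 3 (encBitProg false) (encBitProg true)) (.copy 10 2)

/-- A bound for the running time of `majEncProg` on strings of length `n`. -/
def majEncTime (n : ℕ) : ℕ := n * (7 * n + 7) + n * (19 * expansion n + 50) + 20

/-- Two reversals cancel: the string is reversed into register 3, and blocks are then put in front
of those already made. -/
theorem spec_majEncProg {O : Oracle} (y : List Bool) (a : State) :
    Spec O majEncProg (st [y, [], [], [], [], [], [], [], [], [], []] a)
      (majEncTime y.length)
      ((majEnc (expansion y.length) (odd_expansion _) y).map fun x =>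
        st [[], x, [], [], [], [], [], [], [], [], []] a) := by
  have hrev := spec_st_move (O := O) (a := a) (L := [y, [], unary (expansion y.length), [], [],
    [], [], [], [], [], []]) (r := 0) (s := 3) id (by simp) (by simp) (by simp)
  simp only [List.getD_cons_zero, List.map_id, List.set_cons_zero, List.set_cons_succ,
    List.getD_cons_succ, List.append_nil] at hrev
  have hloop := spec_forBits (O := O) (t := 19 * expansion y.length + 40) (r := 3)
    (P₀ := encBitProg false) (P₁ := encBitProg true)
    (fun l x => st [[], x, unary (expansion y.length), l, [], [], [], [], [], [], []] a)
    (fun b x => (majEncBit _ (odd_expansion y.length) b).map fun z => z ++ x)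
    (fun _ _ => True) (by intro l x; simp [st])
    (by intro b l x; rw [update_st_low (by simp)]; simp)
    (by
      intro b l x _
      have := spec_encBitProg (O := O) (a := a) (r0 := []) (r1 := x) (r3 := l)
        (odd_expansion y.length) b
      rw [PMF.map_comp]
      cases b <;> exact this)
    (fun _ _ _ _ _ _ => trivial) y.reverse [] trivial
  have h3 := hloop.seq_map (u := 1) (Q := .copy 10 2) (g := fun x => PMF.pure
    (st [[], x, [], [], [], [], [], [], [], [], []] a)) (by
      intro x _
      exact (spec_st_copy (by simp) (by simp)).congr rfl le_rfl (by simp))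
  have h1 := spec_expansionProg (O := O) (a := a) (y := y)
  refine (h1.seq (hrev.seq h3)).congr rfl ?_ ?_
  · simp only [majEncTime, List.length_reverse]
    ring_nf
    omega
  · rw [foldP_mapIndep, mapIndep_reverse, PMF.map_comp, majEnc, PMF.map_comp, map_eq_bind,
      bind_map_fun]
    congr 1
    funext L
    congr 3
    simp only [Function.comp]
    have : ∀ (L : List (List Bool)) (acc : List Bool),
        L.reverse.foldl (fun y b => b ++ y) acc = L.flatten ++ acc := by
      intro L
      induction L with
      | nil => simp
      | cons l L ih => intro acc; simp [ih]
    rw [this, List.append_nil]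

/-! ## A program for the majority decoding -/

/-- Count down register 3; when it is empty, reset it to register 2, and read one bit of
register 0. -/
def tickProg : Prog :=
  .seq (.pop 3) (.branch 3
    (.seq (.copy 2 3) (.branch 0 .skip (.seq (.pop 0) (.push 6 true)) (.seq (.pop 0) (.push 5 true))))
    .skip .skip)

/-- The bits of `z` from position `s` on that are read up to time `t`, when every `n` time steps
one bit is read. -/
def segment (n : ℕ) (z : List Bool) (s t : ℕ) : List Bool := (z.drop s).take (t / n - s)

theorem segment_of_drop_eq_nil {n : ℕ} {z : List Bool} {s t u : ℕ} (hs : s ≤ t / n)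
    (h : z.drop (t / n) = []) (htu : t ≤ u) : segment n z s u = segment n z s t := by
  rw [List.drop_eq_nil_iff] at h
  have : t / n ≤ u / n := Nat.div_le_div_right htu
  rw [segment, segment, List.take_of_length_le (by simp; omega),
    List.take_of_length_le (by simp; omega)]

theorem segment_succ {n : ℕ} {z : List Bool} {s t u : ℕ} {b : Bool} {l : List Bool}
    (hs : s ≤ t / n) (h : z.drop (t / n) = b :: l) (hu : u / n = t / n + 1) :
    segment n z s u = segment n z s t ++ [b] := by
  have hd : (z.drop s).drop (t / n - s) = b :: l := by
    rw [List.drop_drop, ← h]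
    congr 1; omega
  rw [segment, segment, hu, show t / n + 1 - s = (t / n - s) + 1 by omega, List.take_add, hd]
  rfl

theorem unaryCount_append_singleton (l : List Bool) (b c : Bool) :
    unaryCount (l ++ [b]) c = unaryCount (b :: l) c := by
  rw [unaryCount, List.count_append, add_comm, ← List.count_append]
  rfl

theorem tail_unary (n : ℕ) : (unary n).tail = unary (n - 1) := by simp [unary]

/-- The boundaries ⌊i |z| / n⌋ are reached without any division. A bit is read at every `n`-th tick,
so `t` ticks read ⌊t / n⌋ bits, and each block is given |z| ticks. Register 3 is the clock: it holds
n - (t mod n) and runs empty exactly when t + 1 is a multiple of `n`. -/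
theorem spec_tickProg {O : Oracle} {n : ℕ} {z r1 r4 r7 r8 : List Bool} {a : State} {s t : ℕ}
    (hn : 0 < n) (hs : s ≤ t / n) :
    Spec O tickProg (st [z.drop (t / n), r1, unary n, unary (n - t % n), r4,
        unaryCount (segment n z s t) true, unaryCount (segment n z s t) false, r7, r8, [], []] a) 9
      (PMF.pure (st [z.drop ((t + 1) / n), r1, unary n, unary (n - (t + 1) % n), r4,
        unaryCount (segment n z s (t + 1)) true, unaryCount (segment n z s (t + 1)) false,
        r7, r8, [], []] a)) := by
  have h0 := spec_st_pop (O := O) (a := a) (L := [z.drop (t / n), r1, unary n,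
    unary (n - t % n), r4, unaryCount (segment n z s t) true,
    unaryCount (segment n z s t) false, r7, r8, [], []]) (i := 3) (by simp)
  simp only [List.getD_cons_zero, List.set_cons_zero, List.set_cons_succ, List.getD_cons_succ,
    tail_unary] at h0
  have hlt := Nat.mod_lt t hn
  have hdm := Nat.div_add_mod' t n
  refine (h0.seq (u := 7) ?_).mono (by norm_num)
  by_cases hr : t % n + 1 = n
  · have hdiv : (t + 1) / n = t / n + 1 := by
      rw [Nat.div_eq_iff hn, add_mul, one_mul]
      omega
    have hmod : (t + 1) % n = 0 := by
      have : t + 1 = n * (t / n + 1) := by rw [mul_add, mul_comm]; omega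
      rw [this, Nat.mul_mod_right]
    rw [show n - t % n - 1 = 0 by omega]
    refine (spec_branch_nil (t := 6) (by simp [st, unary]) ?_).mono le_rfl
    refine ((spec_st_copy (by simp) (by simp)).seq (u := 4) ?_).mono (by norm_num)
    simp only [List.getD_cons_zero, List.set_cons_zero, List.set_cons_succ, List.getD_cons_succ]
    rw [hmod, hdiv, Nat.sub_zero]
    rcases hz : z.drop (t / n) with _ | ⟨b, l⟩
    · refine (spec_branch_nil (by simp [st]) spec_skip).congr rfl (by norm_num) ?_
      rw [segment_of_drop_eq_nil hs hz (Nat.le_succ t), ← List.drop_drop, hz, List.drop_nil]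
    · have hl : z.drop (t / n + 1) = l := by
        rw [← List.drop_drop, hz]; rfl
      refine (spec_branch_cons (b := b) (l := l) (t := 3) (by simp [st]) ?_).mono le_rfl
      rw [segment_succ hs hz hdiv, hl, unaryCount_append_singleton, unaryCount_append_singleton]
      cases b
      · exact ((spec_st_pop (by simp)).seq (spec_st_push _ (by simp))).congr rfl le_rfl
          (by simp [unaryCount_cons])
      · exact ((spec_st_pop (by simp)).seq (spec_st_push _ (by simp))).congr rfl le_rfl
          (by simp [unaryCount_cons])
  · have hdiv : (t + 1) / n = t / n := by
      rw [Nat.div_eq_iff hn]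
      omega
    have hmod : (t + 1) % n = t % n + 1 := by
      rw [Nat.add_mod, Nat.mod_eq_of_lt (show 1 < n by omega)]
      exact Nat.mod_eq_of_lt (by omega)
    refine (spec_branch_cons (b := true) (l := unary (n - t % n - 2)) (t := 1) ?_
      (spec_skip.congr rfl le_rfl ?_)).mono (by norm_num)
    · simp only [st, unary, ← List.replicate_succ]
      simp
      omega
    · have hseg : segment n z s (t + 1) = segment n z s t := by rw [segment, segment, hdiv]
      rw [hdiv, hmod, hseg, Nat.sub_sub]

/-- Distribute the bits of register 0 evenly over as many blocks as there are bits in register 2,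
and compute the majorities of the blocks. -/
def majDecProg : Prog :=
  .seq (.copy 0 4) <| .seq (.copy 2 1) <| .seq (.copy 2 3) <|
  .seq (forBits 1 (.seq (.copy 4 7) (.seq (forBits 7 tickProg tickProg) majProg))
    (.seq (.copy 4 7) (.seq (forBits 7 tickProg tickProg) majProg)))
  (forBits 8 (.push 1 (id false)) (.push 1 (id true)))

/-- A bound for the running time of `majDecProg` for `n` blocks and a string of length `L`. -/
def majDecTime (n L : ℕ) : ℕ := n * (18 * L + 50) + 20

/-- Block number `i` of `z`. -/
def blockAt (n : ℕ) (z : List Bool) (i : ℕ) : List Bool :=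
  (z.drop (i * z.length / n)).take ((i + 1) * z.length / n - i * z.length / n)

theorem foldP_maj (n : ℕ) (z l : List Bool) (i : ℕ) (acc : List Bool) :
    foldP (fun (_ : Bool) (x : ℕ × List Bool) =>
        (maj (blockAt n z x.1)).map fun b => (x.1 + 1, b :: x.2)) l (i, acc) =
      (mapIndep maj ((List.range' i l.length).map (blockAt n z))).map fun w =>
        (i + l.length, w.reverse ++ acc) := by
  induction l generalizing i acc with
  | nil => simp [foldP, mapIndep, PMF.pure_map]
  | cons b l ih =>
    rw [foldP, bind_map_fun, List.length_cons, List.range'_succ, List.map_cons, mapIndep_cons,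
      map_bind_fun]
    congr 1; funext c
    rw [ih, PMF.map_comp]
    congr 1; funext w
    simp; omega

/-- Pass `i` runs the clock from time i |z| to (i + 1) |z| and thus reads block `i`. The majorities
pile up in reverse order on register 8 and are put right by the last loop. -/
theorem spec_majDecProg {O : Oracle} (n : ℕ) (z : List Bool) (a : State) :
    Spec O majDecProg (st [z, [], unary n, [], [], [], [], [], [], [], []] a)
      (majDecTime n z.length)
      ((majDec n z).map fun x => st [z.drop (n * z.length / n), x, unary n,
        unary (n - (n * z.length) % n), z, [], [], [], [], [], []] a) := by
  have hbody : ∀ (l : List Bool) (x : ℕ × List Bool), 0 < n → Spec O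
      (.seq (.copy 4 7) (.seq (forBits 7 tickProg tickProg) majProg))
      (st [z.drop (x.1 * z.length / n), l, unary n, unary (n - (x.1 * z.length) % n), z, [], [],
        [], x.2, [], []] a) (18 * z.length + 40)
      (((maj (blockAt n z x.1)).map fun b => (x.1 + 1, b :: x.2)).map fun x =>
        st [z.drop (x.1 * z.length / n), l, unary n, unary (n - (x.1 * z.length) % n), z, [], [],
        [], x.2, [], []] a) := by
    rintro l ⟨i, acc⟩ hn
    have hloop := spec_forBits_pure (O := O) (t := 9) (r := 7) (P₀ := tickProg) (P₁ := tickProg)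
      (fun l' t => st [z.drop (t / n), l, unary n, unary (n - t % n), z,
        unaryCount (segment n z (i * z.length / n) t) true,
        unaryCount (segment n z (i * z.length / n) t) false, l', acc, [], []] a)
      (fun _ t => t + 1) (fun _ t => i * z.length / n ≤ t / n) (by intro l x; simp [st])
      (by intro b l x; rw [update_st_low (by simp)]; simp)
      (by
        intro b l' t ht
        rw [ite_self]
        exact spec_tickProg hn ht)
      (by
        intro b l' t ht
        exact ht.trans (Nat.div_le_div_right (Nat.le_succ t)))
      z (i * z.length) le_rfl
    have hfold : ∀ (l : List Bool) (t : ℕ), l.foldl (fun x _ => x + 1) t = t + l.length := by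
      intro l
      induction l with
      | nil => simp
      | cons b l ih => intro t; rw [List.foldl_cons, ih, List.length_cons]; omega
    have hempty : segment n z (i * z.length / n) (i * z.length) = [] := by simp [segment]
    have hfull : segment n z (i * z.length / n) (i * z.length + z.length) = blockAt n z i := by
      rw [segment, blockAt, add_mul, one_mul]
    rw [hfold, hempty, hfull] at hloop
    have hmaj := spec_majProg (O := O) (a := a)
      (r0 := z.drop ((i * z.length + z.length) / n)) (r1 := l) (r2 := unary n)
      (r3 := unary (n - (i * z.length + z.length) % n)) (r4 := z)
      (r5 := unaryCount (blockAt n z i) true) (r6 := unaryCount (blockAt n z i) false) (r8 := acc)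
    rw [← maj_eq_majCount] at hmaj
    have h := (spec_st_copy (O := O) (a := a) (L := [z.drop (i * z.length / n), l, unary n,
      unary (n - (i * z.length) % n), z, [], [], [], acc, [], []]) (i := 4) (j := 7)
      (by simp) (by simp)).seq (hloop.seq hmaj)
    refine h.congr rfl ?_ ?_
    · have h1 := count_add_count (blockAt n z i)
      have h2 : (blockAt n z i).length ≤ z.length := (List.length_take_le' _ _).trans (by simp)
      simp only [unaryCount, unary, List.length_replicate]
      omega
    · rw [PMF.map_comp]
      congr 1; funext b
      simp [add_mul]
  have houter := spec_forBits (O := O) (t := 18 * z.length + 40) (r := 1)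
    (P₀ := .seq (.copy 4 7) (.seq (forBits 7 tickProg tickProg) majProg))
    (P₁ := .seq (.copy 4 7) (.seq (forBits 7 tickProg tickProg) majProg))
    (fun l (x : ℕ × List Bool) => st [z.drop (x.1 * z.length / n), l, unary n,
      unary (n - (x.1 * z.length) % n), z, [], [], [], x.2, [], []] a)
    (fun (_ : Bool) (x : ℕ × List Bool) =>
        (maj (blockAt n z x.1)).map fun b => (x.1 + 1, b :: x.2))
    -- This invariant serves only to guarantee `0 < n` inside the loop, where the clock needs it.
    (fun l _ => l.length ≤ n) (by intro l x; simp [st])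
    (by intro b l x; rw [update_st_low (by simp)]; simp)
    (by
      intro b l x h
      rw [ite_self]
      exact hbody l x (by simp at h; omega))
    (by
      intro b l x h x' _
      simp at h; omega)
    (unary n) (0, []) (by simp [unary])
  rw [foldP_maj, PMF.map_comp] at houter
  have hlen : (unary n).length = n := by simp [unary]
  have hblocks : (List.range' 0 n).map (blockAt n z) = blocks n z := by
    rw [blocks, List.range_eq_range']; rfl
  rw [hlen, hblocks] at houter
  have hend := houter.seq_map (u := 5 * n + 1) (Q := forBits 8 (.push 1 (id false)) (.push 1 (id true)))
    (g := fun x => PMF.pure (st [z.drop (n * z.length / n), x, unary n,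
        unary (n - (n * z.length) % n), z, [], [], [], [], [], []] a)) (by
      intro x hx
      have hx' := length_of_mem_support_majDec n z x hx
      exact (spec_st_move id (by simp) (by simp) (by simp)).congr rfl (by simp [hx']; omega)
        (by simp))
  have h3 := (spec_st_copy (O := O) (a := a) (L := [z, unary n, unary n, [], z, [], [], [], [], [],
    []]) (i := 2) (j := 3) (by simp) (by simp)).seq (hend.congr (by simp) le_rfl rfl)
  have h2 := (spec_st_copy (O := O) (a := a) (L := [z, [], unary n, [], z, [], [], [], [], [],
    []]) (i := 2) (j := 1) (by simp) (by simp)).seq h3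
  have h1 := (spec_st_copy (O := O) (a := a) (L := [z, [], unary n, [], [], [], [], [], [], [],
    []]) (i := 0) (j := 4) (by simp) (by simp)).seq h2
  refine h1.congr rfl ?_ rfl
  simp only [majDecTime]
  have : n * (18 * z.length + 40 + 4) = n * (18 * z.length + 44) := rfl
  have : n * (18 * z.length + 50) = n * (18 * z.length + 44) + n * 6 := by ring
  omega

/-! ## The composed code: algorithms, soundness and pseudorandomness -/

theorem eval_mono (p : Polynomial ℕ) {a b : ℕ} (h : a ≤ b) : p.eval a ≤ p.eval b := by
  rw [Polynomial.eval_eq_sum_range, Polynomial.eval_eq_sum_range]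
  gcongr

/-- The running time of `majEncProg` as a polynomial. -/
def majEncPoly : Polynomial ℕ :=
  .X * (7 * .X + 7) + .X * (19 * (2 * (.X * .X) + 1) + 50) + 20

theorem eval_majEncPoly (n : ℕ) : majEncPoly.eval n = majEncTime n := by
  simp [majEncPoly, majEncTime, expansion]

theorem majEncTime_mono {a b : ℕ} (h : a ≤ b) : majEncTime a ≤ majEncTime b := by
  rw [← eval_majEncPoly, ← eval_majEncPoly]
  exact eval_mono _ h

/-- Without an oracle, every step makes the registers longer by at most one bit. -/
theorem length_le_of_mem_support_steps (t : ℕ) : ∀ (c : Config) (M : ℕ),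
    (∀ r, (c.2 r).length ≤ M) → ∀ c' ∈ (steps noOracle t c).support,
      ∀ r, (c'.2 r).length ≤ M + t := by
  induction t with
  | zero =>
    intro c M hM c' hc'
    simp only [steps, PMF.support_pure, Set.mem_singleton_iff] at hc'
    subst hc'
    exact hM
  | succ t ih =>
    intro c M hM c' hc'
    rw [steps, PMF.mem_support_bind_iff] at hc'
    obtain ⟨d, hd, hc'⟩ := hc'
    have hupd : ∀ (r : ℕ) (v : List Bool), v.length ≤ M + 1 →
        ∀ r', (Function.update c.2 r v r').length ≤ M + 1 := by
      intro r v hv r'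
      by_cases h : r' = r
      · subst h; simpa using hv
      · rw [Function.update_of_ne h]; exact (hM r').trans (Nat.le_succ M)
    have hkeep : ∀ r, (c.2 r).length ≤ M + 1 := fun r => (hM r).trans (Nat.le_succ M)
    have hd' : ∀ r, (d.2 r).length ≤ M + 1 := by
      obtain ⟨l, s⟩ := c
      match l with
      | [] =>
        simp only [step, PMF.support_pure, Set.mem_singleton_iff] at hd
        subst hd; exact hkeep
      | Prog.skip :: k =>
        simp only [step, PMF.support_pure, Set.mem_singleton_iff] at hd
        subst hd; exact hkeep
      | Prog.push r b :: k =>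
        simp only [step, PMF.support_pure, Set.mem_singleton_iff] at hd
        subst hd; exact hupd r _ (by simpa using hM r)
      | Prog.pop r :: k =>
        simp only [step, PMF.support_pure, Set.mem_singleton_iff] at hd
        subst hd
        refine hupd r _ ?_
        have : (s r).length ≤ M := hM r
        rw [List.length_tail]
        omega
      | Prog.copy r r' :: k =>
        simp only [step, PMF.support_pure, Set.mem_singleton_iff] at hd
        subst hd; exact hupd r' _ (hkeep r)
      | Prog.flip r :: k =>
        simp only [step, PMF.mem_support_map_iff] at hd
        obtain ⟨b, -, rfl⟩ := hd
        exact hupd r _ (by simpa using hM r)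
      | Prog.query r r' :: k =>
        simp only [step, PMF.mem_support_map_iff, noOracle, PMF.support_pure,
          Set.mem_singleton_iff] at hd
        obtain ⟨b, rfl, rfl⟩ := hd
        exact hupd r' _ (by simp)
      | Prog.seq P Q :: k =>
        simp only [step, PMF.support_pure, Set.mem_singleton_iff] at hd
        subst hd; exact hkeep
      | Prog.branch r P P₀ P₁ :: k =>
        simp only [step] at hd
        split at hd <;> simp only [PMF.support_pure, Set.mem_singleton_iff] at hd <;> subst hd <;>
          exact hkeep
      | Prog.loop r P :: k =>
        simp only [step] at hd
        split at hd <;> simp only [PMF.support_pure, Set.mem_singleton_iff] at hd <;> subst hd <;>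
          exact hkeep
    intro r
    have := ih d (M + 1) hd' c' hc' r
    omega

/-- A computation cannot write more bits than it takes steps, beyond the length of its input. For
the block length this bounds the cost of the majority code by a polynomial in the security
parameter. -/
theorem exists_polynomial_bound {f : ℕ → ℕ} (hf : PolyTimeLength f) :
    ∃ B : Polynomial ℕ, ∀ n, f n ≤ B.eval n := by
  obtain ⟨P, T, h⟩ := hf
  refine ⟨.X + T, fun n => ?_⟩
  have h2 := (h n).2
  obtain ⟨c, hc⟩ := (steps noOracle (T.eval n) (initial P [unary n])).support_nonempty
  have hmem : c.2 0 ∈ ((finalState noOracle P [unary n] (T.eval n)).map fun s => s 0).support := by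
    rw [PMF.mem_support_map_iff]
    refine ⟨c.2, ?_, rfl⟩
    rw [finalState, PMF.mem_support_map_iff]
    exact ⟨c, hc, rfl⟩
  rw [h2, PMF.support_pure, Set.mem_singleton_iff] at hmem
  have := length_le_of_mem_support_steps (T.eval n) (initial P [unary n]) n (by
    intro r
    rcases r with _ | r <;> simp [initial, unary]) c hc 0
  rw [hmem] at this
  simpa [unary] using this

section save

variable {O : Oracle} {L : List (List Bool)} {a : State}

theorem spec_st_save {i : ℕ} (r : ℕ) (h : i < L.length) :
    Spec O (Prog.copy i (r + L.length)) (st L a) 1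
      (PMF.pure (st L (Function.update a r (L.getD i [])))) := by
  have := spec_copy (O := O) (s := st L a) i (r + L.length)
  rwa [update_st_high, st_getD h] at this

theorem spec_st_load {j : ℕ} (r : ℕ) (h : j < L.length) :
    Spec O (Prog.copy (r + L.length) j) (st L a) 1 (PMF.pure (st (L.set j (a r)) a)) := by
  have := spec_copy (O := O) (s := st L a) (r + L.length) j
  rwa [update_st_low h, st_high] at this

end save

theorem update_blank_two (x y : List Bool) :
    Function.update (Function.update blank 0 x) 1 y = fun i => [x, y].getD i [] := by
  funext i
  rcases i with _ | _ | i <;> simp [blank]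

theorem update_blank_three (x y z : List Bool) :
    Function.update (Function.update (Function.update blank 0 x) 1 y) 2 z =
      fun i => [x, y, z].getD i [] := by
  funext i
  rcases i with _ | _ | _ | i <;> simp [blank]

/-- The majority encoding with blocks of the length `expansion`. -/
def majEncode (y : List Bool) : PMF (List Bool) :=
  majEnc (expansion y.length) (odd_expansion _) y

theorem majEncode_eq {n : ℕ} {y : List Bool} (h : y.length = n) :
    majEncode y = majEnc (expansion n) (odd_expansion n) y := by
  subst h; rfl

theorem length_of_mem_support_majEncode {y x : List Bool} (h : x ∈ (majEncode y).support) :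
    x.length = y.length * expansion y.length :=
  length_of_mem_support_majEnc _ _ _ h

/-- Run the encoder `P`, and apply the majority encoding. -/
def encodeProg (P : Prog) : Prog :=
  .seq (.copy 0 (0 + 11)) <| .seq (.copy 1 (1 + 11)) <| .seq (.copy 2 (2 + 11)) <|
  .seq (.copy 10 0) <| .seq (.copy 10 1) <| .seq (.copy 10 2) <|
  .seq (P.translate (fun r => r + 11) Prog.query) <|
  .seq (.copy (0 + 11) 0) <| .seq majEncProg (.copy 1 0)

/-- `P` runs on the registers from 11 on: the inputs are copied there, and the working registers are
cleared, as `majEncProg` expects them to be empty. -/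
theorem computes_encodeProg {P : Prog} {x0 x1 x2 : List Bool} {t n : ℕ} {μ : PMF (List Bool)}
    (h : Computes P [x0, x1, x2] t (fun s => s 0) μ) (hn : ∀ x ∈ μ.support, x.length = n) :
    Computes (encodeProg P) [x0, x1, x2] (t + majEncTime n + 20) (fun s => s 0)
      (μ.bind majEncode) := by
  obtain ⟨hh, hμ⟩ := computes_iff.1 h
  set ν := law noOracle ([P], fun i => [x0, x1, x2].getD i []) t with hν
  have hP := spec_rename (ρ := fun r => r + 11)
    (emb := st [[], [], [], [], [], [], [], [], [], [], []])
    (fun a r => st_high (L := [[], [], [], [], [], [], [], [], [], [], []]) r)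
    (fun a r v => update_st_high (L := [[], [], [], [], [], [], [], [], [], [], []]) r v) hh
  rw [← hν] at hP
  have hrest : ∀ a ∈ ν.support, Spec noOracle
      (.seq (.copy (0 + 11) 0) <| .seq majEncProg (.copy 1 0))
      (st [[], [], [], [], [], [], [], [], [], [], []] a) (majEncTime n + 4)
      ((majEncode (a 0)).map fun x => st [x, x, [], [], [], [], [], [], [], [], []] a) := by
    intro a ha
    have ha0 : (a 0).length = n := by
      refine hn _ ?_
      rw [← hμ, PMF.mem_support_map_iff]
      exact ⟨a, ha, rfl⟩
    have h1 := (spec_majEncProg (O := noOracle) (a 0) a).seq_map (Q := .copy 1 0) (u := 1)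
      (g := fun x => PMF.pure (st [x, x, [], [], [], [], [], [], [], [], []] a))
      (fun x _ => (spec_st_copy (by simp) (by simp)).congr rfl le_rfl (by simp))
    refine ((spec_st_load (L := [[], [], [], [], [], [], [], [], [], [], []]) 0
      (by simp)).seq h1).congr rfl ?_ rfl
    rw [ha0]; omega
  have h7 := hP.seq_map hrest
  have h6 := (spec_st_copy (O := noOracle) (a := fun i => [x0, x1, x2].getD i [])
    (L := [[], [], x2, [], [], [], [], [], [], [], []]) (i := 10) (j := 2) (by simp)
    (by simp)).seq h7
  have h5 := (spec_st_copy (O := noOracle) (a := fun i => [x0, x1, x2].getD i [])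
    (L := [[], x1, x2, [], [], [], [], [], [], [], []]) (i := 10) (j := 1) (by simp)
    (by simp)).seq h6
  have h4 := (spec_st_copy (O := noOracle) (a := fun i => [x0, x1, x2].getD i [])
    (L := [x0, x1, x2, [], [], [], [], [], [], [], []]) (i := 10) (j := 0) (by simp)
    (by simp)).seq h5
  rw [← update_blank_three] at h4
  have h3 := (spec_st_save (O := noOracle) (L := [x0, x1, x2, [], [], [], [], [], [], [], []])
    (i := 2) 2 (by simp)).seq h4
  have h2 := (spec_st_save (O := noOracle) (L := [x0, x1, x2, [], [], [], [], [], [], [], []])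
    (i := 1) 1 (by simp)).seq h3
  have h1 := (spec_st_save (O := noOracle) (L := [x0, x1, x2, [], [], [], [], [], [], [], []])
    (a := blank) (i := 0) 0 (by simp)).seq h2
  have hfin := (h1.congr (u := t + majEncTime n + 20) (initial_eq_st [x0, x1, x2] 8) (by omega)
    rfl).computes (out := fun s => s 0)
  convert hfin using 1
  · rfl
  rw [← hμ, bind_map_fun, map_bind_fun]
  congr 1; funext a
  rw [PMF.map_comp]
  exact (PMF.map_id _).symm

/-- Compute the block length by `Q`, apply the majority decoding, and run the decoder `P`. -/
def decodeProg (Q P : Prog) : Prog :=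
  .seq (.copy 0 (2 * 0 + 1 + 11)) <|
  .seq (Q.translate (fun r => 2 * r + 1 + 11) Prog.query) <|
  .seq (.copy 0 (2 * 0 + 11)) <| .seq (.copy 1 (2 * 1 + 11)) <| .seq (.copy 2 0) <|
  .seq (.copy 10 1) <| .seq (.copy (2 * 0 + 1 + 11) 2) <| .seq majDecProg <|
  .seq (.copy 1 (2 * 2 + 11)) <| .seq (P.translate (fun r => 2 * r + 11) Prog.query)
  (.copy (2 * 0 + 11) 0)

/-- Two foreign programs run here, and `P` must find its registers blank apart from its inputs after
`Q` has left arbitrary data. So beyond the working registers `P` owns every other register and `Q`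
the rest. -/
theorem computes_decodeProg {Q P : Prog} {x0 x1 x2 : List Bool} {t u n : ℕ}
    {μ : List Bool → PMF (List Bool)}
    (hQ : Computes Q [x0] u (fun s => s 0) (PMF.pure (unary n)))
    (hP : ∀ x : List Bool, x.length = n → Computes P [x0, x1, x] t (fun s => s 0) (μ x)) :
    Computes (decodeProg Q P) [x0, x1, x2] (u + majDecTime n x2.length + t + 20) (fun s => s 0)
      ((majDec n x2).bind μ) := by
  obtain ⟨hQh, hQμ⟩ := computes_iff.1 hQ
  set ν := law noOracle ([Q], fun i => [x0].getD i []) u with hν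
  have hQs := spec_rename (ρ := fun r => 2 * r + 1 + 11)
    (emb := fun b => st [x0, x1, x2, [], [], [], [], [], [], [], []] (interleave blank b))
    (fun b r => (st_high (L := [x0, x1, x2, [], [], [], [], [], [], [], []]) _).trans
      (interleave_odd _ _ _))
    (fun b r v => (update_st_high (L := [x0, x1, x2, [], [], [], [], [], [], [], []]) _ v).trans
      (by rw [update_interleave_odd])) hQh
  rw [← hν] at hQs
  let ξ : List Bool → PMF State := fun x => law noOracle ([P], fun i => [x0, x1, x].getD i []) t
  have hrest : ∀ b ∈ ν.support, Spec noOracle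
      (.seq (.copy 0 (2 * 0 + 11)) <| .seq (.copy 1 (2 * 1 + 11)) <| .seq (.copy 2 0) <|
        .seq (.copy 10 1) <| .seq (.copy (2 * 0 + 1 + 11) 2) <| .seq majDecProg <|
        .seq (.copy 1 (2 * 2 + 11)) <| .seq (P.translate (fun r => 2 * r + 11) Prog.query)
        (.copy (2 * 0 + 11) 0))
      (st [x0, x1, x2, [], [], [], [], [], [], [], []] (interleave blank b))
      (majDecTime n x2.length + t + 16)
      ((majDec n x2).bind fun x => (ξ x).bind fun a =>
        PMF.pure (st [a 0, x, unary n, unary (n - (n * x2.length) % n), x2, [], [], [], [], [], []]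
          (interleave a b))) := by
    intro b hb
    have hb0 : b 0 = unary n := by
      have : b 0 ∈ (PMF.pure (unary n)).support := by
        rw [← hQμ, PMF.mem_support_map_iff]
        exact ⟨b, hb, rfl⟩
      simpa using this
    have hfin : ∀ x ∈ (majDec n x2).support, Spec noOracle
        (.seq (.copy 1 (2 * 2 + 11)) <| .seq (P.translate (fun r => 2 * r + 11) Prog.query)
          (.copy (2 * 0 + 11) 0))
        (st [x2.drop (n * x2.length / n), x, unary n, unary (n - (n * x2.length) % n), x2, [], [],
          [], [], [], []]
          (interleave (Function.update (Function.update blank 0 x0) 1 x1) b)) (t + 4)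
        ((ξ x).bind fun a =>
          PMF.pure (st [a 0, x, unary n, unary (n - (n * x2.length) % n), x2, [], [], [], [], [],
            []] (interleave a b))) := by
      intro x hx
      have hPh := (computes_iff.1 (hP x (length_of_mem_support_majDec _ _ _ hx))).1
      have hPs := spec_rename (ρ := fun r => 2 * r + 11)
        (emb := fun a => st [x2.drop (n * x2.length / n), x, unary n,
          unary (n - (n * x2.length) % n), x2, [], [], [], [], [], []] (interleave a b))
        (fun a r => (st_high (L := [x2.drop (n * x2.length / n), x, unary n,
          unary (n - (n * x2.length) % n), x2, [], [], [], [], [], []]) _).trans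
          (interleave_even _ _ _))
        (fun a r v => (update_st_high (L := [x2.drop (n * x2.length / n), x, unary n,
          unary (n - (n * x2.length) % n), x2, [], [], [], [], [], []]) _ v).trans
          (by rw [update_interleave_even])) hPh
      rw [show law noOracle ([P], fun i => [x0, x1, x].getD i []) t = ξ x from rfl] at hPs
      have h2 := hPs.seq_map (Q := .copy (2 * 0 + 11) 0) (u := 1)
        (g := fun a => PMF.pure (st [a 0, x, unary n, unary (n - (n * x2.length) % n), x2, [], [],
          [], [], [], []] (interleave a b))) (fun a _ =>
          (spec_st_load (L := [x2.drop (n * x2.length / n), x, unary n,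
          unary (n - (n * x2.length) % n), x2, [], [], [], [], [], []]) (2 * 0) (by simp)).congr
            rfl le_rfl (by rw [interleave_even]; rfl))
      rw [← update_blank_three, ← update_interleave_even] at h2
      refine Spec.mono (t := 1 + (t + 1 + 1) + 1) ?_ (by omega)
      exact (spec_st_save (L := [x2.drop (n * x2.length / n), x, unary n,
          unary (n - (n * x2.length) % n), x2, [], [], [], [], [], []]) (2 * 2) (i := 1)
          (by simp)).seq h2
    have h6 := (spec_majDecProg (O := noOracle) n x2 (interleave (Function.update
      (Function.update blank 0 x0) 1 x1) b)).seq_map hfin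
    have h5 := (spec_st_load (O := noOracle) (a := interleave (Function.update
      (Function.update blank 0 x0) 1 x1) b) (L := [x2, [], x2, [], [], [], [], [], [], [], []])
      (j := 2) (2 * 0 + 1) (by simp)).seq (h6.congr (by rw [interleave_odd, hb0]; rfl) le_rfl rfl)
    have h4 := (spec_st_copy (O := noOracle) (a := interleave (Function.update
      (Function.update blank 0 x0) 1 x1) b) (L := [x2, x1, x2, [], [], [], [], [], [], [], []])
      (i := 10) (j := 1) (by simp) (by simp)).seq h5
    have h3 := (spec_st_copy (O := noOracle) (a := interleave (Function.update
      (Function.update blank 0 x0) 1 x1) b) (L := [x0, x1, x2, [], [], [], [], [], [], [], []])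
      (i := 2) (j := 0) (by simp) (by simp)).seq h4
    rw [← update_interleave_even] at h3
    have h2 := (spec_st_save (O := noOracle) (L := [x0, x1, x2, [], [], [], [], [], [], [], []])
      (i := 1) (2 * 1) (by simp)).seq h3
    rw [← update_interleave_even] at h2
    exact ((spec_st_save (O := noOracle) (L := [x0, x1, x2, [], [], [], [], [], [], [], []])
      (i := 0) (2 * 0) (by simp)).seq h2).mono (by omega)
  have hx0 : Function.update blank 0 x0 = fun i => [x0].getD i [] := by
    funext i
    rcases i with _ | i <;> simp [blank]
  have h2 := hQs.seq_map hrest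
  rw [← hx0, ← update_interleave_odd, interleave_blank] at h2
  have h1 := (spec_st_save (O := noOracle) (L := [x0, x1, x2, [], [], [], [], [], [], [], []])
      (i := 0) (2 * 0 + 1) (by simp)).seq h2
  have hfin := (h1.congr (u := u + majDecTime n x2.length + t + 20) (initial_eq_st [x0, x1, x2] 8)
    (by omega) rfl).computes (out := fun s => s 0)
  convert hfin using 1
  · rfl
  rw [map_bind_fun]
  simp only [map_bind_fun, PMF.pure_map]
  -- Of the final state of `Q` only register 0 is used, and it is deterministic; its other registers
  -- do not influence the output and are averaged out.
  change _ = ν.bind fun _ => (majDec n x2).bind fun x => (ξ x).bind fun a => PMF.pure (a 0)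
  rw [PMF.bind_const]
  refine bind_congr_support _ _ _ fun x hx => ?_
  exact (computes_iff.1 (hP x (length_of_mem_support_majDec _ _ _ hx))).2.symm

/-- A query followed by the majority encoding of the answer. -/
def querySub (r r' : ℕ) : Prog :=
  .seq (.query r 0) <| .seq majEncProg <| .seq (.copy 1 r') (.copy 10 1)

/-- Simulate the adversary `A` against the composed code by an adversary against the inner code. -/
def simulate (A : Prog) : Prog :=
  .seq (.copy 0 (0 + 11)) <| .seq (.copy 1 (1 + 11)) <| .seq (.copy 10 0) <| .seq (.copy 10 1) <|
  .seq (A.translate (fun r => r + 11) querySub) (.copy (0 + 11) 0)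

/-- Every answer of the oracle is encoded. -/
def majOracle (O : Oracle) : Oracle := fun q => (O q).bind majEncode

/-- The empty answer to a rejected query is covered too: it is encoded by the empty string, in no
more time than a codeword. -/
theorem spec_querySub {O : Oracle} {n : ℕ}
    (hO : ∀ q, ∀ y ∈ (O q).support, y.length = n ∨ y = []) (a : State) (r r' : ℕ) :
    Spec O (querySub (r + 11) (r' + 11)) (st [[], [], [], [], [], [], [], [], [], [], []] a)
      (majEncTime n + 8) ((majOracle O (a r)).map fun y =>
        st [[], [], [], [], [], [], [], [], [], [], []] (Function.update a r' y)) := by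
  have h1 := spec_query (O := O) (s := st [[], [], [], [], [], [], [], [], [], [], []] a)
    (r + 11) 0
  have hr : st [[], [], [], [], [], [], [], [], [], [], []] a (r + 11) = a r :=
    st_high (L := [[], [], [], [], [], [], [], [], [], [], []]) r
  rw [hr] at h1
  simp only [update_st_low (L := [[], [], [], [], [], [], [], [], [], [], []]) (i := 0)
    (by simp)] at h1
  have h3 : ∀ x : List Bool, Spec O (.seq (.copy 1 (r' + 11)) (.copy 10 1))
      (st [[], x, [], [], [], [], [], [], [], [], []] a) 3
      (PMF.pure (st [[], [], [], [], [], [], [], [], [], [], []] (Function.update a r' x))) := by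
    intro x
    exact (spec_st_save (L := [[], x, [], [], [], [], [], [], [], [], []]) r' (by simp)).seq
      (spec_st_copy (by simp) (by simp))
  have h2 : ∀ y ∈ (O (a r)).support, Spec O (.seq majEncProg <| .seq (.copy 1 (r' + 11))
      (.copy 10 1)) (st [y, [], [], [], [], [], [], [], [], [], []] a) (majEncTime n + 4)
      ((majEncode y).bind fun x => PMF.pure
        (st [[], [], [], [], [], [], [], [], [], [], []] (Function.update a r' x))) := by
    intro y hy
    refine ((spec_majEncProg y a).seq_map fun x _ => h3 x).mono ?_
    have : majEncTime y.length ≤ majEncTime n := by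
      rcases hO _ y hy with h | h
      · rw [h]
      · exact majEncTime_mono (by simp [h])
    omega
  refine (h1.seq_map h2).congr rfl (by omega) ?_
  rw [majOracle, map_bind_fun]
  rfl

theorem spec_simulate {O : Oracle} {A : Prog} {x0 x1 : List Bool} {t n : ℕ}
    (hO : ∀ q, ∀ y ∈ (O q).support, y.length = n ∨ y = [])
    (h : HaltsWithin (majOracle O) A [x0, x1] t) :
    Spec O (simulate A) (fun i => [x0, x1].getD i []) (t * (majEncTime n + 8) + 12)
      ((finalState (majOracle O) A [x0, x1] t).map fun a =>
        st [a 0, [], [], [], [], [], [], [], [], [], []] a) := by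
  have hA := spec_translate (O := O) (O' := majOracle O) (sub := querySub)
    (ρ := fun r => r + 11) (emb := st [[], [], [], [], [], [], [], [], [], [], []])
    (C := majEncTime n + 8) (by omega)
    (fun a r => st_high (L := [[], [], [], [], [], [], [], [], [], [], []]) r)
    (fun a r v => update_st_high (L := [[], [], [], [], [], [], [], [], [], [], []]) r v)
    (spec_querySub hO) h
  have h5 := hA.seq_map (Q := .copy (0 + 11) 0) (u := 1)
    (g := fun a => PMF.pure (st [a 0, [], [], [], [], [], [], [], [], [], []] a))
    (fun a _ => spec_st_load (L := [[], [], [], [], [], [], [], [], [], [], []]) 0 (by simp))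
  have h4 := (spec_st_copy (O := O) (a := fun i => [x0, x1].getD i [])
    (L := [[], x1, [], [], [], [], [], [], [], [], []]) (i := 10) (j := 1) (by simp)
    (by simp)).seq h5
  have h3 := (spec_st_copy (O := O) (a := fun i => [x0, x1].getD i [])
    (L := [x0, x1, [], [], [], [], [], [], [], [], []]) (i := 10) (j := 0) (by simp)
    (by simp)).seq h4
  rw [← update_blank_two] at h3
  have h2 := (spec_st_save (O := O) (L := [x0, x1, [], [], [], [], [], [], [], [], []])
    (i := 1) 1 (by simp)).seq h3
  have h1 := (spec_st_save (O := O) (L := [x0, x1, [], [], [], [], [], [], [], [], []])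
    (a := blank) (i := 0) 0 (by simp)).seq h2
  exact h1.congr (initial_eq_st [x0, x1] 9) (by omega) (by rw [update_blank_two]; rfl)

/-! ### Transfer of the requirements from the inner code to the composed code. -/

section del

variable {S : Scheme} {mode : KeyMode}

theorem wellTyped_del (h : S.WellTyped mode) :
    (S.del expansion odd_expansion).WellTyped mode where
  keyGen := h.keyGen
  sameKey := h.sameKey
  encode := by
    intro sec ek msg hek hmsg y hy
    obtain ⟨x, hx, hy⟩ := (PMF.mem_support_bind_iff _ _ _).1 hy
    rw [length_of_mem_support_majEnc _ _ _ hy, h.encode sec ek msg hek hmsg x hx]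
    rfl
  decode := by
    intro sec dk c hdk msg hmsg
    obtain ⟨x, -, hx⟩ := (PMF.mem_support_bind_iff _ _ _).1 hmsg
    exact h.decode sec dk x hdk msg hx

theorem polyTime_del (hn : PolyTimeLength S.blockLen) (hw : S.WellTyped mode)
    (h : S.PolyTime) : (S.del expansion odd_expansion).PolyTime where
  keyGen := h.keyGen
  encode := by
    obtain ⟨B, hB⟩ := exists_polynomial_bound hn
    obtain ⟨P, T, hP⟩ := h.encode
    refine ⟨encodeProg P, T + majEncPoly.comp B + 20, fun sec ek msg hek hmsg => ?_⟩
    have hx := hw.encode sec ek msg hek hmsg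
    have hc := computes_encodeProg (hP sec ek msg hek hmsg) hx
    have hlaw : (S.encode sec ek msg).bind majEncode =
        (S.del expansion odd_expansion).encode sec ek msg :=
      bind_congr_support _ _ _ fun x hx' => majEncode_eq (hx x hx')
    rw [hlaw, computes_iff] at hc
    have htime : T.eval (sec + ek.length + msg.length) + majEncTime (S.blockLen sec) + 20 ≤
        (T + majEncPoly.comp B + 20).eval (sec + ek.length + msg.length) := by
      rw [← eval_majEncPoly]
      simp only [Polynomial.eval_add, Polynomial.eval_comp, Polynomial.eval_ofNat]
      gcongr
      exact eval_mono _ ((hB sec).trans (eval_mono _ (by omega)))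
    have hf := hc.1.haltsWithLaw.mono htime
    refine computes_iff.2 ⟨hf.halts, ?_⟩
    rw [hf.law_eq]
    exact hc.2
  decode := by
    obtain ⟨B, hB⟩ := exists_polynomial_bound hn
    -- The decoder has to know the number of blocks, which the received string does not reveal. Here
    -- the computability of the block length is needed, and not only a bound for it.
    obtain ⟨Q, U, hQ⟩ := hn
    obtain ⟨P, T, hP⟩ := h.decode
    refine ⟨decodeProg Q P, U + (B * (18 * .X + 50) + 20) + T.comp (.X + B) + 20,
      fun sec dk c hdk => ?_⟩
    have hc := computes_decodeProg (x1 := dk) (x2 := c)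
      (μ := fun x => (S.decode sec dk x).map encodeOption)
      (t := T.eval (sec + dk.length + S.blockLen sec)) (P := P) (hQ sec) (by
        intro x hx
        have := hP sec dk x hdk
        rwa [hx] at this)
    rw [← map_bind_fun, computes_iff] at hc
    have htime : U.eval sec + majDecTime (S.blockLen sec) c.length +
        T.eval (sec + dk.length + S.blockLen sec) + 20 ≤
        (U + (B * (18 * .X + 50) + 20) + T.comp (.X + B) + 20).eval
          (sec + dk.length + c.length) := by
      have hB' : S.blockLen sec ≤ B.eval (sec + dk.length + c.length) :=
        (hB sec).trans (eval_mono _ (by omega))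
      simp only [Polynomial.eval_add, Polynomial.eval_comp, Polynomial.eval_ofNat,
        Polynomial.eval_mul, Polynomial.eval_X, majDecTime]
      gcongr
      · exact eval_mono _ (by omega)
      · omega
      · exact eval_mono _ (by omega)
    have hf := hc.1.haltsWithLaw.mono htime
    refine computes_iff.2 ⟨hf.halts, ?_⟩
    rw [hf.law_eq]
    exact hc.2

/-- The coins of the majority decoding are independent of the keys, so they can be fixed first;
soundness of the inner code then applies to each fixed result. -/
theorem sound_del (h : S.Sound) : (S.del expansion odd_expansion).Sound := by
  obtain ⟨ν, hν, h⟩ := h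
  refine ⟨ν, hν, fun sec c => ?_⟩
  have : ((S.del expansion odd_expansion).keyGen sec).bind (fun keys =>
      (S.del expansion odd_expansion).decode sec keys.1 c) =
      (majDec (S.blockLen sec) c).bind fun x =>
        (S.keyGen sec).bind fun keys => S.decode sec keys.1 x := by
    simp only [Scheme.del]
    rw [PMF.bind_comm]
  rw [this]
  exact le_Pr_bind _ _ _ _ fun x _ => h sec x

theorem answers_majOracle {O : Oracle} {n : ℕ}
    (hO : ∀ q, ∀ y ∈ (O q).support, y.length = n ∨ y = []) :
    ∀ q, ∀ y ∈ (majOracle O q).support, y.length = n * expansion n ∨ y = [] := by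
  intro q x hx
  obtain ⟨y, hy, hx⟩ := (PMF.mem_support_bind_iff _ _ _).1 hx
  have hlen := length_of_mem_support_majEncode hx
  rcases hO q y hy with h | h
  · left; rw [hlen, h]
  · right
    rw [h] at hlen
    simpa using hlen

/-- Rejected queries remain rejected under `majOracle`. -/
theorem majEncode_nil : majEncode [] = PMF.pure [] := by
  simp [majEncode, majEnc, mapIndep, PMF.pure_map]

theorem encodeOracle_del (hw : S.WellTyped mode) (sec : ℕ) (ek : List Bool)
    (hek : ek.length = S.encKeyLen sec) :
    (S.del expansion odd_expansion).encodeOracle sec ek = majOracle (S.encodeOracle sec ek) := by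
  funext msg
  have e : (S.del expansion odd_expansion).encodeOracle sec ek msg =
      if msg.length = S.msgLen sec then (S.del expansion odd_expansion).encode sec ek msg
      else PMF.pure [] := rfl
  rw [e, majOracle, Scheme.encodeOracle]
  by_cases h : msg.length = S.msgLen sec
  · rw [if_pos h, if_pos h]
    exact bind_congr_support _ _ _ fun x hx => (majEncode_eq (hw.encode sec ek msg hek h x hx)).symm
  · rw [if_neg h, if_neg h, PMF.pure_bind, majEncode_nil]

theorem uniformOracle_del (sec : ℕ) :
    (S.del expansion odd_expansion).uniformOracle sec = majOracle (S.uniformOracle sec) := by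
  funext msg
  have e : (S.del expansion odd_expansion).uniformOracle sec msg =
      if msg.length = S.msgLen sec then
        uniformString (S.blockLen sec * expansion (S.blockLen sec))
      else PMF.pure [] := rfl
  rw [e, majOracle, Scheme.uniformOracle]
  by_cases h : msg.length = S.msgLen sec
  · rw [if_pos h, if_pos h, ← uniformString_bind_majEnc (odd_expansion _)]
    exact bind_congr_support _ _ _ fun x hx =>
      (majEncode_eq (length_of_mem_support_uniformString hx)).symm
  · rw [if_neg h, if_neg h, PMF.pure_bind, majEncode_nil]

theorem answers_encodeOracle (hw : S.WellTyped mode) {sec : ℕ} {ek : List Bool}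
    (hek : ek.length = S.encKeyLen sec) :
    ∀ q, ∀ y ∈ (S.encodeOracle sec ek q).support, y.length = S.blockLen sec ∨ y = [] := by
  intro q y hy
  simp only [Scheme.encodeOracle] at hy
  split_ifs at hy with h
  · exact Or.inl (hw.encode sec ek q hek h y hy)
  · simp_all

theorem answers_uniformOracle (sec : ℕ) :
    ∀ q, ∀ y ∈ (S.uniformOracle sec q).support, y.length = S.blockLen sec ∨ y = [] := by
  intro q y hy
  simp only [Scheme.uniformOracle] at hy
  split_ifs at hy with h
  · exact Or.inl (length_of_mem_support_uniformString hy)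
  · simp_all

/-- Both oracles of the composed code are `majOracle` of the corresponding oracle of the inner code,
and `simulate A` with an oracle `O` accepts exactly as often as `A` with `majOracle O`. So the two
adversaries have the same advantage. -/
theorem pseudorandom_del (hn : PolyTimeLength S.blockLen) (hw : S.WellTyped mode)
    (h : S.Pseudorandom mode) : (S.del expansion odd_expansion).Pseudorandom mode := by
  intro A T hA
  obtain ⟨B, hB⟩ := exists_polynomial_bound hn
  let T' : Polynomial ℕ := T * (majEncPoly.comp B + 8) + 12
  have htime : ∀ sec, T.eval sec * (majEncTime (S.blockLen sec) + 8) + 12 ≤ T'.eval sec := by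
    intro sec
    rw [← eval_majEncPoly]
    simp only [T', Polynomial.eval_add, Polynomial.eval_comp, Polynomial.eval_ofNat,
      Polynomial.eval_mul]
    gcongr
    exact eval_mono _ (hB sec)
  have hspec : ∀ (sec : ℕ) (ek : List Bool), ek.length = S.encKeyLen sec → ∀ O : Oracle,
      (∀ q, ∀ y ∈ (O q).support, y.length = S.blockLen sec ∨ y = []) →
      Spec O (simulate A) (fun i => [unary sec, mode.view ek].getD i []) (T'.eval sec)
        ((finalState (majOracle O) A [unary sec, mode.view ek] (T.eval sec)).map fun a =>
          st [a 0, [], [], [], [], [], [], [], [], [], []] a) :=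
    fun sec ek hek O hO =>
      (spec_simulate hO (hA sec ek hek (majOracle O) (answers_majOracle hO))).mono (htime sec)
  -- The time bound is required for all oracles with admissible answers; it carries over since
  -- `majOracle` preserves admissibility.
  have hA' : S.AdversaryTime mode (simulate A) T' := fun sec ek hek O hO =>
    (hspec sec ek hek O hO).haltsWithLaw.halts
  have hacc : ∀ (sec : ℕ) (O : List Bool → Oracle), (∀ ek, ek.length = S.encKeyLen sec →
      ∀ q, ∀ y ∈ (O ek q).support, y.length = S.blockLen sec ∨ y = []) →
      S.acceptProb mode (simulate A) (T'.eval sec) sec O =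
        S.acceptProb mode A (T.eval sec) sec fun ek => majOracle (O ek) := by
    intro sec O hO
    have : ∀ keys ∈ (S.keyGen sec).support,
        finalState (O keys.2) (simulate A) [unary sec, mode.view keys.2] (T'.eval sec) =
        (finalState (majOracle (O keys.2)) A [unary sec, mode.view keys.2] (T.eval sec)).map
          fun a => st [a 0, [], [], [], [], [], [], [], [], [], []] a := fun keys hkeys =>
      (hspec sec keys.2 (hw.keyGen sec keys hkeys).2 (O keys.2)
        (hO _ (hw.keyGen sec keys hkeys).2)).law_eq
    rw [Scheme.acceptProb, bind_congr_support _ _ _ this, ← map_bind_fun, Pr_map]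
    rfl
  have hkey := h (simulate A) T' hA'
  refine Eq.mpr (congrArg Negligible (funext fun sec => ?_)) hkey
  have h1 : (S.del expansion odd_expansion).acceptProb mode A (T.eval sec) sec
      (fun ek => (S.del expansion odd_expansion).encodeOracle sec ek) =
      S.acceptProb mode A (T.eval sec) sec (fun ek => majOracle (S.encodeOracle sec ek)) := by
    simp only [Scheme.acceptProb]
    congr 1
    refine bind_congr_support _ _ _ fun keys hkeys => ?_
    rw [encodeOracle_del hw sec keys.2 (hw.keyGen sec keys hkeys).2]
  have h2 : (S.del expansion odd_expansion).acceptProb mode A (T.eval sec) sec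
      (fun _ => (S.del expansion odd_expansion).uniformOracle sec) =
      S.acceptProb mode A (T.eval sec) sec (fun _ => majOracle (S.uniformOracle sec)) := by
    simp only [uniformOracle_del]
    rfl
  rw [h1, h2, hacc sec _ fun ek hek => answers_encodeOracle hw hek,
    hacc sec _ fun ek _ => answers_uniformOracle sec]

/-- The channel that the inner code sees when the outer code is sent over `E`. -/
def innerChannel (E : Channel) : Channel := fun x =>
  (majEncode x).bind fun y => (E y).bind (majDec x.length)

/-- Only a regrouping: the majority layers are counted as part of the channel instead of the code.
-/
theorem robust_del {E : Channel} (hw : S.WellTyped mode) (h : S.Robust (innerChannel E)) :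
    (S.del expansion odd_expansion).Robust E := by
  obtain ⟨ν, hν, h⟩ := h
  refine ⟨ν, hν, fun sec msg hmsg => ?_⟩
  refine (h sec msg hmsg).trans_eq ?_
  congr 1
  refine bind_congr_support _ _ _ fun keys hkeys => ?_
  simp only [Scheme.del, PMF.bind_bind]
  refine bind_congr_support _ _ _ fun x hx => ?_
  have hx' := hw.encode sec keys.2 msg (hw.keyGen sec keys hkeys).2 hmsg x hx
  simp only [innerChannel, PMF.bind_bind, majEncode_eq hx', hx']

theorem isPRC_del {E : Channel} (hn : PolyTimeLength S.blockLen)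
    (h : S.IsPRC mode (innerChannel E)) : (S.del expansion odd_expansion).IsPRC mode E where
  wellTyped := wellTyped_del h.wellTyped
  polyTime := polyTime_del hn h.wellTyped h.polyTime
  robust := robust_del h.wellTyped h.robust
  sound := sound_del h.sound
  pseudorandom := pseudorandom_del hn h.wellTyped h.pseudorandom

end del

/-! ## Expectations under product distributions -/

section Ex

variable {κ α : Type} [Fintype κ] [DecidableEq κ] [Fintype α]

/-- The expectation of `f` when the coordinates are independent with the law `w`. -/
def Ex (w : α → ℝ) (f : (κ → α) → ℝ) : ℝ := ∑ ω, (∏ k, w (ω k)) * f ω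

variable {w : α → ℝ}

theorem Ex_one (h1 : ∑ a, w a = 1) : Ex w (fun _ : κ → α => 1) = 1 := by
  have := Finset.prod_univ_sum (fun _ : κ => (Finset.univ : Finset α)) fun _ a => w a
  simp only [h1, Finset.prod_const_one, Fintype.piFinset_univ] at this
  simp [Ex, ← this]

theorem Ex_const_mul (c : ℝ) (f : (κ → α) → ℝ) : Ex w (fun ω => c * f ω) = c * Ex w f := by
  simp only [Ex, Finset.mul_sum]
  exact Finset.sum_congr rfl fun _ _ => by ring

theorem Ex_mul_const (c : ℝ) (f : (κ → α) → ℝ) : Ex w (fun ω => f ω * c) = Ex w f * c := by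
  simp only [mul_comm _ c, Ex_const_mul]

theorem Ex_add (f g : (κ → α) → ℝ) : Ex w (fun ω => f ω + g ω) = Ex w f + Ex w g := by
  simp only [Ex, ← Finset.sum_add_distrib]
  exact Finset.sum_congr rfl fun _ _ => by ring

theorem Ex_sub (f g : (κ → α) → ℝ) : Ex w (fun ω => f ω - g ω) = Ex w f - Ex w g := by
  simp only [Ex, ← Finset.sum_sub_distrib]
  exact Finset.sum_congr rfl fun _ _ => by ring

theorem Ex_neg (f : (κ → α) → ℝ) : Ex w (fun ω => -f ω) = -Ex w f := by
  have := Ex_const_mul (w := w) (-1) f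
  simpa using this

theorem Ex_const (h1 : ∑ a, w a = 1) (c : ℝ) : Ex w (fun _ : κ → α => c) = c := by
  have := Ex_const_mul (w := w) c (fun _ : κ → α => 1)
  simpa [Ex_one h1] using this

theorem Ex_sum {ι : Type} (s : Finset ι) (f : ι → (κ → α) → ℝ) :
    Ex w (fun ω => ∑ i ∈ s, f i ω) = ∑ i ∈ s, Ex w (f i) := by
  simp only [Ex, Finset.mul_sum]
  exact Finset.sum_comm

theorem Ex_mono (h0 : ∀ a, 0 ≤ w a) {f g : (κ → α) → ℝ} (h : ∀ ω, f ω ≤ g ω) :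
    Ex w f ≤ Ex w g :=
  Finset.sum_le_sum fun ω _ => mul_le_mul_of_nonneg_left (h ω) (Finset.prod_nonneg fun _ _ => h0 _)

theorem Ex_nonneg (h0 : ∀ a, 0 ≤ w a) {f : (κ → α) → ℝ} (h : ∀ ω, 0 ≤ f ω) : 0 ≤ Ex w f :=
  Finset.sum_nonneg fun ω _ => mul_nonneg (Finset.prod_nonneg fun _ _ => h0 _) (h ω)

theorem Ex_mul_Ex (f g : (κ → α) → ℝ) :
    Ex w f * Ex w g = Ex w fun ω => Ex w fun ω' => f ω * g ω' := by
  simp only [Ex_const_mul]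
  rw [Ex_mul_const]

/-- Resampling the coordinates outside `S` does not change the expectation. -/
theorem Ex_glue (h1 : ∑ a, w a = 1) (S : Finset κ) (f : (κ → α) → ℝ) :
    Ex w f = Ex w fun ω => Ex w fun ω' => f (S.piecewise ω ω') := by
  -- The involution on pairs of samples that exchanges the coordinates outside `S`; it preserves the
  -- product weight.
  let e : Equiv.Perm ((κ → α) × (κ → α)) :=
    { toFun := fun x => (S.piecewise x.1 x.2, S.piecewise x.2 x.1)
      invFun := fun x => (S.piecewise x.1 x.2, S.piecewise x.2 x.1)
      left_inv := fun x => by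
        ext k <;> by_cases hk : k ∈ S <;> simp [hk]
      right_inv := fun x => by
        ext k <;> by_cases hk : k ∈ S <;> simp [hk] }
  have hw : ∀ x : (κ → α) × (κ → α), (∏ k, w ((e x).1 k)) * ∏ k, w ((e x).2 k) =
      (∏ k, w (x.1 k)) * ∏ k, w (x.2 k) := by
    intro x
    rw [← Finset.prod_mul_distrib, ← Finset.prod_mul_distrib]
    refine Finset.prod_congr rfl fun k _ => ?_
    by_cases hk : k ∈ S <;> simp [e, hk, mul_comm]
  have hl : Ex w f = ∑ x : (κ → α) × (κ → α), ((∏ k, w (x.1 k)) * ∏ k, w (x.2 k)) * f x.1 := by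
    rw [Ex, Fintype.sum_prod_type]
    refine Finset.sum_congr rfl fun ω _ => ?_
    have h := Ex_one (κ := κ) h1
    simp only [Ex, mul_one] at h
    simp only [mul_assoc]
    rw [← Finset.mul_sum, ← Finset.sum_mul, h, one_mul]
  rw [hl, ← Equiv.sum_comp e]
  simp only [hw, Ex, Finset.mul_sum]
  rw [Fintype.sum_prod_type]
  refine Finset.sum_congr rfl fun ω _ => Finset.sum_congr rfl fun ω' _ => ?_
  simp only [e, Equiv.coe_fn_mk]
  ring

theorem dependsOn_piecewise_left {κ α β : Type} [DecidableEq κ] {f : (κ → α) → β} {A S : Finset κ}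
    (hf : DependsOn f (A : Set κ)) (h : A ⊆ S) (ω ω' : κ → α) : f (S.piecewise ω ω') = f ω :=
  hf fun k hk => by simp [h hk]

theorem dependsOn_piecewise_right {κ α β : Type} [DecidableEq κ] {f : (κ → α) → β} {A S : Finset κ}
    (hf : DependsOn f (A : Set κ)) (h : Disjoint A S) (ω ω' : κ → α) :
    f (S.piecewise ω ω') = f ω' :=
  hf fun k hk => by simp [Finset.disjoint_left.1 h hk]

/-- After resampling the coordinates outside `A`, the factor `f` sees only the first sample and `g`
only the second. -/
theorem Ex_mul_of_disjoint (h1 : ∑ a, w a = 1) {f g : (κ → α) → ℝ} {A B : Finset κ}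
    (hf : DependsOn f (A : Set κ)) (hg : DependsOn g (B : Set κ)) (hAB : Disjoint A B) :
    Ex w (fun ω => f ω * g ω) = Ex w f * Ex w g := by
  rw [Ex_glue h1 A, Ex_mul_Ex]
  simp only [dependsOn_piecewise_left hf subset_rfl, dependsOn_piecewise_right hg hAB.symm]

theorem Ex_prod_of_pairwiseDisjoint (h1 : ∑ a, w a = 1) {ι : Type} [DecidableEq ι] (c : Finset ι)
    {f : ι → (κ → α) → ℝ} {A : ι → Finset κ} (hf : ∀ i ∈ c, DependsOn (f i) (A i : Set κ))
    (hA : (c : Set ι).PairwiseDisjoint A) :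
    Ex w (fun ω => ∏ i ∈ c, f i ω) = ∏ i ∈ c, Ex w (f i) := by
  induction c using Finset.induction_on with
  | empty => simp [Ex_one h1]
  | insert i c hi ih =>
    simp only [Finset.prod_insert hi]
    rw [Ex_mul_of_disjoint h1 (A := A i) (B := c.biUnion A) (hf i (by simp)) ?_ ?_, ih]
    · exact fun j hj => hf j (by simp [hj])
    · exact hA.subset (by simp)
    · intro x y hxy
      refine Finset.prod_congr rfl fun j hj => hf j (by simp [hj]) fun k hk => hxy k ?_
      simp only [Finset.coe_biUnion, Set.mem_iUnion]
      exact ⟨j, hj, hk⟩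
    · rw [Finset.disjoint_biUnion_right]
      intro j hj
      exact hA (by simp) (by simp [hj]) (by rintro rfl; exact hi hj)

/-- The probability of the event `s`. -/
def Prb (w : α → ℝ) (s : Set (κ → α)) : ℝ := Ex w (s.indicator 1)

theorem Prb_mono (h0 : ∀ a, 0 ≤ w a) {s t : Set (κ → α)} (h : s ⊆ t) : Prb w s ≤ Prb w t :=
  Ex_mono h0 fun _ => Set.indicator_le_indicator_of_subset h (by simp) _

theorem Prb_union_le (h0 : ∀ a, 0 ≤ w a) (s t : Set (κ → α)) :
    Prb w (s ∪ t) ≤ Prb w s + Prb w t := by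
  rw [Prb, Prb, Prb, ← Ex_add]
  refine Ex_mono h0 fun ω => ?_
  by_cases hs : ω ∈ s <;> by_cases ht : ω ∈ t <;> simp [hs, ht]

theorem Prb_biUnion_le (h0 : ∀ a, 0 ≤ w a) {ι : Type} (c : Finset ι) (s : ι → Set (κ → α)) :
    Prb w (⋃ i ∈ c, s i) ≤ ∑ i ∈ c, Prb w (s i) := by
  simp only [Prb]
  rw [← Ex_sum]
  refine Ex_mono h0 fun ω => ?_
  have hnn : ∀ i ∈ c, 0 ≤ (s i).indicator (1 : (κ → α) → ℝ) ω := fun i _ =>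
    Set.indicator_nonneg (by simp) _
  by_cases h : ω ∈ ⋃ i ∈ c, s i
  · rw [Set.indicator_of_mem h]
    simp only [Set.mem_iUnion] at h
    obtain ⟨i, hi, hω⟩ := h
    have := Finset.single_le_sum hnn hi
    rwa [Set.indicator_of_mem hω] at this
  · rw [Set.indicator_of_notMem h]
    exact Finset.sum_nonneg hnn

/-- A Chernoff bound for independent bounded variables with nonnegative means. -/
theorem Prb_sum_le (h0 : ∀ a, 0 ≤ w a) (h1 : ∑ a, w a = 1) {ι : Type} [DecidableEq ι]
    (c : Finset ι) {X : ι → (κ → α) → ℝ} {A : ι → Finset κ}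
    (hX : ∀ i ∈ c, DependsOn (X i) (A i : Set κ)) (hA : (c : Set ι).PairwiseDisjoint A)
    (hb : ∀ i ∈ c, ∀ ω, |X i ω| ≤ 1) (hm : ∀ i ∈ c, 0 ≤ Ex w (X i))
    {l : ℝ} (hl0 : 0 ≤ l) (hl1 : l ≤ 1) (t : ℝ) :
    Prb w {ω | ∑ i ∈ c, X i ω ≤ -t} ≤ Real.exp (l ^ 2 * c.card - l * t) := by
  have hstep : ∀ i ∈ c, Ex w (fun ω => Real.exp (-(l * X i ω))) ≤ Real.exp (l ^ 2) := by
    intro i hi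
    -- The bound exp(-x) ≤ 1 - x + x² for |x| ≤ 1. The sign of the mean then allows the linear term
    -- to be dropped.
    have hp : ∀ ω, Real.exp (-(l * X i ω)) ≤ 1 + l ^ 2 - l * X i ω := by
      intro ω
      have hX1 := hb i hi ω
      have habs : |-(l * X i ω)| ≤ 1 := by
        rw [abs_neg, abs_mul, abs_of_nonneg hl0]
        exact mul_le_one₀ hl1 (abs_nonneg _) hX1
      have h2 := (abs_le.1 (Real.abs_exp_sub_one_sub_id_le habs)).2
      have h3 : (X i ω) ^ 2 ≤ 1 := by
        rw [← sq_abs]; exact pow_le_one₀ (abs_nonneg _) hX1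
      have h4 : (-(l * X i ω)) ^ 2 ≤ l ^ 2 := by
        rw [neg_sq, mul_pow]; exact mul_le_of_le_one_right (sq_nonneg l) h3
      linarith
    calc Ex w (fun ω => Real.exp (-(l * X i ω)))
        ≤ Ex w (fun ω => (1 + l ^ 2) - l * X i ω) := Ex_mono h0 hp
      _ = (1 + l ^ 2) - l * Ex w (X i) := by rw [Ex_sub, Ex_const h1, Ex_const_mul]
      _ ≤ 1 + l ^ 2 := by have := mul_nonneg hl0 (hm i hi); linarith
      _ ≤ Real.exp (l ^ 2) := by have := Real.add_one_le_exp (l ^ 2); linarith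
  have hind : ∀ ω, ({ω | ∑ i ∈ c, X i ω ≤ -t} : Set (κ → α)).indicator 1 ω ≤
      Real.exp (-(l * t)) * ∏ i ∈ c, Real.exp (-(l * X i ω)) := by
    intro ω
    rw [← Real.exp_sum, ← Real.exp_add]
    by_cases h : ω ∈ ({ω | ∑ i ∈ c, X i ω ≤ -t} : Set (κ → α))
    · rw [Set.indicator_of_mem h]
      refine Real.one_le_exp ?_
      rw [Finset.sum_neg_distrib, ← Finset.mul_sum]
      have := mul_le_mul_of_nonneg_left h hl0
      linarith
    · rw [Set.indicator_of_notMem h]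
      exact (Real.exp_pos _).le
  calc Prb w {ω | ∑ i ∈ c, X i ω ≤ -t}
      ≤ Ex w fun ω => Real.exp (-(l * t)) * ∏ i ∈ c, Real.exp (-(l * X i ω)) := Ex_mono h0 hind
    _ = Real.exp (-(l * t)) * ∏ i ∈ c, Ex w fun ω => Real.exp (-(l * X i ω)) := by
        rw [Ex_const_mul, Ex_prod_of_pairwiseDisjoint h1 c (A := A) ?_ hA]
        exact fun i hi x y hxy => by simp only [hX i hi hxy]
    _ ≤ Real.exp (-(l * t)) * ∏ i ∈ c, Real.exp (l ^ 2) := by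
        gcongr with i hi
        · intro i hi; exact Ex_nonneg h0 fun _ => (Real.exp_pos _).le
        · exact hstep i hi
    _ = Real.exp (l ^ 2 * c.card - l * t) := by
        rw [Finset.prod_const, ← Real.exp_nat_mul, ← Real.exp_add]
        congr 1; ring

/-- Permuting the coordinates. -/
theorem Ex_comp_perm (σ : Equiv.Perm κ) (f : (κ → α) → ℝ) :
    Ex w (fun ω => f (ω ∘ σ)) = Ex w f := by
  rw [Ex, Ex, ← Equiv.sum_comp (Equiv.arrowCongr σ (Equiv.refl α))]
  refine Finset.sum_congr rfl fun ω _ => ?_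
  have h1 : ∏ k, w (((Equiv.arrowCongr σ (Equiv.refl α)) ω) k) = ∏ k, w (ω k) := by
    rw [← Equiv.prod_comp σ.symm fun k => w (ω k)]
    rfl
  have h2 : ((Equiv.arrowCongr σ (Equiv.refl α)) ω) ∘ σ = ω := by
    funext k; simp
  rw [h1, h2]

/-- Chebyshev's association inequality. -/
theorem Ex_mul_le (h0 : ∀ a, 0 ≤ w a) (h1 : ∑ a, w a = 1) {f g : (κ → α) → ℝ}
    (h : ∀ ω ω', 0 ≤ (f ω - f ω') * (g ω - g ω')) :
    Ex w f * Ex w g ≤ Ex w fun ω => f ω * g ω := by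
  have hnn : 0 ≤ Ex w fun ω => Ex w fun ω' => (f ω - f ω') * (g ω - g ω') :=
    Ex_nonneg h0 fun ω => Ex_nonneg h0 fun ω' => h ω ω'
  have e : (Ex w fun ω => Ex w fun ω' => (f ω - f ω') * (g ω - g ω')) =
      2 * Ex w (fun ω => f ω * g ω) - 2 * (Ex w f * Ex w g) := by
    have e1 : ∀ ω, Ex w (fun ω' => (f ω - f ω') * (g ω - g ω')) =
        f ω * g ω - f ω * Ex w g - Ex w f * g ω + Ex w fun ω' => f ω' * g ω' := by
      intro ω
      have : ∀ ω', (f ω - f ω') * (g ω - g ω') =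
          ((f ω * g ω - f ω * g ω') - f ω' * g ω) + f ω' * g ω' := fun ω' => by ring
      simp only [this]
      rw [Ex_add, Ex_sub, Ex_sub, Ex_const h1, Ex_const_mul, Ex_mul_const]
    simp only [e1]
    rw [Ex_add, Ex_sub, Ex_sub, Ex_const h1, Ex_const_mul, Ex_mul_const]
    ring
  linarith

end Ex

/-! ## Sums of random signs -/

section signs

variable {κ : Type} [Fintype κ] [DecidableEq κ]

/-- The uniform distribution on bits. -/
def half : Bool → ℝ := fun _ => 1 / 2

theorem half_nonneg (a : Bool) : 0 ≤ half a := by norm_num [half]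

theorem sum_half : ∑ a, half a = 1 := by norm_num [half]

/-- The sign that represents a bit. -/
def sgn (b : Bool) : ℝ := if b then 1 else -1

/-- The sum of the signs with indices in `A`. -/
def signSum {κ : Type} (A : Finset κ) (ω : κ → Bool) : ℝ := ∑ k ∈ A, sgn (ω k)

theorem sgn_not (b : Bool) : sgn (!b) = -sgn b := by cases b <;> simp [sgn]

theorem sgn_mul_self (b : Bool) : sgn b * sgn b = 1 := by cases b <;> simp [sgn]

theorem signSum_flipAll {κ : Type} (A : Finset κ) (ω : κ → Bool) :
    signSum A (flipAll ω) = -signSum A ω := by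
  simp only [signSum, flipAll, Equiv.coe_fn_mk, sgn_not, Finset.sum_neg_distrib]

theorem dependsOn_signSum {κ : Type} (A : Finset κ) : DependsOn (signSum A) (A : Set κ) :=
  fun _ _ h => Finset.sum_congr rfl fun k hk => by rw [h k hk]

theorem signSum_union {κ : Type} [DecidableEq κ] {A B : Finset κ} (h : Disjoint A B) (ω : κ → Bool) :
    signSum (A ∪ B) ω = signSum A ω + signSum B ω :=
  Finset.sum_union h

theorem Ex_flipAll (f : (κ → Bool) → ℝ) : Ex half (fun ω => f (flipAll ω)) = Ex half f := by
  simp only [Ex, half]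
  exact Equiv.sum_comp flipAll fun ω : κ → Bool => (∏ _k : κ, (1 / 2 : ℝ)) * f ω

theorem Ex_sgn_mul {k : κ} {f : (κ → Bool) → ℝ} {A : Finset κ} (hk : k ∉ A)
    (hf : DependsOn f (A : Set κ)) : Ex half (fun ω => sgn (ω k) * f ω) = 0 := by
  rw [Ex_mul_of_disjoint sum_half (A := {k}) (B := A) (f := fun ω => sgn (ω k)) ?_ hf (by simpa)]
  · have h := Ex_flipAll (κ := κ) fun ω => sgn (ω k)
    simp only [flipAll, Equiv.coe_fn_mk, sgn_not, Ex_neg] at h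
    rw [show Ex half (fun ω : κ → Bool => sgn (ω k)) = 0 by linarith, zero_mul]
  · intro x y h
    simp only [h k (by simp)]

theorem Ex_signSum_sq (A : Finset κ) : Ex half (fun ω => signSum A ω ^ 2) = A.card := by
  induction A using Finset.induction_on with
  | empty => simp [signSum, Ex]
  | insert k A hk ih =>
    have : ∀ ω, signSum (insert k A) ω ^ 2 =
        1 + 2 * (sgn (ω k) * signSum A ω) + signSum A ω ^ 2 := by
      intro ω
      have := sgn_mul_self (ω k)
      rw [signSum, Finset.sum_insert hk, ← signSum]
      linear_combination this
    simp only [this]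
    rw [Ex_add, Ex_add, Ex_const sum_half, Ex_const_mul, Ex_sgn_mul hk (dependsOn_signSum A), ih,
      Finset.card_insert_of_notMem hk]
    push_cast; ring

theorem Ex_signSum_pow_four (A : Finset κ) :
    Ex half (fun ω => signSum A ω ^ 4) = 3 * (A.card : ℝ) ^ 2 - 2 * A.card := by
  induction A using Finset.induction_on with
  | empty => simp [signSum, Ex]
  | insert k A hk ih =>
    have : ∀ ω, signSum (insert k A) ω ^ 4 = 1 + 4 * (sgn (ω k) * signSum A ω) +
        4 * (sgn (ω k) * signSum A ω ^ 3) + 6 * signSum A ω ^ 2 + signSum A ω ^ 4 := by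
      intro ω
      have := sgn_mul_self (ω k)
      rw [signSum, Finset.sum_insert hk, ← signSum]
      generalize sgn (ω k) = e at *
      generalize signSum A ω = x
      linear_combination (e * e + 1 + 4 * e * x + 6 * x ^ 2) * this
    simp only [this]
    rw [Ex_add, Ex_add, Ex_add, Ex_add, Ex_const sum_half, Ex_const_mul, Ex_const_mul, Ex_const_mul,
      Ex_sgn_mul hk (dependsOn_signSum A),
      Ex_sgn_mul hk (f := fun ω => signSum A ω ^ 3)
        (fun x y h => by simp only [dependsOn_signSum A h]), Ex_signSum_sq, ih,
      Finset.card_insert_of_notMem hk]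
    push_cast; ring

/-- Fourth moment method. With r² = |A| and y = |S| / r, take the expectation of y ≥ y² - y⁴/6: the
second and fourth moments give r - (3r⁴ - 2r²) / (6r³) ≥ r/2. -/
theorem le_Ex_abs_signSum (A : Finset κ) :
    √(A.card : ℝ) / 2 ≤ Ex half (fun ω => |signSum A ω|) := by
  rcases A.eq_empty_or_nonempty with rfl | hA
  · simp [signSum, Ex]
  have hn : (0 : ℝ) < A.card := by exact_mod_cast hA.card_pos
  set r := √(A.card : ℝ) with hr
  have hr0 : 0 < r := Real.sqrt_pos.2 hn
  have hr2 : r ^ 2 = A.card := Real.sq_sqrt hn.le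
  have hp : ∀ x : ℝ, (1 / r) * x ^ 2 - (1 / (6 * r ^ 3)) * x ^ 4 ≤ |x| := by
    intro x
    rw [← sq_abs x, show x ^ 4 = |x| ^ 4 by rw [← abs_pow, abs_of_nonneg (by positivity)]]
    obtain ⟨y, hy⟩ : ∃ y, |x| = r * y := ⟨|x| / r, by field_simp⟩
    have hy0 : 0 ≤ y := by
      have := abs_nonneg x
      rw [hy] at this
      exact nonneg_of_mul_nonneg_right this hr0
    rw [hy]
    have e : (1 / r) * (r * y) ^ 2 - (1 / (6 * r ^ 3)) * (r * y) ^ 4 = r * (y ^ 2 - y ^ 4 / 6) := by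
      field_simp
    rw [e]
    refine mul_le_mul_of_nonneg_left ?_ hr0.le
    -- For y ≥ 0 the cubic is smallest at y = √2, where its value 1 - 2√2/3 is positive.
    have : 0 ≤ y * (1 - y + y ^ 3 / 6) := by
      refine mul_nonneg hy0 ?_
      nlinarith [mul_nonneg (show (0 : ℝ) ≤ y + 2 * (3 / 2) by linarith) (sq_nonneg (y - 3 / 2))]
    linarith
  have h := Ex_mono half_nonneg fun ω : κ → Bool => hp (signSum A ω)
  rw [Ex_sub, Ex_const_mul, Ex_const_mul, Ex_signSum_sq, Ex_signSum_pow_four, ← hr2] at h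
  refine le_trans ?_ h
  have e : 1 / r * r ^ 2 - 1 / (6 * r ^ 3) * (3 * (r ^ 2) ^ 2 - 2 * r ^ 2) =
      r / 2 + 1 / (3 * r) := by
    field_simp; ring
  rw [e]
  have : 0 < 1 / (3 * r) := by positivity
  linarith

theorem sign_monotone : Monotone Real.sign := by
  intro x y h
  rcases lt_trichotomy x 0 with hx | hx | hx <;> rcases lt_trichotomy y 0 with hy | hy | hy <;>
    first
    | (exfalso; linarith)
    | simp [Real.sign, hx, hy, hx.not_gt, hy.not_gt]

theorem abs_sign_le (x : ℝ) : |Real.sign x| ≤ 1 := by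
  rcases Real.sign_apply_eq x with h | h | h <;> simp [h]

/-- The mean of the sign of `u` plus a random sum. -/
def meanSign (A : Finset κ) (u : ℝ) : ℝ := Ex half fun ω => Real.sign (u + signSum A ω)

theorem meanSign_neg (A : Finset κ) (u : ℝ) : meanSign A (-u) = -meanSign A u := by
  rw [meanSign, meanSign, ← Ex_flipAll, ← Ex_neg]
  simp only [signSum_flipAll, ← neg_add, Real.sign_neg]

theorem meanSign_monotone (A : Finset κ) : Monotone (meanSign A) := fun _ _ h =>
  Ex_mono half_nonneg fun _ => sign_monotone (by linarith)

theorem abs_meanSign_le (A : Finset κ) (u : ℝ) : |meanSign A u| ≤ 1 := by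
  rw [abs_le]
  constructor
  · rw [← Ex_const (κ := κ) sum_half (-1)]
    exact Ex_mono half_nonneg fun ω => (abs_le.1 (abs_sign_le _)).1
  · rw [← Ex_const (κ := κ) sum_half 1]
    exact Ex_mono half_nonneg fun ω => (abs_le.1 (abs_sign_le _)).2

theorem meanSign_zero (A : Finset κ) : meanSign A 0 = 0 := by
  have := meanSign_neg A 0
  rw [neg_zero] at this
  linarith

theorem abs_meanSign (A : Finset κ) (u : ℝ) : |meanSign A u| = meanSign A |u| := by
  rcases le_total 0 u with h | h
  · rw [abs_of_nonneg h, abs_of_nonneg]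
    rw [← meanSign_zero A]
    exact meanSign_monotone A h
  · rw [abs_of_nonpos h, abs_of_nonpos, meanSign_neg]
    rw [← meanSign_zero A]
    exact meanSign_monotone A h

/-- Both means are odd and increasing in `u`, so they never have opposite signs. -/
theorem meanSign_mul_meanSign (A B : Finset κ) (u : ℝ) :
    meanSign A u * meanSign B u = |meanSign A u| * |meanSign B u| := by
  rw [abs_meanSign, abs_meanSign]
  rcases le_total 0 u with h | h
  · rw [abs_of_nonneg h]
  · rw [abs_of_nonpos h, meanSign_neg, meanSign_neg, neg_mul_neg]

/-- Average over the signs in `A`. -/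
theorem Ex_sign_add_mul {A C D : Finset κ} (hC : Disjoint C A) {G : (κ → Bool) → ℝ}
    (hG : DependsOn G (D : Set κ)) (hD : Disjoint D A) :
    Ex half (fun ω => Real.sign (signSum C ω + signSum A ω) * G ω) =
      Ex half fun ω => meanSign A (signSum C ω) * G ω := by
  -- With the coordinates outside `A` resampled, the sum over `A` is independent of everything else,
  -- and averaging over it yields `meanSign`.
  rw [Ex_glue sum_half A]
  simp only [dependsOn_piecewise_left (dependsOn_signSum A) subset_rfl,
    dependsOn_piecewise_right (dependsOn_signSum C) hC, dependsOn_piecewise_right hG hD]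
  have : ∀ f : (κ → Bool) → (κ → Bool) → ℝ,
      (Ex half fun ω => Ex half fun ω' => f ω ω') = Ex half fun ω' => Ex half fun ω => f ω ω' := by
    intro f
    simp only [Ex, Finset.mul_sum]
    rw [Finset.sum_comm]
    exact Finset.sum_congr rfl fun _ _ => Finset.sum_congr rfl fun _ _ => by ring
  rw [this]
  simp only [Ex_mul_const]
  rfl

/-- By symmetry every single sign in `B` has the same correlation with the sign of the total. So the
correlation of a partial sum is proportional to its number of terms, and the case C = B fixes the
factor. -/
theorem Ex_signSum_mul_sign {B C : Finset κ} (hCB : C ⊆ B) :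
    (B.card : ℝ) * Ex half (fun ω => signSum C ω * Real.sign (signSum B ω)) =
      C.card * Ex half (fun ω => |signSum B ω|) := by
  rcases B.eq_empty_or_nonempty with rfl | ⟨k₀, hk₀⟩
  · simp [Finset.subset_empty.1 hCB]
  have hsym : ∀ k ∈ B, Ex half (fun ω => sgn (ω k) * Real.sign (signSum B ω)) =
      Ex half (fun ω => sgn (ω k₀) * Real.sign (signSum B ω)) := by
    intro k hk
    rw [← Ex_comp_perm (Equiv.swap k k₀) fun ω : κ → Bool =>
      sgn (ω k₀) * Real.sign (signSum B ω)]
    congr 1; funext ω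
    have : signSum B (ω ∘ Equiv.swap k k₀) = signSum B ω := by
      simp only [signSum, Function.comp]
      refine Finset.sum_equiv (Equiv.swap k k₀) (fun i => ?_) fun i _ => rfl
      rcases eq_or_ne i k with rfl | h1
      · simp [hk, hk₀]
      rcases eq_or_ne i k₀ with rfl | h2
      · simp [hk, hk₀]
      rw [Equiv.swap_apply_of_ne_of_ne h1 h2]
    rw [this]
    simp
  have hgen : ∀ D ⊆ B, Ex half (fun ω => signSum D ω * Real.sign (signSum B ω)) =
      D.card * Ex half (fun ω => sgn (ω k₀) * Real.sign (signSum B ω)) := by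
    intro D hD
    have hsum : ∀ ω : κ → Bool, signSum D ω * Real.sign (signSum B ω) =
        ∑ k ∈ D, sgn (ω k) * Real.sign (signSum B ω) := fun ω => Finset.sum_mul ..
    simp only [hsum]
    rw [Ex_sum, Finset.sum_congr rfl fun k hk => hsym k (hD hk), Finset.sum_const, nsmul_eq_mul]
  have habs : (fun ω : κ → Bool => |signSum B ω|) =
      fun ω => signSum B ω * Real.sign (signSum B ω) := by
    funext ω
    rcases lt_trichotomy (signSum B ω) 0 with h | h | h
    · rw [abs_of_neg h, Real.sign_of_neg h]; ring
    · simp [h]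
    · rw [abs_of_pos h, Real.sign_of_pos h]; ring
  rw [habs, hgen B subset_rfl, hgen C hCB]
  ring

/-- Write S for the sum over C, f for the conditional mean of the sign of the sum over B, and r² =
|B|. By `Ex_signSum_mul_sign`, E[S f] = (|C| / |B|) E|S_B| ≥ |C| / (2r). Expanding (f - S / (2r))² ≥
0 gives E f² ≥ E[S f] / r - |C| / (4r²) ≥ |C| / (4 |B|), and E|f| ≥ E f² because |f| ≤ 1. -/
theorem le_Ex_abs_meanSign {B C : Finset κ} (hCB : C ⊆ B) :
    (C.card : ℝ) / (4 * B.card) ≤ Ex half fun ω => |meanSign (B \ C) (signSum C ω)| := by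
  rcases B.eq_empty_or_nonempty with rfl | hB
  · simpa using Ex_nonneg half_nonneg fun ω => abs_nonneg _
  have hn : (0 : ℝ) < B.card := by exact_mod_cast hB.card_pos
  set r := √(B.card : ℝ) with hr
  have hr0 : 0 < r := Real.sqrt_pos.2 hn
  have hr2 : r ^ 2 = B.card := Real.sq_sqrt hn.le
  set e := Ex half fun ω => signSum C ω * meanSign (B \ C) (signSum C ω) with he
  have he1 : e = Ex half (fun ω => signSum C ω * Real.sign (signSum B ω)) := by
    have h := Ex_sign_add_mul (A := B \ C) (C := C) (D := C) Finset.disjoint_sdiff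
      (dependsOn_signSum C) Finset.disjoint_sdiff
    simp only [← signSum_union (Finset.disjoint_sdiff (s := C) (t := B)),
      Finset.union_sdiff_of_subset hCB, mul_comm _ (signSum C _)] at h
    exact h.symm
  have he2 : (C.card : ℝ) / (2 * r) ≤ e := by
    have h := Ex_signSum_mul_sign hCB
    rw [← he1, ← hr2] at h
    have h2 := le_Ex_abs_signSum B
    rw [← hr] at h2
    have h3 := mul_le_mul_of_nonneg_left h2 (Nat.cast_nonneg (α := ℝ) C.card)
    rw [← h] at h3
    rw [div_le_iff₀ (by positivity)]
    have : C.card * (r / 2) = r * (C.card / 2) := by ring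
    rw [this, show r ^ 2 * e = r * (r * e) by ring] at h3
    have := le_of_mul_le_mul_left h3 hr0
    linarith
  have hsq : 0 ≤ Ex half fun ω : κ → Bool =>
      (meanSign (B \ C) (signSum C ω) - 1 / (2 * r) * signSum C ω) ^ 2 :=
    Ex_nonneg half_nonneg fun ω => sq_nonneg _
  have hexp : ∀ ω : κ → Bool, (meanSign (B \ C) (signSum C ω) - 1 / (2 * r) * signSum C ω) ^ 2 =
      meanSign (B \ C) (signSum C ω) ^ 2 -
        1 / r * (signSum C ω * meanSign (B \ C) (signSum C ω)) +
        1 / (4 * r ^ 2) * signSum C ω ^ 2 := by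
    intro ω; field_simp; ring
  simp only [hexp] at hsq
  rw [Ex_add, Ex_sub, Ex_const_mul, Ex_const_mul, Ex_signSum_sq, ← he] at hsq
  have hle : (Ex half fun ω : κ → Bool => meanSign (B \ C) (signSum C ω) ^ 2) ≤
      Ex half fun ω => |meanSign (B \ C) (signSum C ω)| := by
    refine Ex_mono half_nonneg fun ω => ?_
    have h := abs_meanSign_le (B \ C) (signSum C ω)
    rw [← sq_abs, sq]
    exact mul_le_of_le_one_left (abs_nonneg _) h
  have h5 := mul_le_mul_of_nonneg_left he2 (show 0 ≤ 1 / r by positivity)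
  have e1 : 1 / r * (C.card / (2 * r)) = 2 * ((C.card : ℝ) / (4 * B.card)) := by
    rw [← hr2]; field_simp; norm_num
  have e2 : 1 / (4 * r ^ 2) * (C.card : ℝ) = C.card / (4 * B.card) := by
    rw [← hr2]; ring
  linarith

/-- The signs of two overlapping random sums are positively correlated. -/
theorem le_Ex_sign_mul_sign (B J : Finset κ) :
    ((B ∩ J).card : ℝ) ^ 2 / (16 * B.card * J.card) ≤
      Ex half fun ω => Real.sign (signSum B ω) * Real.sign (signSum J ω) := by
  set C := B ∩ J with hC
  have hCB : C ⊆ B := Finset.inter_subset_left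
  have hCJ : C ⊆ J := Finset.inter_subset_right
  have hBJ : Disjoint (J \ C) (B \ C) := by
    rw [Finset.disjoint_left]
    intro k hk hk'
    simp only [Finset.mem_sdiff, hC, Finset.mem_inter] at hk hk'
    exact hk.2 ⟨hk'.1, hk.1⟩
  -- Given the signs in `C`, the two signs are independent, since `B \ C` and `J \ C` are disjoint;
  -- each is averaged separately.
  have e1 : (Ex half fun ω => Real.sign (signSum B ω) * Real.sign (signSum J ω)) =
      Ex half fun ω => meanSign (B \ C) (signSum C ω) * meanSign (J \ C) (signSum C ω) := by
    have h1 := Ex_sign_add_mul (A := B \ C) (C := C) (D := J)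
      (G := fun ω => Real.sign (signSum J ω)) Finset.disjoint_sdiff
      (fun x y h => by simp only [dependsOn_signSum J h])
      (by
        rw [← Finset.sdiff_union_of_subset hCJ, Finset.disjoint_union_left]
        exact ⟨hBJ, Finset.disjoint_sdiff⟩)
    have h2 := Ex_sign_add_mul (A := J \ C) (C := C) (D := C)
      (G := fun ω => meanSign (B \ C) (signSum C ω)) Finset.disjoint_sdiff
      (fun x y h => by simp only [dependsOn_signSum C h]) Finset.disjoint_sdiff
    simp only [← signSum_union (Finset.disjoint_sdiff (s := C) (t := B)),
      Finset.union_sdiff_of_subset hCB] at h1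
    simp only [← signSum_union (Finset.disjoint_sdiff (s := C) (t := J)),
      Finset.union_sdiff_of_subset hCJ] at h2
    rw [h1]
    simp only [mul_comm (meanSign (B \ C) _)]
    exact h2
  simp only [meanSign_mul_meanSign] at e1
  rw [e1]
  -- Both absolute means increase with the absolute value of the sum over `C`, hence are similarly
  -- ordered.
  have hassoc := Ex_mul_le (κ := κ) half_nonneg sum_half
    (f := fun ω => |meanSign (B \ C) (signSum C ω)|)
    (g := fun ω => |meanSign (J \ C) (signSum C ω)|) (by
      intro ω ω'
      simp only [abs_meanSign]
      rcases le_total |signSum C ω| |signSum C ω'| with h | h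
      · exact mul_nonneg_of_nonpos_of_nonpos (sub_nonpos.2 (meanSign_monotone _ h))
          (sub_nonpos.2 (meanSign_monotone _ h))
      · exact mul_nonneg (sub_nonneg.2 (meanSign_monotone _ h))
          (sub_nonneg.2 (meanSign_monotone _ h)))
  refine le_trans ?_ hassoc
  refine le_trans (le_of_eq ?_) (mul_le_mul (le_Ex_abs_meanSign hCB) (le_Ex_abs_meanSign hCJ)
    (by positivity) (Ex_nonneg half_nonneg fun ω => abs_nonneg _))
  rw [div_mul_div_comm]
  ring

end signs

/-! ## The law of the inner channel on uniform inputs -/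

/-- `n` independent samples. -/
def iid {α : Type} (μ : PMF α) (n : ℕ) : PMF (List α) :=
  mapIndep (fun _ => μ) (List.replicate n ())

theorem iid_succ {α : Type} (μ : PMF α) (n : ℕ) :
    iid μ (n + 1) = μ.bind fun a => (iid μ n).map fun l => a :: l := rfl

theorem uniformString_eq_iid (n : ℕ) : uniformString n = iid fairBit n := by
  have := uniformString_eq_mapIndep (List.replicate n ())
  rwa [List.length_replicate] at this

/-- Separate the sources of randomness in a list of independent entries. -/
theorem mapIndep_bind_map {α β γ δ : Type} (μ : PMF β) (ν : PMF γ) (g : α → β → γ → δ)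
    (l : List α) :
    mapIndep (fun a => μ.bind fun s => ν.map (g a s)) l =
      (iid μ l.length).bind fun σ => (iid ν l.length).map fun u => List.zipWith3 g l σ u := by
  induction l with
  | nil => simp [mapIndep, iid, PMF.pure_map, List.zipWith3]
  | cons a l ih =>
    simp only [mapIndep_cons, ih, List.length_cons, iid_succ, PMF.bind_bind, bind_map_fun,
      map_bind_fun, PMF.map_comp]
    congr 1; funext s
    rw [PMF.bind_comm]
    rfl

theorem mapIndep_map_param {α γ δ : Type} (ν : PMF γ) (g : α → γ → δ) (l : List α) :
    mapIndep (fun a => ν.map (g a)) l =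
      (iid ν l.length).map fun u => List.zipWith g l u := by
  induction l with
  | nil => simp [mapIndep, iid, PMF.pure_map]
  | cons a l ih =>
    simp only [mapIndep_cons, ih, List.length_cons, iid_succ, bind_map_fun, map_bind_fun,
      PMF.map_comp]
    rfl

/-- Whether a bit is deleted, and whether it is replaced by a fresh random bit. -/
def eventLaw (p r : unitInterval) : PMF (Bool × Bool) :=
  (ber p).bind fun d => (ber r).map fun e => (d, e)

/-- The output for the bit `b`, where `s` tells whether it is deleted or replaced by `u`. -/
def emit (b : Bool) (s : Bool × Bool) (u : Bool) : List Bool :=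
  if s.1 then [] else [if s.2 then u else b]

theorem ber_apply (p : unitInterval) (b : Bool) :
    ber p b = if b then ENNReal.ofReal (p : ℝ) else ENNReal.ofReal (1 - (p : ℝ)) := rfl

theorem fairBit_apply (b : Bool) : fairBit b = 2⁻¹ := by simp [fairBit]

/-- Noise as replacement by fresh random bits. -/
theorem ber_map_xor {q r : unitInterval} (hr : (r : ℝ) = 2 * q) (b : Bool) :
    ((ber q).map fun e => xor b e) =
      (ber r).bind fun e => fairBit.map fun u => if e then u else b := by
  have hr1 := r.2.2
  have hq0 := q.2.1
  have h1 : ENNReal.ofReal (r : ℝ) * 2⁻¹ = ENNReal.ofReal (q : ℝ) := by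
    rw [hr, mul_comm (2 : ℝ), ENNReal.ofReal_mul hq0, mul_assoc, ENNReal.ofReal_ofNat,
      ENNReal.mul_inv_cancel (by simp) (by simp), mul_one]
  have h2 : ENNReal.ofReal (1 - (r : ℝ)) + ENNReal.ofReal (q : ℝ) = ENNReal.ofReal (1 - (q : ℝ)) := by
    rw [← ENNReal.ofReal_add (by linarith) hq0]
    congr 1; rw [hr]; ring
  ext c
  simp only [PMF.bind_apply, PMF.map_apply, tsum_bool, ber_apply, fairBit_apply]
  cases b <;> cases c <;>
    simp [h1, h2, ENNReal.inv_two_add_inv_two]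

/-- Noise on a deleted bit has no effect, so every position may receive its deletion flag, its
replacement flag and its fresh bit independently and in advance. Replacement by fresh bits, rather
than flipping, makes the received bits independent fair bits once σ is fixed. -/
theorem channel_eq {p q r : unitInterval} (hr : (r : ℝ) = 2 * q) (y : List Bool) :
    ((BSC q).comp (BDC p)) y =
      (iid (eventLaw p r) y.length).bind fun σ => (uniformString y.length).map fun u =>
        (List.zipWith3 emit y σ u).flatten := by
  have hcomb : ∀ b : Bool, (((ber p).map fun d => if d then [] else [b]).bind (BSC q)) =
      (eventLaw p r).bind fun s => fairBit.map (emit b s) := by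
    intro b
    rw [eventLaw, PMF.bind_bind, bind_map_fun]
    congr 1; funext d
    rw [bind_map_fun]
    cases d
    · have h := congrArg (PMF.map fun c => [c]) (ber_map_xor hr b)
      rw [map_bind_fun] at h
      simp only [PMF.map_comp] at h
      simp only [BSC, mapIndep, PMF.pure_map, Bool.false_eq_true, if_false]
      rw [← map_eq_bind, PMF.map_comp]
      exact h
    · have : ∀ e, fairBit.map (emit b (true, e)) = PMF.pure [] := fun e => PMF.map_const _ _
      simp only [if_true, BSC, mapIndep, this, PMF.bind_const]
  have h := mapIndep_bind_map (eventLaw p r) fairBit emit y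
  simp only [← hcomb] at h
  have h2 := congrArg (PMF.map List.flatten) h
  rw [map_bind_fun] at h2
  simp only [PMF.map_comp] at h2
  rw [uniformString_eq_iid]
  refine Eq.trans ?_ h2
  rw [Channel.comp, BDC, bind_map_fun, ← mapIndep_bind, map_bind_fun]
  simp only [BSC, mapIndep_flatten]

/-- The majority of `l`, where `t` resolves ties. -/
def majTie (l : List Bool) (t : Bool) : Bool :=
  if l.count false < l.count true then true else if l.count true < l.count false then false else t

theorem maj_eq_map (l : List Bool) : maj l = fairBit.map (majTie l) := by
  have hc : ∀ c : Bool, fairBit.map (fun _ => c) = PMF.pure c := fun c => PMF.map_const _ _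
  rw [maj]
  split_ifs with h1 h2
  · rw [← hc]; congr 1; funext t; simp [majTie, h1]
  · rw [← hc]; congr 1; funext t; simp [majTie, h1, h2]
  · have : majTie l = id := by funext t; simp [majTie, h1, h2]
    rw [this, PMF.map_id]

theorem majDec_eq (N : ℕ) (z : List Bool) :
    majDec N z = (uniformString N).map fun t => List.zipWith majTie (blocks N z) t := by
  rw [majDec, funext maj_eq_map, mapIndep_map_param, length_blocks, uniformString_eq_iid]

/-- The `N` consecutive pieces of length `m` of a list. -/
def chunks {α : Type} (N m : ℕ) (y : List α) : List (List α) :=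
  (List.range N).map fun i => (y.drop (i * m)).take m

theorem chunks_flatten {α : Type} (m : ℕ) (L : List (List α)) (h : ∀ l ∈ L, l.length = m) :
    chunks L.length m L.flatten = L := by
  induction L with
  | nil => rfl
  | cons l L ih =>
    have hl := h l (by simp)
    have ih' := ih fun l' hl' => h l' (by simp [hl'])
    rw [chunks, List.length_cons, List.range_succ_eq_map, List.map_cons, List.map_map]
    congr 1
    · simp [← hl]
    · conv_rhs => rw [← ih']
      refine List.map_congr_left fun i _ => ?_
      simp only [Function.comp, List.flatten_cons]
      congr 1
      rw [show i.succ * m = l.length + i * m by rw [hl, Nat.succ_mul]; ring, ← List.drop_drop,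
        List.drop_left]

/-- For a uniform input the transmitted string can be sampled first, and the input read off from it.
-/
theorem uniformString_bind_majEncode (N : ℕ) :
    ((uniformString N).bind fun x => (majEncode x).map fun y => (x, y)) =
      (uniformString (N * expansion N)).map fun y =>
        ((chunks N (expansion N) y).map majBit, y) := by
  have h := uniformString_bind_majEncBit (odd_expansion N) (List.replicate N ())
  have h2 := congrArg (PMF.map fun z : List Bool × List (List Bool) => (z.1, z.2.flatten)) h
  rw [map_bind_fun, List.length_replicate, PMF.map_comp] at h2
  simp only [PMF.map_comp] at h2
  have h3 := mapIndep_uniformString (expansion N) (List.replicate N ())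
  rw [List.length_replicate] at h3
  rw [← h3, PMF.map_comp]
  refine Eq.trans (bind_congr_support _ _ _ fun x hx => ?_) (h2.trans
    (map_congr_support _ _ _ fun L hL => ?_))
  · rw [majEncode_eq (length_of_mem_support_uniformString hx), majEnc, PMF.map_comp]
    rfl
  · have hlen := length_of_mem_support_mapIndep _ _ _ hL
    have hall := forall_of_mem_support_mapIndep _ (fun l => l.length = expansion N)
      (fun _ _ h => length_of_mem_support_uniformString h) _ _ hL
    rw [List.length_replicate] at hlen
    have := chunks_flatten (expansion N) L hall
    rw [hlen] at this
    simp only [Function.comp, this]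

/-- The number of errors of the inner channel, as a function of the sources of randomness: the
codeword `y`, the events `σ`, the fresh bits `u`, and the bits `t` that resolve ties. -/
def listErrors (N : ℕ) (y : List Bool) (σ : List (Bool × Bool)) (u t : List Bool) : ℕ :=
  diffWeight (List.zipWith majTie (blocks N (List.zipWith3 emit y σ u).flatten) t)
    ((chunks N (expansion N) y).map majBit)

/-- The events σ are drawn first, so that one can condition on them; all remaining randomness
consists of fair bits. -/
theorem innerChannel_law {p q r : unitInterval} (hr : (r : ℝ) = 2 * q) (N : ℕ) :
    ((uniformString N).bind fun x =>
        (innerChannel ((BSC q).comp (BDC p)) x).map fun y => diffWeight y x) =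
      (iid (eventLaw p r) (N * expansion N)).bind fun σ =>
        (uniformString (N * expansion N)).bind fun y =>
          (uniformString (N * expansion N)).bind fun u =>
            (uniformString N).map fun t => listErrors N y σ u t := by
  have h1 := congrArg (fun μ => μ.bind fun z : List Bool × List Bool =>
    (((BSC q).comp (BDC p)) z.2).bind fun w => (majDec N w).map fun y => diffWeight y z.1)
    (uniformString_bind_majEncode N)
  simp only [PMF.bind_bind, bind_map_fun] at h1
  rw [PMF.bind_comm (iid (eventLaw p r) (N * expansion N))]
  refine Eq.trans ?_ (h1.trans (bind_congr_support _ _ _ fun y hy => ?_))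
  · refine bind_congr_support _ _ _ fun x hx => ?_
    rw [innerChannel, length_of_mem_support_uniformString hx, map_bind_fun]
    simp only [map_bind_fun]
  · rw [channel_eq hr, length_of_mem_support_uniformString hy, PMF.bind_bind]
    simp only [bind_map_fun, majDec_eq, PMF.map_comp]
    rfl

/-- The product distribution. -/
def piLaw {α : Type} [Fintype α] (μ : PMF α) (n : ℕ) : PMF (Fin n → α) :=
  PMF.ofFintype (fun ω => ∏ k, μ (ω k)) (by
    have h := Finset.prod_univ_sum (fun _ : Fin n => (Finset.univ : Finset α)) fun _ a => μ a
    have h1 : ∑ a, μ a = 1 := by rw [← tsum_fintype (L := .unconditional _)]; exact μ.tsum_coe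
    simp only [h1, Finset.prod_const_one, Fintype.piFinset_univ] at h
    exact h.symm)

theorem piLaw_succ {α : Type} [Fintype α] (μ : PMF α) (n : ℕ) :
    piLaw μ (n + 1) = μ.bind fun a => (piLaw μ n).map fun ω => (Fin.cons a ω : Fin (n + 1) → α) := by
  classical
  ext ω
  rw [PMF.bind_apply, tsum_eq_single (ω 0), PMF.map_apply, tsum_eq_single (Fin.tail ω)]
  · rw [if_pos (Fin.cons_self_tail ω).symm]
    simp only [piLaw, PMF.ofFintype_apply, Fin.prod_univ_succ]
    rfl
  · intro ω' h
    rw [if_neg]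
    rintro h'
    rw [h', Fin.tail_cons] at h
    exact h rfl
  · intro a ha
    rw [PMF.map_apply, ENNReal.tsum_eq_zero.2, mul_zero]
    intro ω'
    rw [if_neg]
    rintro h'
    rw [h', Fin.cons_zero] at ha
    exact ha rfl

theorem iid_eq_piLaw {α : Type} [Fintype α] (μ : PMF α) (n : ℕ) :
    iid μ n = (piLaw μ n).map List.ofFn := by
  induction n with
  | zero =>
    rw [map_congr_support _ _ (fun _ => []) (fun a _ => by simp)]
    exact (PMF.map_const _ _).symm
  | succ n ih =>
    rw [iid_succ, piLaw_succ, ih, map_bind_fun]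
    simp only [PMF.map_comp]
    congr 1; funext a
    congr 1; funext ω
    simp [List.ofFn_succ]

/-- The indices of the random bits: codeword, fresh bits, and ties. -/
abbrev Idx (N n : ℕ) : Type := (Fin n ⊕ Fin n) ⊕ Fin N

/-- The number of errors of the inner channel. -/
def errors (N : ℕ) (σ : Fin (N * expansion N) → Bool × Bool)
    (ω : Idx N (N * expansion N) → Bool) : ℕ :=
  listErrors N (List.ofFn fun k => ω (.inl (.inl k))) (List.ofFn σ)
    (List.ofFn fun k => ω (.inl (.inr k))) (List.ofFn fun i => ω (.inr i))

theorem innerChannel_law' {p q r : unitInterval} (hr : (r : ℝ) = 2 * q) (N : ℕ) :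
    ((uniformString N).bind fun x =>
        (innerChannel ((BSC q).comp (BDC p)) x).map fun y => diffWeight y x) =
      (piLaw (eventLaw p r) (N * expansion N)).bind fun σ =>
        (PMF.uniformOfFintype (Idx N (N * expansion N) → Bool)).map (errors N σ) := by
  rw [innerChannel_law hr, iid_eq_piLaw, bind_map_fun]
  congr 1; funext σ
  let e : (Fin (N * expansion N) → Bool) × (Fin (N * expansion N) → Bool) × (Fin N → Bool) ≃ (Idx N (N * expansion N) → Bool) :=
    (Equiv.prodAssoc _ _ _).symm.trans
      (((Equiv.sumArrowEquivProdArrow _ _ _).symm.prodCongr (Equiv.refl _)).trans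
        (Equiv.sumArrowEquivProdArrow _ _ _).symm)
  rw [← map_uniformOfFintype_equiv e, PMF.map_comp]
  simp only [uniformString, bind_map_fun, PMF.map_comp]
  have h2 : ∀ y : Fin (N * expansion N) → Bool, ((PMF.uniformOfFintype (Fin (N * expansion N) → Bool)).bind fun u =>
      (PMF.uniformOfFintype (Fin N → Bool)).map
        ((fun t => listErrors N (List.ofFn y) (List.ofFn σ) (List.ofFn u) t) ∘ List.ofFn)) =
      (PMF.uniformOfFintype ((Fin (N * expansion N) → Bool) × (Fin N → Bool))).map fun x =>
        listErrors N (List.ofFn y) (List.ofFn σ) (List.ofFn x.1) (List.ofFn x.2) := fun y =>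
    bind_uniformOfFintype_prod fun u t =>
      listErrors N (List.ofFn y) (List.ofFn σ) (List.ofFn u) (List.ofFn t)
  simp only [h2]
  rw [bind_uniformOfFintype_prod fun y (x : (Fin (N * expansion N) → Bool) × (Fin N → Bool)) =>
    listErrors N (List.ofFn y) (List.ofFn σ) (List.ofFn x.1) (List.ofFn x.2)]
  rfl

theorem Pr_piLaw {α : Type} [Fintype α] (μ : PMF α) (n : ℕ) (S : Set (Fin n → α)) :
    Pr (piLaw μ n) S = Prb (fun a => (μ a).toReal) S := by
  classical
  rw [Pr, PMF.toOuterMeasure_apply, tsum_fintype, ENNReal.toReal_sum, Prb, Ex]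
  · refine Finset.sum_congr rfl fun ω _ => ?_
    by_cases h : ω ∈ S
    · rw [Set.indicator_of_mem h, Set.indicator_of_mem h]
      simp [piLaw, ENNReal.toReal_prod]
    · rw [Set.indicator_of_notMem h, Set.indicator_of_notMem h]
      simp
  · intro ω _
    by_cases h : ω ∈ S
    · rw [Set.indicator_of_mem h]
      exact PMF.apply_ne_top _ _
    · rw [Set.indicator_of_notMem h]
      simp

theorem Pr_uniformOfFintype {κ : Type} [Fintype κ] [DecidableEq κ] (S : Set (κ → Bool)) :
    Pr (PMF.uniformOfFintype (κ → Bool)) S = Prb half S := by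
  classical
  rw [Pr, PMF.toOuterMeasure_apply, tsum_fintype, ENNReal.toReal_sum, Prb, Ex]
  · refine Finset.sum_congr rfl fun ω _ => ?_
    by_cases h : ω ∈ S
    · rw [Set.indicator_of_mem h, Set.indicator_of_mem h]
      simp [half]
    · rw [Set.indicator_of_notMem h, Set.indicator_of_notMem h]
      simp
  · intro ω _
    by_cases h : ω ∈ S
    · rw [Set.indicator_of_mem h]
      exact PMF.apply_ne_top _ _
    · rw [Set.indicator_of_notMem h]
      simp

/-! ## Errors as products of signs -/

theorem sum_sgn (l : List Bool) :
    (l.map sgn).sum = (l.count true : ℝ) - l.count false := by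
  induction l with
  | nil => simp
  | cons b l ih => cases b <;> simp [ih, sgn] <;> ring

theorem sign_eq_sgn_majBit {l : List Bool} (h : Odd l.length) :
    Real.sign (l.map sgn).sum = sgn (majBit l) := by
  have h2 := count_add_count l
  rw [sum_sgn, majBit]
  by_cases h3 : l.count false < l.count true
  · have h4 : (l.count false : ℝ) < l.count true := by exact_mod_cast h3
    rw [Real.sign_of_pos (by linarith)]
    simp [h3, sgn]
  · have h5 : l.count true < l.count false := by
      obtain ⟨k, hk⟩ := h
      omega
    have h4 : (l.count true : ℝ) < l.count false := by exact_mod_cast h5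
    rw [Real.sign_of_neg (by linarith)]
    simp [h3, sgn]

/-- For even length the sum of signs is even, so one more sign decides ties and changes nothing
else. Thus the tie-breaking coin becomes an ordinary summand. -/
theorem sign_eq_sgn_majTie (l : List Bool) (t : Bool) :
    Real.sign ((l.map sgn).sum + if Even l.length then sgn t else 0) = sgn (majTie l t) := by
  have h2 := count_add_count l
  have hs : |(if Even l.length then sgn t else 0 : ℝ)| ≤ 1 := by
    split_ifs <;> cases t <;> simp [sgn]
  obtain ⟨hs1, hs2⟩ := abs_le.1 hs
  rw [sum_sgn]
  rcases lt_trichotomy (l.count false) (l.count true) with h | h | h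
  · have hmaj : majTie l t = true := by simp [majTie, h]
    rw [hmaj, Real.sign_of_pos]
    · simp [sgn]
    by_cases he : Even l.length
    · have h3 : l.count false + 2 ≤ l.count true := by
        obtain ⟨k, hk⟩ := he
        omega
      have h4 : (l.count false : ℝ) + 2 ≤ l.count true := by exact_mod_cast h3
      linarith
    · have h4 : (l.count false : ℝ) < l.count true := by exact_mod_cast h
      rw [if_neg he]
      linarith
  · have he : Even l.length := ⟨l.count true, by omega⟩
    have hmaj : majTie l t = t := by simp [majTie, h]
    rw [hmaj, if_pos he, h, sub_self, zero_add]
    cases t <;> simp [sgn, Real.sign_of_neg, Real.sign_of_pos]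
  · have hmaj : majTie l t = false := by simp [majTie, h, h.not_gt]
    rw [hmaj, Real.sign_of_neg]
    · simp [sgn]
    by_cases he : Even l.length
    · have h3 : l.count true + 2 ≤ l.count false := by
        obtain ⟨k, hk⟩ := he
        omega
      have h4 : (l.count true : ℝ) + 2 ≤ l.count false := by exact_mod_cast h3
      linarith
    · have h4 : (l.count true : ℝ) < l.count false := by exact_mod_cast h
      rw [if_neg he]
      linarith

theorem count_true_ofFn {n : ℕ} (f : Fin n → Bool) :
    (List.ofFn f).count true = ∑ i, if f i then 1 else 0 := by
  induction n with
  | zero => simp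
  | succ n ih =>
    rw [List.ofFn_succ, List.count_cons, ih, Fin.sum_univ_succ, add_comm]
    cases f 0 <;> simp

theorem diffWeight_ofFn {n : ℕ} (f g : Fin n → Bool) :
    (diffWeight (List.ofFn f) (List.ofFn g) : ℝ) = ∑ i, (1 - sgn (g i) * sgn (f i)) / 2 := by
  have h : List.zipWith xor (List.ofFn f) (List.ofFn g) = List.ofFn fun i => xor (f i) (g i) := by
    simp only [List.ofFn_eq_map, List.zipWith_map, List.zipWith_self]
  rw [diffWeight, h, count_true_ofFn]
  push_cast
  refine Finset.sum_congr rfl fun i _ => ?_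
  cases f i <;> cases g i <;> norm_num [sgn]

theorem range_map_eq_ofFn {α : Type} (n : ℕ) (f : ℕ → α) :
    (List.range n).map f = List.ofFn fun i : Fin n => f i := by
  rw [List.ofFn_eq_map, ← List.map_coe_finRange_eq_range, List.map_map]
  rfl

/-- The positions that are not deleted. -/
def kept {n : ℕ} (σ : Fin n → Bool × Bool) : List (Fin n) :=
  (List.finRange n).filter fun k => !(σ k).1

/-- The index of the random bit that is transmitted at position `k`. -/
def source (N : ℕ) {n : ℕ} (σ : Fin n → Bool × Bool) (k : Fin n) : Idx N n :=
  .inl (if (σ k).2 then .inr k else .inl k)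

/-- The positions in the `i`-th block of the received string. -/
def window (N : ℕ) {n : ℕ} (σ : Fin n → Bool × Bool) (i : ℕ) : List (Fin n) :=
  ((kept σ).drop (i * (kept σ).length / N)).take
    ((i + 1) * (kept σ).length / N - i * (kept σ).length / N)

/-- The indices of the random bits in the `i`-th block of the transmitted string. -/
def inputSet (N m n : ℕ) (i : ℕ) : Finset (Idx N n) :=
  (Finset.univ.filter fun k : Fin n => i * m ≤ (k : ℕ) ∧ (k : ℕ) < (i + 1) * m).image
    fun k => .inl (.inl k)

/-- The indices of the random bits that determine the `i`-th decoded bit. -/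
def outputSet {N n : ℕ} (σ : Fin n → Bool × Bool) (i : Fin N) : Finset (Idx N n) :=
  (window N σ i).toFinset.image (source N σ) ∪
    if Even (window N σ i).length then {.inr i} else ∅

theorem flatten_zipWith3_emit {N n : ℕ} (σ : Fin n → Bool × Bool) (ω : Idx N n → Bool) :
    (List.zipWith3 emit (List.ofFn fun k => ω (.inl (.inl k))) (List.ofFn σ)
      (List.ofFn fun k => ω (.inl (.inr k)))).flatten =
      (kept σ).map fun k => ω (source N σ k) := by
  have h3 : ∀ (l : List (Fin n)) (f : Fin n → Bool) (g : Fin n → Bool × Bool) (h : Fin n → Bool),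
      List.zipWith3 emit (l.map f) (l.map g) (l.map h) =
        l.map fun k => emit (f k) (g k) (h k) := by
    intro l f g h
    induction l with
    | nil => rfl
    | cons a l ih => simp only [List.map_cons, List.zipWith3, ih]
  simp only [List.ofFn_eq_map]
  rw [h3, kept]
  induction List.finRange n with
  | nil => rfl
  | cons k l ih =>
    rw [List.map_cons, List.flatten_cons, ih, List.filter_cons]
    rcases hσ : σ k with ⟨d, e⟩
    cases d <;> cases e <;> simp [emit, source, hσ]

theorem nodup_kept {n : ℕ} (σ : Fin n → Bool × Bool) : (kept σ).Nodup :=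
  (List.nodup_finRange n).filter _

theorem nodup_window (N : ℕ) {n : ℕ} (σ : Fin n → Bool × Bool) (i : ℕ) : (window N σ i).Nodup :=
  (nodup_kept σ).sublist ((List.take_sublist _ _).trans (List.drop_sublist _ _))

/-- Distinct positions transmit distinct coins, so a block of the received string is a sum over a
set of coins, without repetitions. -/
theorem source_injective (N : ℕ) {n : ℕ} (σ : Fin n → Bool × Bool) :
    Function.Injective (source N σ) := by
  intro k k' h
  unfold source at h
  split_ifs at h <;> simp_all

theorem signSum_image {κ α : Type} [DecidableEq κ] [DecidableEq α] {f : α → κ}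
    (hf : Function.Injective f) {l : List α} (hl : l.Nodup) (ω : κ → Bool) :
    signSum (l.toFinset.image f) ω = ((l.map fun k => ω (f k)).map sgn).sum := by
  rw [signSum, Finset.sum_image fun _ _ _ _ h => hf h,
    List.sum_toFinset (fun k => sgn (ω (f k))) hl, List.map_map]
  rfl

theorem toFinset_take_drop_finRange (n a m : ℕ) :
    (((List.finRange n).drop a).take m).toFinset =
      Finset.univ.filter fun k : Fin n => a ≤ (k : ℕ) ∧ (k : ℕ) < a + m := by
  ext k
  simp only [List.mem_toFinset, List.mem_take_iff_getElem, List.getElem_drop, List.getElem_finRange,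
    List.length_drop, List.length_finRange, Finset.mem_filter, Finset.mem_univ, true_and]
  constructor
  · rintro ⟨j, hj, rfl⟩
    simp only [Fin.val_cast]
    omega
  · rintro ⟨h1, h2⟩
    have := k.2
    exact ⟨k - a, by omega, Fin.ext (by simp only [Fin.val_cast]; omega)⟩

theorem sgn_majBit_chunk {N m : ℕ} (hm : Odd m) (i : Fin N) (ω : Idx N (N * m) → Bool) :
    sgn (majBit (((List.ofFn fun k => ω (.inl (.inl k))).drop (i * m)).take m)) =
      Real.sign (signSum (inputSet N m (N * m) i) ω) := by
  have hlen : (i : ℕ) * m + m ≤ N * m := by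
    rw [← Nat.succ_mul]; exact Nat.mul_le_mul_right _ i.2
  have h : (inputSet N m (N * m) i) =
      (((List.finRange (N * m)).drop (i * m)).take m).toFinset.image fun k => .inl (.inl k) := by
    rw [toFinset_take_drop_finRange, inputSet, add_mul, one_mul]
  rw [h, signSum_image (fun _ _ h => by simpa using h)
    ((List.nodup_finRange _).sublist ((List.take_sublist _ _).trans (List.drop_sublist _ _))),
    List.ofFn_eq_map, ← List.map_drop, ← List.map_take, sign_eq_sgn_majBit]
  simp only [List.length_map, List.length_take, List.length_drop, List.length_finRange]
  rwa [min_eq_left (by omega)]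

theorem sgn_majTie_window {N n : ℕ} (σ : Fin n → Bool × Bool) (i : Fin N) (ω : Idx N n → Bool) :
    sgn (majTie ((window N σ i).map fun k => ω (source N σ k)) (ω (.inr i))) =
      Real.sign (signSum (outputSet σ i) ω) := by
  rw [← sign_eq_sgn_majTie, List.length_map, outputSet, signSum_union,
    signSum_image (source_injective N σ) (nodup_window N σ i)]
  · congr 2
    split_ifs <;> simp [signSum]
  · rw [Finset.disjoint_left]
    intro x hx hx'
    obtain ⟨k, _, rfl⟩ := Finset.mem_image.1 hx
    split_ifs at hx' <;> simp [source] at hx'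

/-- For signs s and s', the error indicator is (1 - s s') / 2. -/
theorem errors_eq {N : ℕ} (σ : Fin (N * expansion N) → Bool × Bool)
    (ω : Idx N (N * expansion N) → Bool) :
    (errors N σ ω : ℝ) = ∑ i : Fin N,
      (1 - Real.sign (signSum (inputSet N (expansion N) (N * expansion N) i) ω) *
        Real.sign (signSum (outputSet σ i) ω)) / 2 := by
  have h1 : List.zipWith majTie (blocks N ((kept σ).map fun k => ω (source N σ k)))
      (List.ofFn fun i => ω (.inr i)) =
      List.ofFn fun i : Fin N =>
        majTie ((window N σ i).map fun k => ω (source N σ k)) (ω (.inr i)) := by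
    rw [blocks, range_map_eq_ofFn, List.ofFn_eq_map, List.ofFn_eq_map, List.ofFn_eq_map,
      List.zipWith_map, List.zipWith_self]
    refine List.map_congr_left fun i _ => ?_
    rw [window, List.map_take, List.map_drop, List.length_map]
  rw [errors, listErrors, flatten_zipWith3_emit, h1, chunks, List.map_map, range_map_eq_ofFn,
    diffWeight_ofFn]
  refine Finset.sum_congr rfl fun i _ => ?_
  rw [sgn_majTie_window, Function.comp, sgn_majBit_chunk (odd_expansion N)]

/-! ## The blocks of the received string for typical deletions -/

/-- The number of positions before `a` that are not deleted. -/
def keptCount {n : ℕ} (σ : Fin n → Bool × Bool) (a : ℕ) : ℕ :=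
  (Finset.univ.filter fun k : Fin n => (k : ℕ) < a ∧ (σ k).1 = false).card

/-- The number of positions before `a` that are transmitted without errors. -/
def copiedCount {n : ℕ} (σ : Fin n → Bool × Bool) (a : ℕ) : ℕ :=
  (Finset.univ.filter fun k : Fin n => (k : ℕ) < a ∧ σ k = (false, false)).card

theorem keptCount_mono {n : ℕ} (σ : Fin n → Bool × Bool) : Monotone (keptCount σ) :=
  fun _ _ h => Finset.card_le_card fun k => by
    simp only [Finset.mem_filter, Finset.mem_univ, true_and]
    exact fun hk => ⟨hk.1.trans_le h, hk.2⟩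

theorem keptCount_lt {n : ℕ} {σ : Fin n → Bool × Bool} {k : Fin n} (hk : (σ k).1 = false) {a : ℕ}
    (h : (k : ℕ) < a) : keptCount σ k < keptCount σ a := by
  refine Finset.card_lt_card (Finset.ssubset_iff_of_subset (fun j => ?_) |>.2 ⟨k, ?_, ?_⟩)
  · simp only [Finset.mem_filter, Finset.mem_univ, true_and]
    exact fun hj => ⟨hj.1.trans h, hj.2⟩
  · simp [h, hk]
  · simp

theorem keptCount_eq_length {n : ℕ} (σ : Fin n → Bool × Bool) (a : ℕ) :
    keptCount σ a = (((List.finRange n).take a).filter fun k => !(σ k).1).length := by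
  rw [← List.toFinset_card_of_nodup
    (((List.nodup_finRange n).sublist (List.take_sublist _ _)).filter _), keptCount]
  congr 1
  have h := toFinset_take_drop_finRange n 0 a
  rw [List.drop_zero] at h
  rw [List.toFinset_filter, h]
  ext k
  simp

theorem length_kept {n : ℕ} (σ : Fin n → Bool × Bool) : (kept σ).length = keptCount σ n := by
  rw [keptCount_eq_length, List.take_of_length_le (by simp), kept]

theorem keptCount_le {n : ℕ} (σ : Fin n → Bool × Bool) (a : ℕ) : keptCount σ a ≤ n :=
  (Finset.card_le_univ _).trans_eq (Fintype.card_fin n)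

/-- `keptCount σ k` is the place of a kept position `k` in the received string. -/
theorem getElem?_kept {n : ℕ} {σ : Fin n → Bool × Bool} {k : Fin n} (hk : (σ k).1 = false) :
    (kept σ)[keptCount σ k]? = some k := by
  have h : kept σ = ((List.finRange n).take k).filter (fun k => !(σ k).1) ++
      k :: ((List.finRange n).drop (k + 1)).filter (fun k => !(σ k).1) := by
    have h1 := List.take_append_drop (k : ℕ) (List.finRange n)
    rw [List.drop_eq_getElem_cons (by simp)] at h1
    rw [kept]
    conv_lhs => rw [← h1]
    rw [List.filter_append, List.filter_cons]
    simp [hk]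
  rw [h, keptCount_eq_length, List.getElem?_append_right le_rfl, Nat.sub_self]
  rfl

theorem mem_window {N n : ℕ} (σ : Fin n → Bool × Bool) (i : ℕ) (k : Fin n) :
    k ∈ window N σ i ↔ (σ k).1 = false ∧ i * keptCount σ n / N ≤ keptCount σ k ∧
      keptCount σ k < (i + 1) * keptCount σ n / N := by
  rw [window, length_kept, List.mem_iff_getElem?]
  simp only [List.getElem?_take, List.getElem?_drop]
  constructor
  · rintro ⟨j, hj⟩
    split_ifs at hj with hlt
    have hk : (σ k).1 = false := by
      have := List.mem_of_getElem? hj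
      simpa [kept] using this
    have := getElem?_kept hk
    rw [← this] at hj
    obtain ⟨hlen, -⟩ := List.getElem?_eq_some_iff.1 this
    have := (List.getElem?_inj (by
      by_contra! hge
      rw [List.getElem?_eq_none hge, this] at hj
      simp at hj) (nodup_kept σ)).1 hj
    exact ⟨hk, by omega, by omega⟩
  · rintro ⟨hk, h1, h2⟩
    refine ⟨keptCount σ k - i * keptCount σ n / N, ?_⟩
    rw [if_pos (by omega), Nat.add_sub_cancel' h1, getElem?_kept hk]

/-- The fractions of kept and of copied positions are close to `r` and `g` in every prefix that
consists of whole blocks. -/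
structure Regular {N m : ℕ} (r g d : ℝ) (σ : Fin (N * m) → Bool × Bool) : Prop where
  kept : ∀ i ≤ N, |(keptCount σ (i * m) : ℝ) - r * (i * m)| ≤ d
  copied : ∀ i ≤ N, |(copiedCount σ (i * m) : ℝ) - g * (i * m)| ≤ d

namespace Regular

variable {N m : ℕ} {r g d : ℝ} {σ : Fin (N * m) → Bool × Bool}

/-- The boundary interpolates linearly in the total number of kept positions, whose deviation is
multiplied by i / N ≤ 1. Rounding down costs at most 1 ≤ d more. -/
theorem abs_boundary_sub_le (h : Regular r g d σ) (hd : 1 ≤ d) (hN : 0 < N) {i : ℕ} (hi : i ≤ N) :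
    |((i * keptCount σ (N * m) / N : ℕ) : ℝ) - r * (i * m)| ≤ 2 * d := by
  have hN' : (0 : ℝ) < N := by exact_mod_cast hN
  have hi' : (i : ℝ) ≤ N := by exact_mod_cast hi
  obtain ⟨h1, h2⟩ := abs_le.1 (h.kept N le_rfl)
  set L := keptCount σ (N * m)
  have hf1 : ((i * L / N : ℕ) : ℝ) ≤ i * L / N := by
    have := @Nat.cast_div_le ℝ _ _ _ (i * L) N
    push_cast at this
    exact this
  have hf2 : (i * L / N : ℝ) < ((i * L / N : ℕ) : ℝ) + 1 := by
    rw [div_lt_iff₀ hN']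
    have := Nat.lt_div_mul_add (a := i * L) hN
    have h3 : ((i * L : ℕ) : ℝ) < ((i * L / N * N + N : ℕ) : ℝ) := by exact_mod_cast this
    push_cast at h3 ⊢
    linarith
  have he : (i * L / N : ℝ) - r * (i * m) = i / N * (L - r * (N * m)) := by
    field_simp
  have hq : (i / N : ℝ) ≤ 1 := (div_le_one hN').2 hi'
  have hq0 : (0 : ℝ) ≤ i / N := by positivity
  have h4 : |(i * L / N : ℝ) - r * (i * m)| ≤ d := by
    rw [he, abs_mul, abs_of_nonneg hq0]
    exact (mul_le_of_le_one_left (abs_nonneg _) hq).trans (h.kept N le_rfl)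
  obtain ⟨h5, h6⟩ := abs_le.1 h4
  rw [abs_le]
  constructor <;> linarith

/-- Block `i` of the received string comes from the blocks i - 1, i and i + 1 of the transmitted
one. A displacement by a whole block would amount to r m kept positions, but the prefix count is off
by at most d and the boundary by at most 2d. -/
theorem bounds_of_mem_window (h : Regular r g d σ) (hd : 1 ≤ d) (hr : 3 * d < r * m) {i : ℕ}
    (hi : i < N) {k : Fin (N * m)} (hk : k ∈ window N σ i) :
    i * m ≤ k + m ∧ (k : ℕ) < (i + 2) * m := by
  obtain ⟨-, h1, h2⟩ := (mem_window σ i k).1 hk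
  have hN : 0 < N := by omega
  constructor
  · by_contra! hlt
    obtain ⟨j, rfl⟩ : ∃ j, i = j + 1 := ⟨i - 1, by
      rcases i with _ | i
      · simp at hlt
      · rfl⟩
    have hkj : (k : ℕ) ≤ j * m := by
      rw [add_mul, one_mul] at hlt
      omega
    have h3 := h1.trans (keptCount_mono σ hkj)
    have h4 := (abs_le.1 (h.kept j (by omega))).2
    have h5 := (abs_le.1 (h.abs_boundary_sub_le hd hN hi.le)).1
    have h6 : (((j + 1) * keptCount σ (N * m) / N : ℕ) : ℝ) ≤ keptCount σ (j * m) := by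
      exact_mod_cast h3
    push_cast at h5
    linarith
  · by_contra! hle
    have hiN : i + 2 ≤ N := by
      by_contra! hlt
      have := Nat.mul_le_mul_right m (show N ≤ i + 2 by omega)
      have := k.2
      omega
    have h3 := (keptCount_mono σ hle).trans_lt h2
    have h4 := (abs_le.1 (h.kept _ hiN)).1
    have h5 := (abs_le.1 (h.abs_boundary_sub_le hd hN hi)).2
    have h6 : (keptCount σ ((i + 2) * m) : ℝ) ≤ ((i + 1) * keptCount σ (N * m) / N : ℕ) := by
      exact_mod_cast h3.le
    push_cast at h4 h5
    linarith

end Regular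

theorem length_window_le {N m : ℕ} (σ : Fin (N * m) → Bool × Bool) (hN : 0 < N) (i : ℕ) :
    (window N σ i).length ≤ m := by
  rw [window]
  refine (List.length_take_le _ _).trans ?_
  have h1 : (i + 1) * (kept σ).length ≤ i * (kept σ).length + N * m := by
    rw [add_mul, one_mul, length_kept]
    have := keptCount_le σ (N * m)
    omega
  have h2 := Nat.div_le_div_right (c := N) h1
  rw [Nat.add_mul_div_left _ _ hN] at h2
  omega

theorem card_outputSet_le {N m : ℕ} (σ : Fin (N * m) → Bool × Bool) (i : Fin N) :
    (outputSet σ i).card ≤ m + 1 := by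
  rw [outputSet]
  refine (Finset.card_union_le _ _).trans (Nat.add_le_add ?_ ?_)
  · exact Finset.card_image_le.trans ((List.toFinset_card_le _).trans
      (length_window_le σ i.pos _))
  · split_ifs <;> simp

theorem card_inputSet {N m : ℕ} (i : Fin N) : (inputSet N m (N * m) i).card ≤ m := by
  have h : (inputSet N m (N * m) i) =
      (((List.finRange (N * m)).drop (i * m)).take m).toFinset.image fun k => .inl (.inl k) := by
    rw [toFinset_take_drop_finRange, inputSet, add_mul, one_mul]
  rw [h]
  exact Finset.card_image_le.trans ((List.toFinset_card_le _).trans (List.length_take_le _ _))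

/-- The kept positions whose rank is in an interval. -/
theorem card_filter_keptCount_le {n : ℕ} (σ : Fin n → Bool × Bool) (a b : ℕ) :
    (Finset.univ.filter fun k : Fin n =>
      (σ k).1 = false ∧ a ≤ keptCount σ k ∧ keptCount σ k < b).card ≤ b - a := by
  rw [← Nat.card_Ico]
  refine Finset.card_le_card_of_injOn (fun k => keptCount σ k) ?_ ?_
  · intro k hk
    simp only [Finset.coe_filter, Finset.mem_univ, true_and, Set.mem_ofPred_eq] at hk
    simpa using hk.2
  · intro k hk k' hk' h
    simp only [Finset.coe_filter, Finset.mem_univ, true_and, Set.mem_ofPred_eq] at hk hk'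
    have h1 := getElem?_kept hk.1
    simp only [h, getElem?_kept hk'.1, Option.some.injEq] at h1
    exact h1.symm

/-- At least g m - 2d positions of block `i` are copied. Those missing from the window have their
rank between a block boundary and the count of kept positions before it; these two gaps have at most
3d ranks each. -/
theorem Regular.le_card_inter {N m : ℕ} {r g d : ℝ} {σ : Fin (N * m) → Bool × Bool}
    (h : Regular r g d σ) (hd : 1 ≤ d) (i : Fin N) :
    g * m - 8 * d ≤ ((inputSet N m (N * m) i ∩ outputSet σ i).card : ℝ) := by
  have hi := i.2
  set a := (i : ℕ) * keptCount σ (N * m) / N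
  set b := ((i : ℕ) + 1) * keptCount σ (N * m) / N
  let C := Finset.univ.filter fun k : Fin (N * m) => (k : ℕ) < (i + 1) * m ∧ σ k = (false, false)
  let C0 := Finset.univ.filter fun k : Fin (N * m) => (k : ℕ) < i * m ∧ σ k = (false, false)
  let D (a b : ℕ) := Finset.univ.filter fun k : Fin (N * m) =>
      (σ k).1 = false ∧ a ≤ keptCount σ k ∧ keptCount σ k < b
  let I := Finset.univ.filter fun k : Fin (N * m) =>
    (i * m ≤ (k : ℕ) ∧ (k : ℕ) < (i + 1) * m) ∧ σ k = (false, false) ∧ k ∈ window N σ i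
  -- A copied position before the end of block `i` lies before the block, or in both block and
  -- window, or in one of the two gaps of ranks.
  have hsub : C ⊆ (C0 ∪ I) ∪ (D (keptCount σ (i * m)) a ∪ D b (keptCount σ ((i + 1) * m))) := by
    intro k hk
    simp only [C, Finset.mem_filter, Finset.mem_univ, true_and] at hk
    simp only [C0, I, D, Finset.mem_union, Finset.mem_filter, Finset.mem_univ, true_and,
      mem_window, hk, and_true]
    have h1 : (i : ℕ) * m ≤ k → keptCount σ (i * m) ≤ keptCount σ k := fun h => keptCount_mono σ h
    have h2 : keptCount σ k < keptCount σ ((i + 1) * m) := keptCount_lt (by simp [hk]) hk.1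
    omega
  have hI : I.card ≤ (inputSet N m (N * m) i ∩ outputSet σ i).card := by
    refine Finset.card_le_card_of_injOn (fun k => .inl (.inl k)) ?_ ?_
    · intro k hk
      simp only [I, Finset.coe_filter, Finset.mem_univ, true_and, Set.mem_ofPred_eq] at hk
      obtain ⟨hk1, hk2, hk3⟩ := hk
      rw [Finset.mem_coe, Finset.mem_inter]
      refine ⟨Finset.mem_image_of_mem _ (by simpa using hk1),
        Finset.mem_union_left _ (Finset.mem_image.2 ⟨k, by simpa using hk3, ?_⟩)⟩
      simp [source, hk2]
    · intro k _ k' _ h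
      simpa using h
  have hcard := Finset.card_le_card hsub
  have hu1 := Finset.card_union_le (C0 ∪ I)
    (D (keptCount σ (i * m)) a ∪ D b (keptCount σ ((i + 1) * m)))
  have hu2 := Finset.card_union_le C0 I
  have hu3 := Finset.card_union_le (D (keptCount σ (i * m)) a) (D b (keptCount σ ((i + 1) * m)))
  have hD1 : (D _ _).card ≤ _ := card_filter_keptCount_le σ (keptCount σ (i * m)) a
  have hD2 : (D _ _).card ≤ _ := card_filter_keptCount_le σ b (keptCount σ ((i + 1) * m))
  have hC : C.card = copiedCount σ ((i + 1) * m) := rfl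
  have hC0 : C0.card = copiedCount σ (i * m) := rfl
  have k0 := abs_le.1 (h.kept i hi.le)
  have k1 := abs_le.1 (h.kept (i + 1) hi)
  have c0 := abs_le.1 (h.copied i hi.le)
  have c1 := abs_le.1 (h.copied (i + 1) hi)
  have b0 := abs_le.1 (h.abs_boundary_sub_le hd i.pos hi.le)
  have b1 := abs_le.1 (h.abs_boundary_sub_le hd i.pos (i := i + 1) hi)
  push_cast at k1 c1 b1
  have hsub_le : ∀ x y : ℕ, (x : ℝ) - y ≤ 3 * d → ((x - y : ℕ) : ℝ) ≤ 3 * d := by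
    intro x y hxy
    rcases le_total y x with hle | hle
    · rwa [Nat.cast_sub hle]
    · rw [Nat.sub_eq_zero_of_le hle]
      push_cast
      linarith
  have hs1 := hsub_le a (keptCount σ (i * m)) (by linarith)
  have hs2 := hsub_le (keptCount σ ((i + 1) * m)) b (by linarith)
  have hfin : copiedCount σ ((i + 1) * m) ≤ copiedCount σ (i * m) +
      (inputSet N m (N * m) i ∩ outputSet σ i).card + ((a - keptCount σ (i * m)) +
        (keptCount σ ((i + 1) * m) - b)) := by
    omega
  have hfin' : (copiedCount σ ((i + 1) * m) : ℝ) ≤ copiedCount σ (i * m) +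
      (inputSet N m (N * m) i ∩ outputSet σ i).card + (((a - keptCount σ (i * m) : ℕ) : ℝ) +
        ((keptCount σ ((i + 1) * m) - b : ℕ) : ℝ)) := by exact_mod_cast hfin
  linarith

/-- The indices that determine whether the `i`-th bit is decoded correctly. -/
def supportSet {N m : ℕ} (σ : Fin (N * m) → Bool × Bool) (i : Fin N) : Finset (Idx N (N * m)) :=
  inputSet N m (N * m) i ∪ outputSet σ i

theorem Regular.mem_supportSet {N m : ℕ} {r g d : ℝ} {σ : Fin (N * m) → Bool × Bool}
    (h : Regular r g d σ) (hd : 1 ≤ d) (hr : 3 * d < r * m) {i : Fin N} {x : Idx N (N * m)}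
    (hx : x ∈ supportSet σ i) :
    x = .inr i ∨ ∃ k : Fin (N * m), (x = .inl (.inl k) ∨ x = .inl (.inr k)) ∧
      i * m ≤ k + m ∧ (k : ℕ) < (i + 2) * m := by
  simp only [supportSet, inputSet, outputSet, Finset.mem_union, Finset.mem_image,
    Finset.mem_filter, Finset.mem_univ, true_and, List.mem_toFinset] at hx
  rcases hx with ⟨k, hk, rfl⟩ | ⟨k, hk, rfl⟩ | hx
  · refine .inr ⟨k, by simp, by omega, hk.2.trans_le (Nat.mul_le_mul_right _ (by omega))⟩
  · refine .inr ⟨k, ?_, h.bounds_of_mem_window hd hr i.2 hk⟩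
    unfold source
    split_ifs <;> simp
  · split_ifs at hx
    · exact .inl (by simpa using hx)
    · simp at hx

theorem Regular.disjoint_supportSet {N m : ℕ} {r g d : ℝ} {σ : Fin (N * m) → Bool × Bool}
    (h : Regular r g d σ) (hd : 1 ≤ d) (hr : 3 * d < r * m) {i j : Fin N}
    (hij : (i : ℕ) + 3 ≤ j) : Disjoint (supportSet σ i) (supportSet σ j) := by
  rw [Finset.disjoint_left]
  intro x hxi hxj
  have h1 : ((i : ℕ) + 2) * m + m ≤ j * m := by
    rw [← Nat.succ_mul]; exact Nat.mul_le_mul_right _ (by omega)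
  rcases h.mem_supportSet hd hr hxi with rfl | ⟨k, hk, hk1, hk2⟩ <;>
    rcases h.mem_supportSet hd hr hxj with hx | ⟨k', hk', hk1', hk2'⟩
  · simp only [Sum.inr.injEq] at hx
    omega
  · simp at hk'
  · simp [hx] at hk
  · rcases hk with rfl | rfl <;> simp only [Sum.inl.injEq, Sum.inr.injEq, reduceCtorEq, or_false,
      false_or] at hk' <;> subst hk' <;> omega

/-! ## Concentration -/

/-- Within a residue class mod 3 the summands are independent, and a sum of at most -t leaves some
class with at most -t/3. -/
theorem Prb_sum_le_of_dist {κ α : Type} [Fintype κ] [DecidableEq κ] [Fintype α] {w : α → ℝ}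
    (h0 : ∀ a, 0 ≤ w a) (h1 : ∑ a, w a = 1) {N : ℕ} {X : Fin N → (κ → α) → ℝ}
    {A : Fin N → Finset κ} (hX : ∀ i, DependsOn (X i) (A i : Set κ))
    (hA : ∀ i j : Fin N, (i : ℕ) + 3 ≤ j → Disjoint (A i) (A j))
    (hb : ∀ i ω, |X i ω| ≤ 1) (hm : ∀ i, 0 ≤ Ex w (X i))
    {l : ℝ} (hl0 : 0 ≤ l) (hl1 : l ≤ 1) (t : ℝ) :
    Prb w {ω | ∑ i, X i ω ≤ -t} ≤ 3 * Real.exp (l ^ 2 * N - l * (t / 3)) := by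
  let c (a : ℕ) : Finset (Fin N) := Finset.univ.filter fun i => (i : ℕ) % 3 = a
  have hsplit : ∀ ω, ∑ i, X i ω = ∑ a ∈ Finset.range 3, ∑ i ∈ c a, X i ω := fun ω =>
    (Finset.sum_fiberwise_of_maps_to (fun i _ => Finset.mem_range.2 (Nat.mod_lt _ (by simp))) _).symm
  have hsub : {ω | ∑ i, X i ω ≤ -t} ⊆
      ⋃ a ∈ Finset.range 3, {ω | ∑ i ∈ c a, X i ω ≤ -(t / 3)} := by
    intro ω hω
    by_contra hcon
    simp only [Set.mem_iUnion, Set.mem_ofPred_eq, exists_prop, not_exists, not_and, not_le] at hcon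
    have hω' : ∑ i, X i ω ≤ -t := hω
    rw [hsplit, Finset.sum_range_succ, Finset.sum_range_succ, Finset.sum_range_one] at hω'
    have := hcon 0 (by simp)
    have := hcon 1 (by simp)
    have := hcon 2 (by simp)
    linarith
  refine (Prb_mono h0 hsub).trans ((Prb_biUnion_le h0 _ _).trans ?_)
  have hc : ∀ a ∈ Finset.range 3, Prb w {ω | ∑ i ∈ c a, X i ω ≤ -(t / 3)} ≤
      Real.exp (l ^ 2 * N - l * (t / 3)) := by
    intro a _
    refine (Prb_sum_le h0 h1 (c a) (fun i _ => hX i) ?_ (fun i _ => hb i) (fun i _ => hm i)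
      hl0 hl1 _).trans (Real.exp_le_exp.2 ?_)
    · intro i hi j hj hij
      simp only [c, Finset.coe_filter, Finset.mem_univ, true_and, Set.mem_ofPred_eq] at hi hj
      rcases lt_or_gt_of_ne (Fin.val_ne_of_ne hij) with h | h
      · exact hA i j (by omega)
      · exact (hA j i (by omega)).symm
    · have : ((c a).card : ℝ) ≤ N := by
        exact_mod_cast (Finset.card_le_univ _).trans_eq (Fintype.card_fin N)
      gcongr
  refine (Finset.sum_le_sum hc).trans_eq ?_
  simp

/-- The sign that tells whether the `i`-th bit is decoded correctly. -/
def agreement {N m : ℕ} (σ : Fin (N * m) → Bool × Bool) (i : Fin N) (ω : Idx N (N * m) → Bool) : ℝ :=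
  Real.sign (signSum (inputSet N m (N * m) i) ω) * Real.sign (signSum (outputSet σ i) ω)

theorem abs_agreement_le {N m : ℕ} (σ : Fin (N * m) → Bool × Bool) (i : Fin N)
    (ω : Idx N (N * m) → Bool) : |agreement σ i ω| ≤ 1 := by
  rw [agreement, abs_mul]
  exact mul_le_one₀ (abs_sign_le _) (abs_nonneg _) (abs_sign_le _)

theorem dependsOn_agreement {N m : ℕ} (σ : Fin (N * m) → Bool × Bool) (i : Fin N) :
    DependsOn (agreement σ i) (supportSet σ i : Set (Idx N (N * m))) := by
  intro x y hxy
  rw [agreement, agreement,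
    dependsOn_signSum (inputSet N m (N * m) i) fun k hk => hxy k (by
      rw [supportSet, Finset.coe_union]; exact .inl hk),
    dependsOn_signSum (outputSet σ i) fun k hk => hxy k (by
      rw [supportSet, Finset.coe_union]; exact .inr hk)]

/-- The overlap is at least gm - 8d ≥ gm/2, and the two sets have at most m and m + 1 ≤ 2m elements:
(gm/2)² / (16 · m · 2m) = g² / 128. -/
theorem Regular.le_Ex_agreement {N m : ℕ} {r g d : ℝ} {σ : Fin (N * m) → Bool × Bool}
    (h : Regular r g d σ) (hm : 1 ≤ m) (hd : 1 ≤ d) (hg0 : 0 < g) (hdg : 16 * d ≤ g * m)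
    (i : Fin N) : g ^ 2 / 128 ≤ Ex half (agreement σ i) := by
  have hm1 : (1 : ℝ) ≤ m := by exact_mod_cast hm
  refine le_trans ?_ (le_Ex_sign_mul_sign _ _)
  have hc := h.le_card_inter hd i
  have hc' : g * m / 2 ≤ ((inputSet N m (N * m) i ∩ outputSet σ i).card : ℝ) := by linarith
  have hpos : 0 < g * m / 2 := by positivity
  have hB : ((inputSet N m (N * m) i).card : ℝ) ≤ m := by exact_mod_cast card_inputSet i
  have hJ : ((outputSet σ i).card : ℝ) ≤ 2 * m := by
    have h1 : ((outputSet σ i).card : ℝ) ≤ m + 1 := by exact_mod_cast card_outputSet_le σ i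
    linarith
  have hB0 : (0 : ℝ) < (inputSet N m (N * m) i).card := hpos.trans_le (hc'.trans (by
    exact_mod_cast Finset.card_le_card Finset.inter_subset_left))
  have hJ0 : (0 : ℝ) < (outputSet σ i).card := hpos.trans_le (hc'.trans (by
    exact_mod_cast Finset.card_le_card Finset.inter_subset_right))
  calc g ^ 2 / 128 = (g * m / 2) ^ 2 / (16 * m * (2 * m)) := by
        field_simp; norm_num
    _ ≤ _ := by gcongr

theorem Regular.Prb_sum_agreement_le {N m : ℕ} {r g d : ℝ} {σ : Fin (N * m) → Bool × Bool}
    (h : Regular r g d σ) (hm : 1 ≤ m) (hd : 1 ≤ d) (hg0 : 0 < g) (hgr : g ≤ r) (hr1 : r ≤ 1)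
    (hdg : 16 * d ≤ g * m) :
    Prb half {ω | ∑ i, (agreement σ i ω - g ^ 2 / 128) / 2 ≤ -(g ^ 2 / 512 * N)} ≤
      3 * Real.exp (-((g ^ 2 / 3072) ^ 2 * N)) := by
  have hm1 : (1 : ℝ) ≤ m := by exact_mod_cast hm
  have hr3 : 3 * d < r * m := by
    have := mul_le_mul_of_nonneg_right hgr (zero_le_one.trans hm1)
    linarith
  have hg1 : g ^ 2 ≤ 1 := pow_le_one₀ hg0.le (hgr.trans hr1)
  have hg2 : 0 < g ^ 2 := by positivity
  -- Here t/3 = 2 l N with l = g² / 3072, so the exponent l² N - l t/3 is -l² N. The halving keeps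
  -- the centred agreements bounded by 1.
  refine (Prb_sum_le_of_dist half_nonneg sum_half
    (A := supportSet σ) (fun i x y hxy => by rw [dependsOn_agreement σ i hxy])
    (fun i j hij => h.disjoint_supportSet hd hr3 hij)
    (fun i ω => ?_) (fun i => ?_) (l := g ^ 2 / 3072) (by positivity) (by linarith) _).trans_eq ?_
  · obtain ⟨h1, h2⟩ := abs_le.1 (abs_agreement_le σ i ω)
    rw [abs_le]
    constructor <;> linarith
  · have he : (fun ω => (agreement σ i ω - g ^ 2 / 128) / 2) =
        fun ω => (1 / 2) * (agreement σ i ω - g ^ 2 / 128) := by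
      funext ω; ring
    rw [he, Ex_const_mul, Ex_sub, Ex_const sum_half]
    have := h.le_Ex_agreement hm hd hg0 hdg i
    linarith
  · congr 2
    ring

/-- The expected fraction of errors is at most 1/2 - g²/256; half of this margin is given up for the
deviation, which leaves ε = g² / 512. -/
theorem Regular.Prb_errors_le {N : ℕ} {r g d : ℝ} {σ : Fin (N * expansion N) → Bool × Bool}
    (h : Regular r g d σ) (hd : 1 ≤ d) (hg0 : 0 < g) (hgr : g ≤ r) (hr1 : r ≤ 1)
    (hdg : 16 * d ≤ g * expansion N) :
    Prb half {ω | (1 / 2 - g ^ 2 / 512) * (N : ℝ) < (errors N σ ω : ℝ)} ≤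
      3 * Real.exp (-((g ^ 2 / 3072) ^ 2 * N)) := by
  refine (Prb_mono half_nonneg fun ω hω => ?_).trans
    (h.Prb_sum_agreement_le (odd_expansion N).pos hd hg0 hgr hr1 hdg)
  have hω' : (1 / 2 - g ^ 2 / 512) * (N : ℝ) < (errors N σ ω : ℝ) := hω
  have he : (errors N σ ω : ℝ) = ∑ i : Fin N, (1 - agreement σ i ω) / 2 := errors_eq σ ω
  rw [he, ← Finset.sum_div, Finset.sum_sub_distrib] at hω'
  change ∑ i, (agreement σ i ω - g ^ 2 / 128) / 2 ≤ -(g ^ 2 / 512 * N)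
  rw [← Finset.sum_div, Finset.sum_sub_distrib]
  simp only [Finset.sum_const, Finset.card_univ, Fintype.card_fin, nsmul_eq_mul, mul_one] at hω' ⊢
  linarith

theorem Ex_apply {κ α : Type} [Fintype κ] [DecidableEq κ] [Fintype α] {w : α → ℝ}
    (h1 : ∑ a, w a = 1) (k : κ) (h : α → ℝ) :
    Ex w (fun ω : κ → α => h (ω k)) = ∑ a, w a * h a := by
  have := Finset.prod_univ_sum (fun _ : κ => (Finset.univ : Finset α))
    fun j a => w a * if j = k then h a else 1
  rw [Finset.prod_eq_single k (fun j _ hj => by simp [hj, h1]) (by simp),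
    Fintype.piFinset_univ] at this
  simp only [if_true, Finset.prod_mul_distrib, Finset.prod_ite_eq', Finset.mem_univ] at this
  rw [this, Ex]

theorem Prb_deviation_le {κ α : Type} [Fintype κ] [DecidableEq κ] [Fintype α] {w : α → ℝ}
    (h0 : ∀ a, 0 ≤ w a) (h1 : ∑ a, w a = 1) (E : Set α) {μ : ℝ} (hμ0 : 0 ≤ μ) (hμ1 : μ ≤ 1)
    (hμ : ∑ a, w a * E.indicator 1 a = μ) (s : Finset κ) {l : ℝ} (hl0 : 0 ≤ l) (hl1 : l ≤ 1)
    (t : ℝ) :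
    Prb w {ω | t < |∑ k ∈ s, E.indicator 1 (ω k) - μ * s.card|} ≤
      2 * Real.exp (l ^ 2 * s.card - l * t) := by
  have hEx : ∀ k : κ, Ex w (fun ω => E.indicator (1 : α → ℝ) (ω k)) = μ := fun k =>
    (Ex_apply h1 k _).trans hμ
  have hE : ∀ a, 0 ≤ E.indicator (1 : α → ℝ) a ∧ E.indicator (1 : α → ℝ) a ≤ 1 := fun a => by
    by_cases ha : a ∈ E <;> simp [ha]
  have hdisj : (s : Set κ).PairwiseDisjoint fun k => ({k} : Finset κ) := fun i _ j _ hij => by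
    simpa [Function.onFun] using hij
  have hup := Prb_sum_le h0 h1 s (X := fun k ω => E.indicator 1 (ω k) - μ) (A := fun k => {k})
    (fun k _ x y hxy => by simp only [hxy k (by simp)]) hdisj
    (fun k _ ω => by rw [abs_le]; constructor <;> linarith [hE (ω k)])
    (fun k _ => by rw [Ex_sub, hEx, Ex_const h1, sub_self]) hl0 hl1 t
  have hdown := Prb_sum_le h0 h1 s (X := fun k ω => μ - E.indicator 1 (ω k)) (A := fun k => {k})
    (fun k _ x y hxy => by simp only [hxy k (by simp)]) hdisj
    (fun k _ ω => by rw [abs_le]; constructor <;> linarith [hE (ω k)])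
    (fun k _ => by rw [Ex_sub, hEx, Ex_const h1, sub_self]) hl0 hl1 t
  rw [two_mul]
  refine (Prb_mono h0 fun ω hω => ?_).trans
    ((Prb_union_le h0 _ _).trans (add_le_add hup hdown))
  have hω' : t < |∑ k ∈ s, E.indicator 1 (ω k) - μ * s.card| := hω
  simp only [Set.mem_union, Set.mem_ofPred_eq, Finset.sum_sub_distrib, Finset.sum_const,
    nsmul_eq_mul]
  rcases lt_abs.1 hω' with h | h
  · right; linarith
  · left; linarith

theorem eventLaw_apply (p r : unitInterval) (a : Bool × Bool) :
    eventLaw p r a = ber p a.1 * ber r a.2 := by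
  rcases a with ⟨d, e⟩
  rw [eventLaw, PMF.bind_apply, tsum_bool]
  simp only [PMF.map_apply, tsum_bool]
  cases d <;> cases e <;> simp

/-- The probabilities of the events at a position. -/
def eventWeight (p r : unitInterval) (a : Bool × Bool) : ℝ := (eventLaw p r a).toReal

theorem eventWeight_nonneg (p r : unitInterval) (a : Bool × Bool) : 0 ≤ eventWeight p r a :=
  ENNReal.toReal_nonneg

theorem eventWeight_apply (p r : unitInterval) (d e : Bool) : eventWeight p r (d, e) =
    (if d then (p : ℝ) else 1 - p) * if e then (r : ℝ) else 1 - r := by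
  have hp := p.2
  have hr := r.2
  rw [eventWeight, eventLaw_apply, ENNReal.toReal_mul, ber_apply, ber_apply]
  cases d <;> cases e <;>
    simp [ENNReal.toReal_ofReal, hp.1, hr.1, sub_nonneg.2 hp.2, sub_nonneg.2 hr.2]

theorem sum_eventWeight (p r : unitInterval) : ∑ a, eventWeight p r a = 1 := by
  simp only [Fintype.sum_prod_type, Fintype.sum_bool, eventWeight_apply]
  simp
  ring

theorem keptCount_eq_sum {n : ℕ} (σ : Fin n → Bool × Bool) (a : ℕ) :
    (keptCount σ a : ℝ) = ∑ k ∈ Finset.univ.filter (fun k : Fin n => (k : ℕ) < a),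
      ({x | x.1 = false} : Set (Bool × Bool)).indicator 1 (σ k) := by
  classical
  rw [keptCount, ← Finset.filter_filter, Finset.card_filter]
  push_cast
  exact Finset.sum_congr rfl fun k _ => by simp [Set.indicator_apply]

theorem copiedCount_eq_sum {n : ℕ} (σ : Fin n → Bool × Bool) (a : ℕ) :
    (copiedCount σ a : ℝ) = ∑ k ∈ Finset.univ.filter (fun k : Fin n => (k : ℕ) < a),
      ({(false, false)} : Set (Bool × Bool)).indicator 1 (σ k) := by
  classical
  rw [copiedCount, ← Finset.filter_filter, Finset.card_filter]
  push_cast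
  exact Finset.sum_congr rfl fun k _ => by simp [Set.indicator_apply]

/-- A union bound over N + 1 prefixes and two kinds of counts, each with a two-sided Chernoff bound.
-/
theorem Prb_not_regular_le (p r : unitInterval) {N : ℕ} (hN : 0 < N) {δ : ℝ} (hδ0 : 0 < δ)
    (hδ1 : δ ≤ 1) :
    Prb (eventWeight p r) {σ : Fin (N * expansion N) → Bool × Bool |
      ¬Regular (1 - p) ((1 - p) * (1 - r)) (δ * expansion N) σ} ≤
      4 * (N + 1) * Real.exp (-(δ ^ 2 / 2 * N)) := by
  set m := expansion N with hm
  have hp := p.2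
  have hr := r.2
  have hN' : (1 : ℝ) ≤ N := by exact_mod_cast hN
  have hm2 : 2 * (N : ℝ) ^ 2 ≤ m := by
    rw [hm, expansion]; push_cast; linarith
  let E : Bool → Set (Bool × Bool) := fun b => if b then {x | x.1 = false} else {(false, false)}
  let μ : Bool → ℝ := fun b => if b then 1 - p else (1 - p) * (1 - r)
  let s (i : ℕ) : Finset (Fin (N * m)) := Finset.univ.filter fun k => (k : ℕ) < i * m
  have hpr0 : 0 ≤ (1 - (p : ℝ)) * (1 - r) :=
    mul_nonneg (sub_nonneg.2 hp.2) (sub_nonneg.2 hr.2)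
  have hpr1 : (1 - (p : ℝ)) * (1 - r) ≤ 1 :=
    mul_le_one₀ (by linarith [hp.1]) (sub_nonneg.2 hr.2) (by linarith [hr.1])
  have hstep : ∀ x ∈ Finset.range (N + 1) ×ˢ (Finset.univ : Finset Bool),
      Prb (eventWeight p r) {σ : Fin (N * m) → Bool × Bool | δ * m <
        |∑ k ∈ s x.1, (E x.2).indicator 1 (σ k) - μ x.2 * (s x.1).card|} ≤
      2 * Real.exp (-(δ ^ 2 / 2 * N)) := by
    rintro ⟨i, b⟩ hi
    have hi' : i ≤ N := by
      simp only [Finset.mem_product, Finset.mem_range] at hi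
      omega
    refine (Prb_deviation_le (eventWeight_nonneg p r) (sum_eventWeight p r) (E b) (μ := μ b) ?_ ?_ ?_
      (s i) (l := δ / (2 * N)) (by positivity) ?_ (δ * m)).trans ?_
    · cases b
      · exact hpr0
      · exact sub_nonneg.2 hp.2
    · cases b
      · exact hpr1
      · exact sub_le_self _ hp.1
    · simp only [Fintype.sum_prod_type, Fintype.sum_bool, eventWeight_apply, E, μ]
      cases b
      · simp
      · simp
        ring
    · rw [div_le_one (by positivity)]
      linarith
    · have hcard : ((s i).card : ℝ) ≤ N * m := by
        exact_mod_cast (Finset.card_le_univ _).trans_eq (Fintype.card_fin _)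
      refine mul_le_mul_of_nonneg_left (Real.exp_le_exp.2 ?_) (by norm_num)
      -- The choice l = δ / (2N) minimizes l² N m - l δ m. The minimum is -δ² m / (4N), and m ≥ 2N²
      -- makes it linear in N: here the quadratic block length is used.
      calc (δ / (2 * N)) ^ 2 * (s i).card - δ / (2 * N) * (δ * m)
          ≤ (δ / (2 * N)) ^ 2 * (N * m) - δ / (2 * N) * (δ * m) := by gcongr
        _ = -(δ ^ 2 / (4 * N) * m) := by field_simp; ring
        _ ≤ -(δ ^ 2 / (4 * N) * (2 * N ^ 2)) := by gcongr
        _ = -(δ ^ 2 / 2 * N) := by field_simp; ring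
  refine (Prb_mono (eventWeight_nonneg p r) fun σ hσ => ?_).trans
    ((Prb_biUnion_le (eventWeight_nonneg p r) _ _).trans
      ((Finset.sum_le_sum hstep).trans_eq ?_))
  · by_contra hcon
    simp only [Set.mem_iUnion, Set.mem_ofPred_eq, exists_prop, not_exists, not_and, not_lt,
      Finset.mem_product, Finset.mem_range, Finset.mem_univ, and_true] at hcon
    have hcard : ∀ i ≤ N, ((s i).card : ℝ) = i * m := fun i hi => by
      rw [Fin.card_filter_val_lt, min_eq_right (Nat.mul_le_mul_right m hi)]
      push_cast; rfl
    refine hσ ⟨fun i hi => ?_, fun i hi => ?_⟩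
    · have := hcon (i, true) (by simp only; omega)
      rw [hcard i hi] at this
      rw [keptCount_eq_sum]
      exact this
    · have := hcon (i, false) (by simp only; omega)
      rw [hcard i hi] at this
      rw [copiedCount_eq_sum]
      exact this
  · simp only [Finset.sum_const, Finset.card_product, Finset.card_range, Finset.card_univ,
      Fintype.card_bool, nsmul_eq_mul]
    push_cast
    ring

/-! ## The inner channel is bounded -/

theorem negligible_exp {c : ℝ} (hc : 0 < c) : Negligible fun n => Real.exp (-(c * n)) := by
  rw [Negligible, superpolynomialDecay_iff_isLittleO _ tendsto_natCast_atTop_atTop]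
  intro z
  have h := (isLittleO_exp_neg_mul_rpow_atTop hc z).comp_tendsto
    (tendsto_natCast_atTop_atTop (R := ℝ))
  refine h.congr (fun n => ?_) fun n => ?_
  · simp [Function.comp]
  · simp [Function.comp]

/-- The tolerance is d = g m / 16, the largest that leaves half of the expected overlap; the
condition 16 ≤ g m makes it at least 1. -/
theorem Pr_innerChannel_le {p q r : unitInterval} (hr : (r : ℝ) = 2 * q) {N : ℕ} (hN : 0 < N)
    {g : ℝ} (hg : (1 - (p : ℝ)) * (1 - r) = g) (hg0 : 0 < g) (hgN : 16 ≤ g * expansion N) :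
    Pr ((uniformString N).bind fun x =>
        (innerChannel ((BSC q).comp (BDC p)) x).map fun y => diffWeight y x)
      {w | (1 / 2 - g ^ 2 / 512) * (N : ℝ) < (w : ℝ)} ≤
      4 * (N + 1) * Real.exp (-((g / 16) ^ 2 / 2 * N)) +
        3 * Real.exp (-((g ^ 2 / 3072) ^ 2 * N)) := by
  classical
  have hp := p.2
  have hr' := r.2
  have hgp : g ≤ 1 - p := by
    rw [← hg]
    exact mul_le_of_le_one_right (sub_nonneg.2 hp.2) (sub_le_self _ hr'.1)
  have hp1 : 1 - (p : ℝ) ≤ 1 := sub_le_self _ hp.1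
  rw [innerChannel_law' hr]
  refine (Pr_bind_le _ _ _
    {σ | ¬Regular (1 - p) ((1 - p) * (1 - r)) (g / 16 * expansion N) σ} _
    (by positivity) fun σ hσ => ?_).trans (add_le_add_left ?_ _)
  · rw [Pr_map, Pr_uniformOfFintype]
    rw [Set.mem_ofPred_eq, not_not, hg] at hσ
    exact hσ.Prb_errors_le (by linarith) hg0 hgp hp1 (by linarith)
  · rw [Pr_piLaw]
    exact Prb_not_regular_le p r hN (by positivity) (by linarith)

theorem isBounded_innerChannel {p q r : unitInterval} (hr : (r : ℝ) = 2 * q) {g : ℝ}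
    (hg : (1 - (p : ℝ)) * (1 - r) = g) (hg0 : 0 < g) :
    (innerChannel ((BSC q).comp (BDC p))).IsBounded (1 / 2 - g ^ 2 / 512) := by
  constructor
  · intro x y hy
    rw [innerChannel, PMF.mem_support_bind_iff] at hy
    obtain ⟨z, -, hy⟩ := hy
    rw [PMF.mem_support_bind_iff] at hy
    obtain ⟨z, -, hy⟩ := hy
    exact length_of_mem_support_majDec _ _ _ hy
  -- The negligible function is the error probability itself, so the estimate is needed only for
  -- large `n`.
  · refine ⟨_, ?_, fun n => le_rfl⟩
    have h1 : Negligible fun n : ℕ => 4 * (n + 1) * Real.exp (-((g / 16) ^ 2 / 2 * n)) := by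
      have h := negligible_exp (c := (g / 16) ^ 2 / 2) (by positivity)
      exact ((h.param_mul.add h).const_mul 4).congr fun n => by
        simp only [Pi.mul_apply, Pi.add_apply]
        ring
    have h2 : Negligible fun n : ℕ => 3 * Real.exp (-((g ^ 2 / 3072) ^ 2 * n)) :=
      SuperpolynomialDecay.const_mul (negligible_exp (by positivity)) 3
    refine SuperpolynomialDecay.trans_eventually_abs_le (h1.add h2) ?_
    filter_upwards [eventually_ge_atTop (Nat.ceil (16 / g)), eventually_gt_atTop 0] with N hN hN0
    simp only [Function.comp, Pi.add_apply]
    rw [abs_of_nonneg (Pr_nonneg _ _), abs_of_nonneg (by positivity)]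
    refine Pr_innerChannel_le hr hN0 hg hg0 ?_
    have h3 : 16 / g ≤ N := (Nat.le_ceil _).trans (by exact_mod_cast hN)
    have h4 : (N : ℝ) ≤ expansion N := by
      have : N ≤ expansion N := by rw [expansion]; nlinarith
      exact_mod_cast this
    rw [div_le_iff₀ hg0] at h3
    nlinarith

/-- Since log⁶ n = O(n), a quadratic length is more than enough. -/
theorem isBigO_expansion :
    (fun n : ℕ => (n : ℝ) * Real.logb 2 (n : ℝ) ^ 6) =O[atTop] fun n => (expansion n : ℝ) := by
  have h1 : (fun n : ℕ => Real.logb 2 (n : ℝ) ^ 6) =O[atTop] fun n : ℕ => (n : ℝ) :=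
    ((Real.isLittleO_pow_logb_id_atTop (b := 2) (n := 6)).comp_tendsto
      (tendsto_natCast_atTop_atTop (R := ℝ))).isBigO
  refine ((isBigO_refl (fun n : ℕ => (n : ℝ)) atTop).mul h1).trans ?_
  refine IsBigO.of_bound 1 (Eventually.of_forall fun n => ?_)
  rw [one_mul, Real.norm_of_nonneg (by positivity), Real.norm_of_nonneg (by positivity), expansion]
  push_cast
  nlinarith

end PRC

end

theorem mainTheorem4 (p q : unitInterval) (hp0 : 0 < (p : ℝ)) (hp1 : (p : ℝ) < 1)
    (hq0 : 0 < (q : ℝ)) (hq1 : (q : ℝ) < 1 / 2) :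
    ∃ ε : ℝ, 0 < ε ∧ ε < 1 / 2 ∧
      ∀ (mode : PRC.KeyMode) (S : PRC.Scheme), PRC.PolyTimeLength S.blockLen →
        (∀ E : PRC.Channel, E.IsBounded (1 / 2 - ε) → S.IsPRC mode E) →
        ∃ (m : ℕ → ℕ) (hm : ∀ n, Odd (m n)),
          (fun n : ℕ => (n : ℝ) * Real.logb 2 (n : ℝ) ^ 6) =O[Filter.atTop]
            (fun n : ℕ => (m n : ℝ)) ∧
          (S.del m hm).IsPRC mode ((PRC.BSC q).comp (PRC.BDC p)) := by
  -- The replacement rate 2q is a probability less than 1 because q < 1/2; this makes g positive.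
  have hr : 2 * (q : ℝ) ∈ unitInterval := ⟨by linarith, by linarith⟩
  have hg0 : 0 < (1 - (p : ℝ)) * (1 - 2 * q) := mul_pos (by linarith) (by linarith)
  have hg1 : (1 - (p : ℝ)) * (1 - 2 * q) < 1 :=
    mul_lt_one_of_nonneg_of_lt_one_left (by linarith) (by linarith) (by linarith)
  refine ⟨((1 - (p : ℝ)) * (1 - 2 * q)) ^ 2 / 512, by positivity, ?_, fun mode S hn hS => ?_⟩
  · have := pow_le_one₀ (n := 2) hg0.le hg1.le
    linarith
  · exact ⟨PRC.expansion, PRC.odd_expansion, PRC.isBigO_expansion, PRC.isPRC_del hn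
      (hS _ (PRC.isBounded_innerChannel (r := ⟨2 * q, hr⟩) rfl rfl hg0))⟩
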